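/- Let $\mathbf K=\mathbb R$ or $\mathbb C$, let $q\in\mathbf K$ be generic (nonzero and not a root of unity) and let $c\in\mathbf K$, $c\ne 0$. Let $U_q(sl(2))$ be generated by $X,Y,q^{\pm H}$ with $q^HX=q^2Xq^H$, $Yq^H=q^2q^HY$, $[X,Y]=\frac{q^H-q^{-H}}{q-q^{-1}}$ and coproduct $\Delta X=X\otimes 1+q^{-H}\otimes X$, $\Delta Y=1\otimes Y+Y\otimes q^H$, $\Delta q^H=q^H\otimes q^H$. Let $V=\mathrm{Span}(u,v,w)$ be the module with $X.u=0$, $X.v=-(q+q^{-1})u$, $X.w=v$, $Y.u=-v$, $Y.v=(q+q^{-1})w$, $Y.w=0$, $q^H.u=q^2u$, $q^H.v=v$, $q^H.w=q^{-2}w$. Let $A=\mathcal A^c_{0,q}$ be the $U_q(sl(2))$-covariant algebra generated by $u,v,w$ with the relations $$q^2uv=vu,\quad (q^3+q)(uw-wu)+(1-q^2)v^2=0,\quad q^2vw=wv,\quad (q^3+q)uw+v^2+(q+q^{-1})wu=c,$$ and let $V_k\subset A$ be its component of spin $k$ (so $V_1=V$). For a $U_q(sl(2))$-module $P$, the component $P_j$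 of spin $j$ is the sum of its irreducible submodules of spin $j$, i.e. of dimension $2j+1$ with a highest weight vector on which $q^H$ acts by $q^{2j}$. Let $V'=\mathrm{Span}(U,V,W)$ be a copy of the module $V$ (with $U,V,W$ corresponding to $u,v,w$). The left and right tangent modules are $$T(H_q)_l=(A\otimes V')/A\,\kappa,\quad \kappa=(q^3+q)uW+vV+(q+q^{-1})wU,$$ $$T(H_q)_r=(V'\otimes A)/\bar\kappa\, A,\quad \bar\kappa=(q^3+q)Uw+Vv+(q+q^{-1})Wu,$$ with the induced $U_q(sl(2))$-actions. Then: 1. The components $V'$ and $(V_k\otimes V')_{k}$, $(V_k\otimes V')_{k+1}$, $k\ge 1$, of $A\otimes V'$ map injectively to $T(H_q)_l$; their images are irreducible $U_q(sl(2))$-submodules of spins $1$ and $k$, $k+1$ respectively, and $T(H_q)_l$ is the direct sum of all these images. For every $k\ge 1$, the image of $(V_k\otimes V')_{k-1}$ in $T(H_q)_l$ is contained in the sum of the images of $V_j\otimes V'$, $j<k-1$. 2. The same holds for $T(H_q)_r$, with the components $V'$, $(V'\otimes V_k)_k$, $(V'\otimes V_k)_{k+1}$, $(V'\otimes V_k)_{k-1}$,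 and with $V'\otimes V_j$ in place of $V_j\otimes V'$. 3. There is an isomorphism of $U_q(sl(2))$-modules $\alpha:T(H_q)_l\to T(H_q)_r$ that maps the image of $V'$ onto the image of $V'$ and the image of $(V_k\otimes V')_j$ onto the image of $(V'\otimes V_k)_j$ for all $k\ge1$, $j\in\{k,k+1\}$. It is unique up to a constant factor on each component: every $U_q(sl(2))$-morphism $\beta:T(H_q)_l\to T(H_q)_r$ that maps each of these images into the corresponding one equals a scalar multiple of $\alpha$ on each of them. -/

import Mathlib

open scoped TensorProduct

namespace QHyp

noncomputable section

universe u v w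

section QuantumGroup

variable {𝕜 : Type u} [Field 𝕜]

/-- Names of the generators of `U_q(sl(2))`; `K` stands for `q^H` and `Kinv` for `q^{-H}`. -/
inductive UqGen : Type
  | X
  | Y
  | K
  | Kinv

open FreeAlgebra in
/-- Defining relations of `U_q(sl(2))`, with `K = q^H`:
`K K⁻¹ = K⁻¹ K = 1`, `K X = q² X K`, `Y K = q² K Y`, `(q - q⁻¹) [X, Y] = K - K⁻¹`. -/
inductive UqRel (q : 𝕜ˣ) : FreeAlgebra 𝕜 UqGen → FreeAlgebra 𝕜 UqGen → Prop
  | K_mul_Kinv : UqRel q (ι 𝕜 UqGen.K * ι 𝕜 UqGen.Kinv) 1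
  | Kinv_mul_K : UqRel q (ι 𝕜 UqGen.Kinv * ι 𝕜 UqGen.K) 1
  | K_X : UqRel q (ι 𝕜 UqGen.K * ι 𝕜 UqGen.X) ((q : 𝕜) ^ 2 • (ι 𝕜 UqGen.X * ι 𝕜 UqGen.K))
  | Y_K : UqRel q (ι 𝕜 UqGen.Y * ι 𝕜 UqGen.K) ((q : 𝕜) ^ 2 • (ι 𝕜 UqGen.K * ι 𝕜 UqGen.Y))
  | X_Y : UqRel q
      (((q : 𝕜) - (q : 𝕜)⁻¹) • (ι 𝕜 UqGen.X * ι 𝕜 UqGen.Y - ι 𝕜 UqGen.Y * ι 𝕜 UqGen.X))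
      (ι 𝕜 UqGen.K - ι 𝕜 UqGen.Kinv)

/-- The quantum group `U_q(sl(2))`, as an associative algebra. -/
def Uq (q : 𝕜ˣ) : Type u := RingQuot (UqRel q)

instance (q : 𝕜ˣ) : Ring (Uq q) := inferInstanceAs (Ring (RingQuot (UqRel q)))

instance (q : 𝕜ˣ) : Algebra 𝕜 (Uq q) := inferInstanceAs (Algebra 𝕜 (RingQuot (UqRel q)))

/-- The projection of the free algebra onto `U_q(sl(2))`. -/
def uqMk (q : 𝕜ˣ) : FreeAlgebra 𝕜 UqGen →ₐ[𝕜] Uq q := RingQuot.mkAlgHom 𝕜 (UqRel q)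

theorem uqMk_surjective (q : 𝕜ˣ) : Function.Surjective (uqMk q) :=
  RingQuot.mkAlgHom_surjective 𝕜 (UqRel q)

theorem uqMk_rel {q : 𝕜ˣ} {x y : FreeAlgebra 𝕜 UqGen} (h : UqRel q x y) : uqMk q x = uqMk q y :=
  RingQuot.mkAlgHom_rel 𝕜 h

/-- The generators as elements of `U_q(sl(2))`. -/
def uqGen (q : 𝕜ˣ) (g : UqGen) : Uq q :=
  uqMk q (FreeAlgebra.ι 𝕜 g)

/-- Algebra homomorphisms out of `U_q(sl(2))` are given by the images of the generators. -/
def uqLift (q : 𝕜ˣ) {B : Type v} [Ring B] [Algebra 𝕜 B] (X Y K Kinv : B)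
    (h1 : K * Kinv = 1) (h2 : Kinv * K = 1) (h3 : K * X = (q : 𝕜) ^ 2 • (X * K))
    (h4 : Y * K = (q : 𝕜) ^ 2 • (K * Y))
    (h5 : ((q : 𝕜) - (q : 𝕜)⁻¹) • (X * Y - Y * X) = K - Kinv) : Uq q →ₐ[𝕜] B :=
  RingQuot.liftAlgHom (s := UqRel q) 𝕜 ⟨FreeAlgebra.lift 𝕜 fun g => match g with
    | .X => X | .Y => Y | .K => K | .Kinv => Kinv, by
      intro x y h
      induction h <;> simp [h1, h2, h3, h4, h5]⟩

section lift

variable (q : 𝕜ˣ) {B : Type v} [Ring B] [Algebra 𝕜 B] (X Y K Kinv : B)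
    (h1 : K * Kinv = 1) (h2 : Kinv * K = 1) (h3 : K * X = (q : 𝕜) ^ 2 • (X * K))
    (h4 : Y * K = (q : 𝕜) ^ 2 • (K * Y))
    (h5 : ((q : 𝕜) - (q : 𝕜)⁻¹) • (X * Y - Y * X) = K - Kinv)

@[simp] theorem uqLift_X : uqLift q X Y K Kinv h1 h2 h3 h4 h5 (uqGen q .X) = X := by
  exact (RingQuot.liftAlgHom_mkAlgHom_apply (s := UqRel q) 𝕜 _ _ _).trans (by simp)

@[simp] theorem uqLift_Y : uqLift q X Y K Kinv h1 h2 h3 h4 h5 (uqGen q .Y) = Y := by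
  exact (RingQuot.liftAlgHom_mkAlgHom_apply (s := UqRel q) 𝕜 _ _ _).trans (by simp)

@[simp] theorem uqLift_K : uqLift q X Y K Kinv h1 h2 h3 h4 h5 (uqGen q .K) = K := by
  exact (RingQuot.liftAlgHom_mkAlgHom_apply (s := UqRel q) 𝕜 _ _ _).trans (by simp)

@[simp] theorem uqLift_Kinv : uqLift q X Y K Kinv h1 h2 h3 h4 h5 (uqGen q .Kinv) = Kinv := by
  exact (RingQuot.liftAlgHom_mkAlgHom_apply (s := UqRel q) 𝕜 _ _ _).trans (by simp)

end lift

theorem uq_K_mul_Kinv (q : 𝕜ˣ) : uqGen q .K * uqGen q .Kinv = 1 := by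
  simpa [uqGen] using uqMk_rel (UqRel.K_mul_Kinv (q := q))

theorem uq_Kinv_mul_K (q : 𝕜ˣ) : uqGen q .Kinv * uqGen q .K = 1 := by
  simpa [uqGen] using uqMk_rel (UqRel.Kinv_mul_K (q := q))

theorem uq_K_X (q : 𝕜ˣ) :
    uqGen q .K * uqGen q .X = (q : 𝕜) ^ 2 • (uqGen q .X * uqGen q .K) := by
  simpa [uqGen] using uqMk_rel (UqRel.K_X (q := q))

theorem uq_Y_K (q : 𝕜ˣ) :
    uqGen q .Y * uqGen q .K = (q : 𝕜) ^ 2 • (uqGen q .K * uqGen q .Y) := by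
  simpa [uqGen] using uqMk_rel (UqRel.Y_K (q := q))

theorem uq_X_Y (q : 𝕜ˣ) :
    ((q : 𝕜) - (q : 𝕜)⁻¹) • (uqGen q .X * uqGen q .Y - uqGen q .Y * uqGen q .X) =
      uqGen q .K - uqGen q .Kinv := by
  simpa only [uqGen, map_smul, map_sub, map_mul] using
    uqMk_rel (UqRel.X_Y (q := q))

theorem uq_X_Kinv (q : 𝕜ˣ) :
    uqGen q .X * uqGen q .Kinv = (q : 𝕜) ^ 2 • (uqGen q .Kinv * uqGen q .X) := by
  have h := congrArg (fun z => uqGen q .Kinv * z * uqGen q .Kinv) (uq_K_X q)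
  simp only [mul_smul_comm, smul_mul_assoc] at h
  rw [← mul_assoc, uq_Kinv_mul_K, one_mul, mul_assoc, mul_assoc, uq_K_mul_Kinv, mul_one] at h
  exact h

theorem uq_Kinv_Y (q : 𝕜ˣ) :
    uqGen q .Kinv * uqGen q .Y = (q : 𝕜) ^ 2 • (uqGen q .Y * uqGen q .Kinv) := by
  have h := congrArg (fun z => uqGen q .Kinv * z * uqGen q .Kinv) (uq_Y_K q)
  simp only [mul_smul_comm, smul_mul_assoc] at h
  rw [← mul_assoc, mul_assoc, uq_K_mul_Kinv, mul_one, ← mul_assoc, uq_Kinv_mul_K, one_mul] at h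
  exact h

/-- The coproduct of `U_q(sl(2))`:
`Δ X = X ⊗ 1 + K⁻¹ ⊗ X`, `Δ Y = 1 ⊗ Y + Y ⊗ K`, `Δ K = K ⊗ K`. -/
def uqComul (q : 𝕜ˣ) : Uq q →ₐ[𝕜] Uq q ⊗[𝕜] Uq q :=
  uqLift q
    (uqGen q .X ⊗ₜ[𝕜] 1 + uqGen q .Kinv ⊗ₜ[𝕜] uqGen q .X)
    (1 ⊗ₜ[𝕜] uqGen q .Y + uqGen q .Y ⊗ₜ[𝕜] uqGen q .K)
    (uqGen q .K ⊗ₜ[𝕜] uqGen q .K)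
    (uqGen q .Kinv ⊗ₜ[𝕜] uqGen q .Kinv)
    (by simp [uq_K_mul_Kinv, Algebra.TensorProduct.one_def])
    (by simp [uq_Kinv_mul_K, Algebra.TensorProduct.one_def])
    (by
      simp [mul_add, add_mul, uq_K_X, uq_K_mul_Kinv, uq_Kinv_mul_K, TensorProduct.smul_tmul'])
    (by
      simp [mul_add, add_mul, uq_Y_K, TensorProduct.smul_tmul'])
    (by
      have e : (uqGen q .X ⊗ₜ[𝕜] 1 + uqGen q .Kinv ⊗ₜ[𝕜] uqGen q .X) *
            (1 ⊗ₜ[𝕜] uqGen q .Y + uqGen q .Y ⊗ₜ[𝕜] uqGen q .K) -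
          (1 ⊗ₜ[𝕜] uqGen q .Y + uqGen q .Y ⊗ₜ[𝕜] uqGen q .K) *
            (uqGen q .X ⊗ₜ[𝕜] 1 + uqGen q .Kinv ⊗ₜ[𝕜] uqGen q .X) =
          (uqGen q .X * uqGen q .Y - uqGen q .Y * uqGen q .X) ⊗ₜ[𝕜] uqGen q .K +
          uqGen q .Kinv ⊗ₜ[𝕜] (uqGen q .X * uqGen q .Y - uqGen q .Y * uqGen q .X) := by
        simp only [mul_add, add_mul, Algebra.TensorProduct.tmul_mul_tmul, mul_one, one_mul,
          uq_K_X, uq_Kinv_Y, TensorProduct.tmul_smul, TensorProduct.sub_tmul,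
          TensorProduct.tmul_sub, ← TensorProduct.smul_tmul']
        abel
      rw [e, smul_add, TensorProduct.smul_tmul', ← TensorProduct.tmul_smul, uq_X_Y,
        TensorProduct.sub_tmul, TensorProduct.tmul_sub]
      abel)

/-- A representation of `U_q(sl(2))` on `M`, i.e. a `U_q(sl(2))`-module structure. -/
abbrev UqRep (q : 𝕜ˣ) (M : Type v) [AddCommGroup M] [Module 𝕜 M] :=
  Uq q →ₐ[𝕜] Module.End 𝕜 M

/-- The tensor product of two `U_q(sl(2))`-modules, the action being through the coproduct. -/
def tensorRep {q : 𝕜ˣ} {M : Type v} {N : Type w} [AddCommGroup M] [Module 𝕜 M] [AddCommGroup N]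
    [Module 𝕜 N] (ρ : UqRep q M) (σ : UqRep q N) : UqRep q (M ⊗[𝕜] N) :=
  ((Module.endTensorEndAlgHom (R := 𝕜) (A := 𝕜) (M := M) (N := N)).comp
    (Algebra.TensorProduct.map ρ σ)).comp (uqComul q)

section tensor

variable {q : 𝕜ˣ} {M : Type v} {N : Type w} [AddCommGroup M] [Module 𝕜 M] [AddCommGroup N]
    [Module 𝕜 N] (ρ : UqRep q M) (σ : UqRep q N) (m : M) (n : N)

theorem tensorRep_X : tensorRep ρ σ (uqGen q .X) (m ⊗ₜ n) =
    ρ (uqGen q .X) m ⊗ₜ n + ρ (uqGen q .Kinv) m ⊗ₜ σ (uqGen q .X) n := by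
  simp [tensorRep, uqComul, Module.endTensorEndAlgHom_apply]

theorem tensorRep_Y : tensorRep ρ σ (uqGen q .Y) (m ⊗ₜ n) =
    m ⊗ₜ σ (uqGen q .Y) n + ρ (uqGen q .Y) m ⊗ₜ σ (uqGen q .K) n := by
  simp [tensorRep, uqComul, Module.endTensorEndAlgHom_apply]

theorem tensorRep_K : tensorRep ρ σ (uqGen q .K) (m ⊗ₜ n) =
    ρ (uqGen q .K) m ⊗ₜ σ (uqGen q .K) n := by
  simp [tensorRep, uqComul, Module.endTensorEndAlgHom_apply]

theorem tensorRep_Kinv : tensorRep ρ σ (uqGen q .Kinv) (m ⊗ₜ n) =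
    ρ (uqGen q .Kinv) m ⊗ₜ σ (uqGen q .Kinv) n := by
  simp [tensorRep, uqComul, Module.endTensorEndAlgHom_apply]

end tensor

/-- A subspace stable under the generators is stable under all of `U_q(sl(2))`. -/
theorem stable_of_gen {q : 𝕜ˣ} {M : Type v} [AddCommGroup M] [Module 𝕜 M] (ρ : UqRep q M)
    (N : Submodule 𝕜 M) (h : ∀ g, ∀ m ∈ N, ρ (uqGen q g) m ∈ N) (z : Uq q) :
    ∀ m ∈ N, ρ z m ∈ N := by
  obtain ⟨z, rfl⟩ := uqMk_surjective q z
  induction z using FreeAlgebra.induction with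
  | grade0 r =>
    intro m hm
    simpa using N.smul_mem r hm
  | grade1 g => exact h g
  | mul a b ha hb =>
    intro m hm
    simpa using ha _ (hb m hm)
  | add a b ha hb =>
    intro m hm
    simpa using N.add_mem (ha m hm) (hb m hm)

/-- The quotient of a `U_q(sl(2))`-module by a stable subspace. -/
def quotRep {q : 𝕜ˣ} {M : Type v} [AddCommGroup M] [Module 𝕜 M] (ρ : UqRep q M)
    (N : Submodule 𝕜 M) (h : ∀ z, ∀ m ∈ N, ρ z m ∈ N) : UqRep q (M ⧸ N) where
  toFun z := N.mapQ N (ρ z) (h z)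
  map_one' := by ext; simp
  map_mul' a b := by ext; simp
  map_zero' := by ext; simp
  map_add' a b := by ext; simp
  commutes' r := by ext; simp

/-- `W` is a `U_q(sl(2))`-submodule of `M` which is irreducible of spin `j`: it is simple, of
dimension `2j+1`, and its highest weight vector has weight `2j`, i.e. `q^H` acts by `q^{2j}`. -/
structure IsSpinModule {q : 𝕜ˣ} {M : Type v} [AddCommGroup M] [Module 𝕜 M] (ρ : UqRep q M)
    (j : ℕ) (W : Submodule 𝕜 M) : Prop where
  stable : ∀ z, ∀ m ∈ W, ρ z m ∈ W
  simple : ∀ W' ≤ W, (∀ z, ∀ m ∈ W', ρ z m ∈ W') → W' = ⊥ ∨ W' = W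
  finrank_eq : Module.finrank 𝕜 W = 2 * j + 1
  highest : ∃ m ∈ W, m ≠ 0 ∧ ρ (uqGen q .X) m = 0 ∧ ρ (uqGen q .K) m = (q : 𝕜) ^ (2 * j) • m

/-- The spin `j` component `P_j` of a submodule `P`: the sum of all irreducible submodules of
spin `j` contained in `P`. -/
def spinComponent {q : 𝕜ˣ} {M : Type v} [AddCommGroup M] [Module 𝕜 M] (ρ : UqRep q M)
    (P : Submodule 𝕜 M) (j : ℕ) : Submodule 𝕜 M :=
  sSup {W | W ≤ P ∧ IsSpinModule ρ j W}

/-- The three-dimensional space `V`; its basis `u, v, w` is `basisV 0, basisV 1, basisV 2`. -/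
abbrev V (𝕜 : Type u) : Type u := Fin 3 → 𝕜

/-- The basis vectors of `V`. -/
def basisV (𝕜 : Type u) [Field 𝕜] (i : Fin 3) : V 𝕜 := Pi.single i 1

/-- The `U_q(sl(2))`-module `V`:
`X.u = 0`, `X.v = -(q+q⁻¹)u`, `X.w = v`, `Y.u = -v`, `Y.v = (q+q⁻¹)w`, `Y.w = 0`,
`H.u = 2u`, `H.v = 0`, `H.w = -2w`. -/
def vRep (q : 𝕜ˣ) : UqRep q (V 𝕜) :=
  (Matrix.toLinAlgEquiv' (R := 𝕜) (n := Fin 3)).toAlgHom.comp (uqLift q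
    !![0, -((q : 𝕜) + (q : 𝕜)⁻¹), 0; 0, 0, 1; 0, 0, 0]
    !![0, 0, 0; -1, 0, 0; 0, (q : 𝕜) + (q : 𝕜)⁻¹, 0]
    !![(q : 𝕜) ^ 2, 0, 0; 0, 1, 0; 0, 0, ((q : 𝕜)⁻¹) ^ 2]
    !![((q : 𝕜)⁻¹) ^ 2, 0, 0; 0, 1, 0; 0, 0, (q : 𝕜) ^ 2]
    (by ext i j; fin_cases i <;> fin_cases j <;> simp [Matrix.mul_apply, Fin.sum_univ_three])
    (by ext i j; fin_cases i <;> fin_cases j <;> simp [Matrix.mul_apply, Fin.sum_univ_three])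
    (by ext i j; fin_cases i <;> fin_cases j <;> simp [Matrix.mul_apply, Fin.sum_univ_three])
    (by ext i j; fin_cases i <;> fin_cases j <;> simp)
    (by
      have hq : (q : 𝕜) ≠ 0 := q.ne_zero
      ext i j
      fin_cases i <;> fin_cases j <;> simp [Matrix.mul_apply, Fin.sum_univ_three] <;> ring))

section v

variable (q : 𝕜ˣ)

theorem vRep_X_u : vRep q (uqGen q .X) (basisV 𝕜 0) = 0 := by
  ext i; fin_cases i <;> simp [vRep, basisV]

theorem vRep_X_v : vRep q (uqGen q .X) (basisV 𝕜 1) =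
    -((q : 𝕜) + (q : 𝕜)⁻¹) • basisV 𝕜 0 := by
  ext i; fin_cases i <;> simp [vRep, basisV]

theorem vRep_X_w : vRep q (uqGen q .X) (basisV 𝕜 2) = basisV 𝕜 1 := by
  ext i; fin_cases i <;> simp [vRep, basisV]

theorem vRep_Y_u : vRep q (uqGen q .Y) (basisV 𝕜 0) = -basisV 𝕜 1 := by
  ext i; fin_cases i <;> simp [vRep, basisV]

theorem vRep_Y_v : vRep q (uqGen q .Y) (basisV 𝕜 1) =
    ((q : 𝕜) + (q : 𝕜)⁻¹) • basisV 𝕜 2 := by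
  ext i; fin_cases i <;> simp [vRep, basisV]

theorem vRep_Y_w : vRep q (uqGen q .Y) (basisV 𝕜 2) = 0 := by
  ext i; fin_cases i <;> simp [vRep, basisV]

theorem vRep_K_u : vRep q (uqGen q .K) (basisV 𝕜 0) = (q : 𝕜) ^ 2 • basisV 𝕜 0 := by
  ext i; fin_cases i <;> simp [vRep, basisV]

theorem vRep_K_v : vRep q (uqGen q .K) (basisV 𝕜 1) = basisV 𝕜 1 := by
  ext i; fin_cases i <;> simp [vRep, basisV]

theorem vRep_K_w : vRep q (uqGen q .K) (basisV 𝕜 2) = ((q : 𝕜)⁻¹) ^ 2 • basisV 𝕜 2 := by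
  ext i; fin_cases i <;> simp [vRep, basisV]

theorem vRep_Kinv_u : vRep q (uqGen q .Kinv) (basisV 𝕜 0) = ((q : 𝕜)⁻¹) ^ 2 • basisV 𝕜 0 := by
  ext i; fin_cases i <;> simp [vRep, basisV]

theorem vRep_Kinv_v : vRep q (uqGen q .Kinv) (basisV 𝕜 1) = basisV 𝕜 1 := by
  ext i; fin_cases i <;> simp [vRep, basisV]

theorem vRep_Kinv_w : vRep q (uqGen q .Kinv) (basisV 𝕜 2) = (q : 𝕜) ^ 2 • basisV 𝕜 2 := by
  ext i; fin_cases i <;> simp [vRep, basisV]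

end v

end QuantumGroup

section Hyperboloid

variable {𝕜 : Type u} [Field 𝕜]

open FreeAlgebra in
/-- Defining relations of the algebra of functions on the quantum hyperboloid, where `u, v, w`
are the generators `0, 1, 2`; the last one says that the braided Casimir element equals `c`. -/
inductive QHRel (q : 𝕜ˣ) (c : 𝕜) : FreeAlgebra 𝕜 (Fin 3) → FreeAlgebra 𝕜 (Fin 3) → Prop
  | uv : QHRel q c ((q : 𝕜) ^ 2 • (ι 𝕜 0 * ι 𝕜 1) - ι 𝕜 1 * ι 𝕜 0) 0
  | uw : QHRel q c (((q : 𝕜) ^ 3 + (q : 𝕜)) • (ι 𝕜 0 * ι 𝕜 2 - ι 𝕜 2 * ι 𝕜 0) +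
      (1 - (q : 𝕜) ^ 2) • (ι 𝕜 1 * ι 𝕜 1)) 0
  | vw : QHRel q c (-((q : 𝕜) ^ 2 • (ι 𝕜 1 * ι 𝕜 2)) + ι 𝕜 2 * ι 𝕜 1) 0
  | casimir : QHRel q c (((q : 𝕜) ^ 3 + (q : 𝕜)) • (ι 𝕜 0 * ι 𝕜 2) + ι 𝕜 1 * ι 𝕜 1 +
      ((q : 𝕜) + (q : 𝕜)⁻¹) • (ι 𝕜 2 * ι 𝕜 0)) (algebraMap 𝕜 _ c)

/-- The algebra of functions on the quantum hyperboloid. -/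
def QH (q : 𝕜ˣ) (c : 𝕜) : Type u := RingQuot (QHRel q c)

instance (q : 𝕜ˣ) (c : 𝕜) : Ring (QH q c) := inferInstanceAs (Ring (RingQuot (QHRel q c)))

instance (q : 𝕜ˣ) (c : 𝕜) : Algebra 𝕜 (QH q c) :=
  inferInstanceAs (Algebra 𝕜 (RingQuot (QHRel q c)))

/-- The projection of the free algebra onto `QH q c`. -/
def qhMk (q : 𝕜ˣ) (c : 𝕜) : FreeAlgebra 𝕜 (Fin 3) →ₐ[𝕜] QH q c :=
  RingQuot.mkAlgHom 𝕜 (QHRel q c)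

theorem qhMk_surjective (q : 𝕜ˣ) (c : 𝕜) : Function.Surjective (qhMk q c) :=
  RingQuot.mkAlgHom_surjective 𝕜 (QHRel q c)

theorem qhMk_rel {q : 𝕜ˣ} {c : 𝕜} {x y : FreeAlgebra 𝕜 (Fin 3)} (h : QHRel q c x y) :
    qhMk q c x = qhMk q c y :=
  RingQuot.mkAlgHom_rel 𝕜 h

/-- The generators `u, v, w` (for `i = 0, 1, 2`) of the algebra `QH q c`. -/
def qhGen (q : 𝕜ˣ) (c : 𝕜) (i : Fin 3) : QH q c :=
  qhMk q c (FreeAlgebra.ι 𝕜 i)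

/-- Algebra homomorphisms out of `QH q c` are given by the images of `u, v, w`. -/
def qhLift (q : 𝕜ˣ) (c : 𝕜) {B : Type v} [Ring B] [Algebra 𝕜 B] (x y z : B)
    (h1 : (q : 𝕜) ^ 2 • (x * y) - y * x = 0)
    (h2 : ((q : 𝕜) ^ 3 + (q : 𝕜)) • (x * z - z * x) + (1 - (q : 𝕜) ^ 2) • (y * y) = 0)
    (h3 : -((q : 𝕜) ^ 2 • (y * z)) + z * y = 0)
    (h4 : ((q : 𝕜) ^ 3 + (q : 𝕜)) • (x * z) + y * y + ((q : 𝕜) + (q : 𝕜)⁻¹) • (z * x) =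
      algebraMap 𝕜 B c) : QH q c →ₐ[𝕜] B :=
  RingQuot.liftAlgHom (s := QHRel q c) 𝕜 ⟨FreeAlgebra.lift 𝕜 ![x, y, z], by
    intro a b h
    induction h
    · simpa using h1
    · simpa using h2
    · simpa using h3
    · simpa using h4⟩

section lift

variable (q : 𝕜ˣ) (c : 𝕜) {B : Type v} [Ring B] [Algebra 𝕜 B] (x y z : B)
    (h1 : (q : 𝕜) ^ 2 • (x * y) - y * x = 0)
    (h2 : ((q : 𝕜) ^ 3 + (q : 𝕜)) • (x * z - z * x) + (1 - (q : 𝕜) ^ 2) • (y * y) = 0)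
    (h3 : -((q : 𝕜) ^ 2 • (y * z)) + z * y = 0)
    (h4 : ((q : 𝕜) ^ 3 + (q : 𝕜)) • (x * z) + y * y + ((q : 𝕜) + (q : 𝕜)⁻¹) • (z * x) =
      algebraMap 𝕜 B c)

@[simp] theorem qhLift_u : qhLift q c x y z h1 h2 h3 h4 (qhGen q c 0) = x := by
  exact (RingQuot.liftAlgHom_mkAlgHom_apply (s := QHRel q c) 𝕜 _ _ _).trans (by simp)

@[simp] theorem qhLift_v : qhLift q c x y z h1 h2 h3 h4 (qhGen q c 1) = y := by
  exact (RingQuot.liftAlgHom_mkAlgHom_apply (s := QHRel q c) 𝕜 _ _ _).trans (by simp)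

@[simp] theorem qhLift_w : qhLift q c x y z h1 h2 h3 h4 (qhGen q c 2) = z := by
  exact (RingQuot.liftAlgHom_mkAlgHom_apply (s := QHRel q c) 𝕜 _ _ _).trans (by simp)

end lift

variable (q : 𝕜ˣ) (c : 𝕜)

theorem qh_vu : qhGen q c 1 * qhGen q c 0 = (q : 𝕜) ^ 2 • (qhGen q c 0 * qhGen q c 1) := by
  have h := qhMk_rel (QHRel.uv (q := q) (c := c))
  simp only [map_sub, map_smul, map_mul, map_zero] at h
  exact (sub_eq_zero.mp h).symm

theorem qh_wv : qhGen q c 2 * qhGen q c 1 = (q : 𝕜) ^ 2 • (qhGen q c 1 * qhGen q c 2) := by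
  have h := qhMk_rel (QHRel.vw (q := q) (c := c))
  simp only [map_add, map_neg, map_smul, map_mul, map_zero] at h
  exact (neg_add_eq_zero.mp h).symm

theorem qh_uw : ((q : 𝕜) ^ 3 + (q : 𝕜)) • (qhGen q c 0 * qhGen q c 2 - qhGen q c 2 * qhGen q c 0) +
    (1 - (q : 𝕜) ^ 2) • (qhGen q c 1 * qhGen q c 1) = 0 := by
  have h := qhMk_rel (QHRel.uw (q := q) (c := c))
  simp only [map_sub, map_add, map_smul, map_mul, map_zero] at h
  exact h

theorem qh_casimir : ((q : 𝕜) ^ 3 + (q : 𝕜)) • (qhGen q c 0 * qhGen q c 2) +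
    qhGen q c 1 * qhGen q c 1 + ((q : 𝕜) + (q : 𝕜)⁻¹) • (qhGen q c 2 * qhGen q c 0) =
    algebraMap 𝕜 _ c := by
  have h := qhMk_rel (QHRel.casimir (q := q) (c := c))
  simp only [map_add, map_smul, map_mul, AlgHom.commutes] at h
  exact h

/-- Induction on the elements of `QH q c`. -/
theorem qh_induction {P : QH q c → Prop} (h0 : ∀ r : 𝕜, P (algebraMap 𝕜 _ r))
    (h1 : ∀ i, P (qhGen q c i)) (hm : ∀ a b, P a → P b → P (a * b))
    (ha : ∀ a b, P a → P b → P (a + b)) (a : QH q c) : P a := by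
  obtain ⟨a, rfl⟩ := qhMk_surjective q c a
  induction a using FreeAlgebra.induction with
  | grade0 r => simpa using h0 r
  | grade1 g => exact h1 g
  | mul a b iha ihb => simpa using hm _ _ iha ihb
  | add a b iha ihb => simpa using ha _ _ iha ihb

/-- The action of `K = q^H` on `QH q c`: an algebra automorphism. -/
def qhK : QH q c →ₐ[𝕜] QH q c :=
  qhLift q c ((q : 𝕜) ^ 2 • qhGen q c 0) (qhGen q c 1) (((q : 𝕜)⁻¹) ^ 2 • qhGen q c 2)
    (by simp [qh_vu])
    (by
      have h := qh_uw q c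
      simpa [smul_smul] using h)
    (by simp [qh_wv])
    (by
      have h := qh_casimir q c
      simpa [smul_smul] using h)

/-- The action of `K⁻¹ = q^{-H}` on `QH q c`. -/
def qhKinv : QH q c →ₐ[𝕜] QH q c :=
  qhLift q c (((q : 𝕜)⁻¹) ^ 2 • qhGen q c 0) (qhGen q c 1) ((q : 𝕜) ^ 2 • qhGen q c 2)
    (by simp [qh_vu])
    (by
      have h := qh_uw q c
      simpa [smul_smul] using h)
    (by simp [qh_wv])
    (by
      have h := qh_casimir q c
      simpa [smul_smul] using h)

/-- The algebra homomorphism `a ↦ (K⁻¹a, Xa; 0, a)`, which encodes the twisted Leibniz rule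
`X(ab) = (Xa) b + (K⁻¹a)(Xb)` coming from the coproduct. -/
def qhXHom : QH q c →ₐ[𝕜] Matrix (Fin 2) (Fin 2) (QH q c) :=
  qhLift q c
    !![((q : 𝕜)⁻¹) ^ 2 • qhGen q c 0, 0; 0, qhGen q c 0]
    !![qhGen q c 1, -((q : 𝕜) + (q : 𝕜)⁻¹) • qhGen q c 0; 0, qhGen q c 1]
    !![(q : 𝕜) ^ 2 • qhGen q c 2, qhGen q c 1; 0, qhGen q c 2]
    (by
      have hq : (q : 𝕜) ≠ 0 := q.ne_zero
      ext i j
      fin_cases i <;> fin_cases j <;> simp [qh_vu])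
    (by
      have hq : (q : 𝕜) ≠ 0 := q.ne_zero
      ext i j
      fin_cases i <;> fin_cases j <;> simp
      · exact qh_uw q c
      · simp only [qh_vu]
        match_scalars <;> field_simp <;> ring
      · exact qh_uw q c)
    (by
      have hq : (q : 𝕜) ≠ 0 := q.ne_zero
      ext i j
      fin_cases i <;> fin_cases j <;> simp
      · simp [qh_wv]
      · refine Eq.trans ?_ (qh_uw q c)
        match_scalars <;> field_simp <;> ring
      · simp [qh_wv])
    (by
      have hq : (q : 𝕜) ≠ 0 := q.ne_zero
      ext i j
      fin_cases i <;> fin_cases j <;> simp [Matrix.algebraMap_matrix_apply]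
      · exact qh_casimir q c
      · simp only [qh_vu]
        match_scalars <;> field_simp <;> ring
      · exact qh_casimir q c)

/-- The algebra homomorphism `a ↦ (a, Ya; 0, Ka)`, which encodes the twisted Leibniz rule
`Y(ab) = a (Yb) + (Ya)(Kb)` coming from the coproduct. -/
def qhYHom : QH q c →ₐ[𝕜] Matrix (Fin 2) (Fin 2) (QH q c) :=
  qhLift q c
    !![qhGen q c 0, -qhGen q c 1; 0, (q : 𝕜) ^ 2 • qhGen q c 0]
    !![qhGen q c 1, ((q : 𝕜) + (q : 𝕜)⁻¹) • qhGen q c 2; 0, qhGen q c 1]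
    !![qhGen q c 2, 0; 0, ((q : 𝕜)⁻¹) ^ 2 • qhGen q c 2]
    (by
      have hq : (q : 𝕜) ≠ 0 := q.ne_zero
      ext i j
      fin_cases i <;> fin_cases j <;> simp
      · simp [qh_vu]
      · refine Eq.trans ?_ (qh_uw q c)
        match_scalars <;> field_simp <;> ring
      · simp [qh_vu])
    (by
      have hq : (q : 𝕜) ≠ 0 := q.ne_zero
      ext i j
      fin_cases i <;> fin_cases j <;> simp
      · exact qh_uw q c
      · simp only [qh_wv]
        match_scalars <;> field_simp <;> ring
      · exact qh_uw q c)
    (by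
      have hq : (q : 𝕜) ≠ 0 := q.ne_zero
      ext i j
      fin_cases i <;> fin_cases j <;> simp [qh_wv]
      match_scalars <;> field_simp <;> ring)
    (by
      have hq : (q : 𝕜) ≠ 0 := q.ne_zero
      ext i j
      fin_cases i <;> fin_cases j <;> simp [Matrix.algebraMap_matrix_apply]
      · exact qh_casimir q c
      · simp only [qh_wv]
        match_scalars <;> field_simp <;> ring
      · exact qh_casimir q c)

/-- The action of `X` on `QH q c`. -/
def qhX : QH q c →ₗ[𝕜] QH q c :=
  Matrix.entryLinearMap 𝕜 (QH q c) 0 1 ∘ₗ (qhXHom q c).toLinearMap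

/-- The action of `Y` on `QH q c`. -/
def qhY : QH q c →ₗ[𝕜] QH q c :=
  Matrix.entryLinearMap 𝕜 (QH q c) 0 1 ∘ₗ (qhYHom q c).toLinearMap

theorem qhX_def (a : QH q c) : qhX q c a = qhXHom q c a 0 1 := rfl

theorem qhY_def (a : QH q c) : qhY q c a = qhYHom q c a 0 1 := rfl

@[simp] theorem qhK_u : qhK q c (qhGen q c 0) = (q : 𝕜) ^ 2 • qhGen q c 0 := by simp [qhK]
@[simp] theorem qhK_v : qhK q c (qhGen q c 1) = qhGen q c 1 := by simp [qhK]
@[simp] theorem qhK_w : qhK q c (qhGen q c 2) = ((q : 𝕜)⁻¹) ^ 2 • qhGen q c 2 := by simp [qhK]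
@[simp] theorem qhKinv_u : qhKinv q c (qhGen q c 0) = ((q : 𝕜)⁻¹) ^ 2 • qhGen q c 0 := by
  simp [qhKinv]
@[simp] theorem qhKinv_v : qhKinv q c (qhGen q c 1) = qhGen q c 1 := by simp [qhKinv]
@[simp] theorem qhKinv_w : qhKinv q c (qhGen q c 2) = (q : 𝕜) ^ 2 • qhGen q c 2 := by
  simp [qhKinv]
@[simp] theorem qhX_u : qhX q c (qhGen q c 0) = 0 := by simp [qhX_def, qhXHom]
@[simp] theorem qhX_v : qhX q c (qhGen q c 1) = -((q : 𝕜) + (q : 𝕜)⁻¹) • qhGen q c 0 := by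
  simp [qhX_def, qhXHom]
@[simp] theorem qhX_w : qhX q c (qhGen q c 2) = qhGen q c 1 := by simp [qhX_def, qhXHom]
@[simp] theorem qhY_u : qhY q c (qhGen q c 0) = -qhGen q c 1 := by simp [qhY_def, qhYHom]
@[simp] theorem qhY_v : qhY q c (qhGen q c 1) = ((q : 𝕜) + (q : 𝕜)⁻¹) • qhGen q c 2 := by
  simp [qhY_def, qhYHom]
@[simp] theorem qhY_w : qhY q c (qhGen q c 2) = 0 := by simp [qhY_def, qhYHom]

@[simp] theorem qhX_algebraMap (r : 𝕜) : qhX q c (algebraMap 𝕜 _ r) = 0 := by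
  simp [qhX_def, Matrix.algebraMap_matrix_apply]

@[simp] theorem qhY_algebraMap (r : 𝕜) : qhY q c (algebraMap 𝕜 _ r) = 0 := by
  simp [qhY_def, Matrix.algebraMap_matrix_apply]

theorem qhXHom_entries (a : QH q c) :
    qhXHom q c a 0 0 = qhKinv q c a ∧ qhXHom q c a 1 0 = 0 ∧ qhXHom q c a 1 1 = a := by
  induction a using qh_induction with
  | h0 r => simp [Matrix.algebraMap_matrix_apply]
  | h1 i => fin_cases i <;> simp [qhXHom]
  | hm a b ha hb => simp [Matrix.mul_apply, ha, hb]
  | ha a b ha hb => simp [ha, hb]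

theorem qhYHom_entries (a : QH q c) :
    qhYHom q c a 0 0 = a ∧ qhYHom q c a 1 0 = 0 ∧ qhYHom q c a 1 1 = qhK q c a := by
  induction a using qh_induction with
  | h0 r => simp [Matrix.algebraMap_matrix_apply]
  | h1 i => fin_cases i <;> simp [qhYHom]
  | hm a b ha hb => simp [Matrix.mul_apply, ha, hb]
  | ha a b ha hb => simp [ha, hb]

theorem qhX_mul (a b : QH q c) : qhX q c (a * b) = qhX q c a * b + qhKinv q c a * qhX q c b := by
  simp [qhX_def, Matrix.mul_apply, qhXHom_entries, add_comm]

theorem qhY_mul (a b : QH q c) : qhY q c (a * b) = a * qhY q c b + qhY q c a * qhK q c b := by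
  simp [qhY_def, Matrix.mul_apply, qhYHom_entries]

@[simp] theorem qhK_qhKinv (a : QH q c) : qhK q c (qhKinv q c a) = a := by
  induction a using qh_induction with
  | h0 r => simp
  | h1 i => fin_cases i <;> simp [smul_smul]
  | hm a b ha hb => simp [ha, hb]
  | ha a b ha hb => simp [ha, hb]

@[simp] theorem qhKinv_qhK (a : QH q c) : qhKinv q c (qhK q c a) = a := by
  induction a using qh_induction with
  | h0 r => simp
  | h1 i => fin_cases i <;> simp [smul_smul]
  | hm a b ha hb => simp [ha, hb]
  | ha a b ha hb => simp [ha, hb]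

theorem qhK_qhX (a : QH q c) : qhK q c (qhX q c a) = (q : 𝕜) ^ 2 • qhX q c (qhK q c a) := by
  induction a using qh_induction with
  | h0 r => simp
  | h1 i => fin_cases i <;> simp [smul_smul, mul_comm]
  | hm a b ha hb => simp [qhX_mul, ha, hb]
  | ha a b ha hb => simp [ha, hb]

theorem qhY_qhK (a : QH q c) : qhY q c (qhK q c a) = (q : 𝕜) ^ 2 • qhK q c (qhY q c a) := by
  induction a using qh_induction with
  | h0 r => simp
  | h1 i =>
    have hq : (q : 𝕜) ≠ 0 := q.ne_zero
    fin_cases i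
    · simp
    · simp only [Fin.mk_one, qhK_v, qhY_v, map_smul, qhK_w]
      match_scalars
      field_simp
    · simp
  | hm a b ha hb => simp [qhY_mul, ha, hb]
  | ha a b ha hb => simp [ha, hb]

theorem qhKinv_qhY (a : QH q c) :
    qhKinv q c (qhY q c a) = (q : 𝕜) ^ 2 • qhY q c (qhKinv q c a) := by
  have h := qhY_qhK q c (qhKinv q c a)
  rw [qhK_qhKinv] at h
  rw [h, map_smul, qhKinv_qhK]

theorem qhX_qhY (a : QH q c) :
    ((q : 𝕜) - (q : 𝕜)⁻¹) • (qhX q c (qhY q c a) - qhY q c (qhX q c a)) =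
      qhK q c a - qhKinv q c a := by
  have hq : (q : 𝕜) ≠ 0 := q.ne_zero
  induction a using qh_induction with
  | h0 r => simp
  | h1 i =>
    fin_cases i <;> simp <;> match_scalars <;> field_simp <;> ring
  | hm a b ha hb =>
    have e : qhX q c (qhY q c (a * b)) - qhY q c (qhX q c (a * b)) =
        qhKinv q c a * (qhX q c (qhY q c b) - qhY q c (qhX q c b)) +
        (qhX q c (qhY q c a) - qhY q c (qhX q c a)) * qhK q c b := by
      simp only [qhX_mul, qhY_mul, map_add, qhKinv_qhY, qhK_qhX, mul_smul_comm, smul_mul_assoc,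
        mul_sub, sub_mul]
      abel
    rw [e, smul_add, ← mul_smul_comm, ← smul_mul_assoc, ha, hb, map_mul, map_mul,
      mul_sub, sub_mul]
    abel
  | ha a b ha hb =>
    simp only [map_add]
    rw [add_sub_add_comm, smul_add, ha, hb, add_sub_add_comm]

/-- The `U_q(sl(2))`-module `QH q c`. The action on the generators is that on `V`, and it is
extended to products through the coproduct, see `qhX_mul` and `qhY_mul`. -/
def qhRep : UqRep q (QH q c) :=
  uqLift q (B := Module.End 𝕜 (QH q c))
    (qhX q c) (qhY q c) (qhK q c).toLinearMap (qhKinv q c).toLinearMap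
    (by ext a; simp) (by ext a; simp)
    (by ext a; simpa using qhK_qhX q c a)
    (by ext a; simpa using qhY_qhK q c a)
    (by ext a; simpa using qhX_qhY q c a)

theorem qhRep_X (a : QH q c) : qhRep q c (uqGen q .X) a = qhX q c a := by simp [qhRep]
theorem qhRep_Y (a : QH q c) : qhRep q c (uqGen q .Y) a = qhY q c a := by simp [qhRep]
theorem qhRep_K (a : QH q c) : qhRep q c (uqGen q .K) a = qhK q c a := by simp [qhRep]
theorem qhRep_Kinv (a : QH q c) : qhRep q c (uqGen q .Kinv) a = qhKinv q c a := by simp [qhRep]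

/-- The irreducible component `V_k` of spin `k` of the algebra `QH q c`. -/
def Vk (k : ℕ) : Submodule 𝕜 (QH q c) := spinComponent (qhRep q c) ⊤ k

section Left

/-- The free left module `{aU + bV + cW}`; it is `QH q c ⊗ V'`, where `V'` is a copy of `V` with
basis `U, V, W`, so that `a ⊗ U` stands for `aU`. -/
abbrev ML : Type u := QH q c ⊗[𝕜] V 𝕜

/-- The element `(q³+q) uW + vV + (q+q⁻¹) wU`, spanning the spin `0` component of `V ⊗ V'`. -/
def KL : ML q c :=
  ((q : 𝕜) ^ 3 + (q : 𝕜)) • (qhGen q c 0 ⊗ₜ[𝕜] basisV 𝕜 2) + qhGen q c 1 ⊗ₜ[𝕜] basisV 𝕜 1 +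
    ((q : 𝕜) + (q : 𝕜)⁻¹) • (qhGen q c 2 ⊗ₜ[𝕜] basisV 𝕜 0)

/-- The left submodule `{f KL}` generated by `KL`. -/
def NL : Submodule (QH q c) (ML q c) := Submodule.span (QH q c) {KL q c}

/-- The diagonal action of `U_q(sl(2))` on `ML`. -/
def mlRep : UqRep q (ML q c) := tensorRep (qhRep q c) (vRep q)

theorem smul_KL (f : QH q c) : f • KL q c =
    ((q : 𝕜) ^ 3 + (q : 𝕜)) • ((f * qhGen q c 0) ⊗ₜ[𝕜] basisV 𝕜 2) +
    (f * qhGen q c 1) ⊗ₜ[𝕜] basisV 𝕜 1 +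
    ((q : 𝕜) + (q : 𝕜)⁻¹) • ((f * qhGen q c 2) ⊗ₜ[𝕜] basisV 𝕜 0) := by
  simp only [KL, smul_add, smul_comm f (_ : 𝕜), TensorProduct.smul_tmul', smul_eq_mul]

theorem NL_stable (z : Uq q) : ∀ m ∈ (NL q c).restrictScalars 𝕜,
    mlRep q c z m ∈ (NL q c).restrictScalars 𝕜 := by
  have hq : (q : 𝕜) ≠ 0 := q.ne_zero
  refine stable_of_gen _ _ ?_ z
  intro g m hm
  obtain ⟨f, rfl⟩ := Submodule.mem_span_singleton.mp hm
  suffices h : ∃ f', mlRep q c (uqGen q g) (f • KL q c) = f' • KL q c by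
    obtain ⟨f', h⟩ := h
    rw [h]
    exact Submodule.mem_span_singleton.mpr ⟨f', rfl⟩
  cases g with
  | X =>
    refine ⟨qhX q c f, ?_⟩
    simp only [smul_KL, map_add, map_smul, mlRep, tensorRep_X, qhRep_X, qhRep_Kinv, vRep_X_u,
      vRep_X_v, vRep_X_w, qhX_mul, map_mul, qhX_u, qhX_v, qhX_w, qhKinv_u, qhKinv_v, qhKinv_w,
      mul_smul_comm, mul_zero, TensorProduct.tmul_zero, TensorProduct.zero_tmul, TensorProduct.tmul_smul,
      TensorProduct.add_tmul, ← TensorProduct.smul_tmul']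
    match_scalars <;> field_simp <;> ring
  | Y =>
    refine ⟨qhY q c f, ?_⟩
    simp only [smul_KL, map_add, map_smul, mlRep, tensorRep_Y, qhRep_Y, vRep_Y_u,
      vRep_Y_v, vRep_Y_w, vRep_K_u, vRep_K_v, vRep_K_w, qhY_mul, qhY_u, qhY_v, qhY_w,
      qhK_u, qhK_v, qhK_w,
      mul_smul_comm, mul_neg, mul_zero, TensorProduct.tmul_zero, TensorProduct.zero_tmul, TensorProduct.tmul_smul,
      TensorProduct.tmul_neg, TensorProduct.neg_tmul,
      TensorProduct.add_tmul, ← TensorProduct.smul_tmul']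
    match_scalars <;> field_simp <;> ring
  | K =>
    refine ⟨qhK q c f, ?_⟩
    simp only [smul_KL, map_add, map_smul, mlRep, tensorRep_K, qhRep_K, vRep_K_u,
      vRep_K_v, vRep_K_w, map_mul, qhK_u, qhK_v, qhK_w,
      mul_smul_comm, TensorProduct.tmul_smul, ← TensorProduct.smul_tmul']
    match_scalars <;> field_simp
  | Kinv =>
    refine ⟨qhKinv q c f, ?_⟩
    simp only [smul_KL, map_add, map_smul, mlRep, tensorRep_Kinv, qhRep_Kinv, vRep_Kinv_u,
      vRep_Kinv_v, vRep_Kinv_w, map_mul, qhKinv_u, qhKinv_v, qhKinv_w,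
      mul_smul_comm, TensorProduct.tmul_smul, ← TensorProduct.smul_tmul']
    match_scalars <;> field_simp

/-- The left tangent module `T(H_q)_l = ML / NL`. -/
abbrev TL : Type u := ML q c ⧸ (NL q c).restrictScalars 𝕜

/-- The `U_q(sl(2))`-module structure of the left tangent module. -/
def tlRep : UqRep q (TL q c) := quotRep (mlRep q c) _ (NL_stable q c)

/-- The subspace `V_k ⊗ V'` of `ML`. -/
def tensL (k : ℕ) : Submodule 𝕜 (ML q c) :=
  LinearMap.range (LinearMap.rTensor (V 𝕜) (Vk q c k).subtype)

/-- The component `(V_k ⊗ V')_j` of spin `j` of `V_k ⊗ V'`. -/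
def compL (k j : ℕ) : Submodule 𝕜 (ML q c) := spinComponent (mlRep q c) (tensL q c k) j

end Left

section Right

/-- The free right module `{Ua + Vb + Wc}`; it is `V' ⊗ QH q c`, and `U ⊗ a` stands for `Ua`. -/
abbrev MR : Type u := V 𝕜 ⊗[𝕜] QH q c

/-- Right multiplication by `a` on `MR`. -/
def rightMul (a : QH q c) : MR q c →ₗ[𝕜] MR q c :=
  LinearMap.lTensor (V 𝕜) (LinearMap.mulRight 𝕜 a)

/-- The element `(q³+q) Uw + Vv + (q+q⁻¹) Wu`, spanning the spin `0` component of `V' ⊗ V`. -/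
def KR : MR q c :=
  ((q : 𝕜) ^ 3 + (q : 𝕜)) • (basisV 𝕜 0 ⊗ₜ[𝕜] qhGen q c 2) + basisV 𝕜 1 ⊗ₜ[𝕜] qhGen q c 1 +
    ((q : 𝕜) + (q : 𝕜)⁻¹) • (basisV 𝕜 2 ⊗ₜ[𝕜] qhGen q c 0)

/-- The right submodule `{KR f}` generated by `KR`. -/
def NR : Submodule 𝕜 (MR q c) := Submodule.span 𝕜 (Set.range fun f => rightMul q c f (KR q c))

/-- The diagonal action of `U_q(sl(2))` on `MR`. -/
def mrRep : UqRep q (MR q c) := tensorRep (vRep q) (qhRep q c)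

theorem rightMul_KR (f : QH q c) : rightMul q c f (KR q c) =
    ((q : 𝕜) ^ 3 + (q : 𝕜)) • (basisV 𝕜 0 ⊗ₜ[𝕜] (qhGen q c 2 * f)) +
    basisV 𝕜 1 ⊗ₜ[𝕜] (qhGen q c 1 * f) +
    ((q : 𝕜) + (q : 𝕜)⁻¹) • (basisV 𝕜 2 ⊗ₜ[𝕜] (qhGen q c 0 * f)) := by
  simp [KR, rightMul]

theorem NR_stable (z : Uq q) : ∀ m ∈ NR q c, mrRep q c z m ∈ NR q c := by
  have hq : (q : 𝕜) ≠ 0 := q.ne_zero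
  refine stable_of_gen _ _ ?_ z
  intro g m hm
  suffices h : ∀ f, ∃ f', mrRep q c (uqGen q g) (rightMul q c f (KR q c)) =
      rightMul q c f' (KR q c) by
    induction hm using Submodule.span_induction with
    | mem x hx =>
      obtain ⟨f, rfl⟩ := hx
      obtain ⟨f', h⟩ := h f
      exact Submodule.subset_span ⟨f', h.symm⟩
    | zero => simp
    | add x y _ _ hx hy => simpa using (NR q c).add_mem hx hy
    | smul r x _ hx => simpa using (NR q c).smul_mem r hx
  intro f
  cases g with
  | X =>
    refine ⟨qhX q c f, ?_⟩
    simp only [rightMul_KR, map_add, map_smul, mrRep, tensorRep_X, qhRep_X, vRep_Kinv_u,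
      vRep_Kinv_v, vRep_Kinv_w, vRep_X_u,
      vRep_X_v, vRep_X_w, qhX_mul, qhX_u, qhX_v, qhX_w, qhKinv_u, qhKinv_v, qhKinv_w,
      smul_mul_assoc, zero_mul, TensorProduct.zero_tmul, TensorProduct.tmul_zero, TensorProduct.tmul_smul,
      TensorProduct.tmul_add, ← TensorProduct.smul_tmul']
    match_scalars <;> field_simp <;> ring
  | Y =>
    refine ⟨qhY q c f, ?_⟩
    simp only [rightMul_KR, map_add, map_smul, mrRep, tensorRep_Y, qhRep_Y, qhRep_K, vRep_Y_u,
      vRep_Y_v, vRep_Y_w, qhY_mul, map_mul, qhY_u, qhY_v, qhY_w,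
      qhK_u, qhK_v, qhK_w,
      smul_mul_assoc, neg_mul, zero_mul, TensorProduct.zero_tmul, TensorProduct.tmul_zero, TensorProduct.tmul_smul,
      TensorProduct.tmul_neg, TensorProduct.neg_tmul,
      TensorProduct.tmul_add, ← TensorProduct.smul_tmul']
    match_scalars <;> field_simp <;> ring
  | K =>
    refine ⟨qhK q c f, ?_⟩
    simp only [rightMul_KR, map_add, map_smul, mrRep, tensorRep_K, qhRep_K, vRep_K_u,
      vRep_K_v, vRep_K_w, map_mul, qhK_u, qhK_v, qhK_w,
      smul_mul_assoc, TensorProduct.tmul_smul, ← TensorProduct.smul_tmul']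
    match_scalars <;> field_simp
  | Kinv =>
    refine ⟨qhKinv q c f, ?_⟩
    simp only [rightMul_KR, map_add, map_smul, mrRep, tensorRep_Kinv, qhRep_Kinv, vRep_Kinv_u,
      vRep_Kinv_v, vRep_Kinv_w, map_mul, qhKinv_u, qhKinv_v, qhKinv_w,
      smul_mul_assoc, TensorProduct.tmul_smul, ← TensorProduct.smul_tmul']
    match_scalars <;> field_simp

/-- The right tangent module `T(H_q)_r = MR / NR`. -/
abbrev TR : Type u := MR q c ⧸ NR q c

/-- The `U_q(sl(2))`-module structure of the right tangent module. -/
def trRep : UqRep q (TR q c) := quotRep (mrRep q c) _ (NR_stable q c)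

/-- The subspace `V' ⊗ V_k` of `MR`. -/
def tensR (k : ℕ) : Submodule 𝕜 (MR q c) :=
  LinearMap.range (LinearMap.lTensor (V 𝕜) (Vk q c k).subtype)

/-- The component `(V' ⊗ V_k)_j` of spin `j` of `V' ⊗ V_k`. -/
def compR (k j : ℕ) : Submodule 𝕜 (MR q c) := spinComponent (mrRep q c) (tensR q c k) j

end Right

/-- Indices of the members of the basis: `gen` stands for `V'`, and for `k ≥ 0`, `mid k` stands for
`(V_{k+1} ⊗ V')_{k+1}` and `top k` for `(V_{k+1} ⊗ V')_{k+2}`. -/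
inductive BasisIdx : Type
  | gen
  | mid (k : ℕ)
  | top (k : ℕ)

/-- The spin of a member of the basis. -/
def BasisIdx.spin : BasisIdx → ℕ
  | .gen => 1
  | .mid k => k + 1
  | .top k => k + 2

/-- The members of the basis of the left module, before passing to the quotient. -/
def blockL : BasisIdx → Submodule 𝕜 (ML q c)
  | .gen => LinearMap.range (TensorProduct.mk 𝕜 (QH q c) (V 𝕜) 1)
  | .mid k => compL q c (k + 1) (k + 1)
  | .top k => compL q c (k + 1) (k + 2)

/-- The members of the basis of the right module, before passing to the quotient. -/
def blockR : BasisIdx → Submodule 𝕜 (MR q c)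
  | .gen => LinearMap.range ((TensorProduct.mk 𝕜 (V 𝕜) (QH q c)).flip 1)
  | .mid k => compR q c (k + 1) (k + 1)
  | .top k => compR q c (k + 1) (k + 2)

/-- The projection of `ML` onto the left tangent module. -/
def projL : ML q c →ₗ[𝕜] TL q c := ((NL q c).restrictScalars 𝕜).mkQ

/-- The projection of `MR` onto the right tangent module. -/
def projR : MR q c →ₗ[𝕜] TR q c := (NR q c).mkQ

/-- The image of a member of the basis in the left tangent module. -/
def imageL (i : BasisIdx) : Submodule 𝕜 (TL q c) := (blockL q c i).map (projL q c)

/-- The image of a member of the basis in the right tangent module. -/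
def imageR (i : BasisIdx) : Submodule 𝕜 (TR q c) := (blockR q c i).map (projR q c)

end Hyperboloid

end

end QHyp

/-!
The theorem is a computation with highest weight vectors, i.e. vectors killed by `X`.

For `q` not a root of unity, a highest weight vector `m` of weight `2n` in a module on which `X` and
`Y` act locally nilpotently generates an irreducible submodule `cyc m` of spin `n`, with basis
`m, Y m, …, Y²ⁿ m`, in which `m` is the only vector killed by `X` up to scalars. Three facts follow.
A stable subspace containing all highest weight vectors is everything (`eq_top_of_highest`; here
`X` maps the weight space `2n ≥ 0` onto the next one). Linearly independent highest weight vectors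
generate independent submodules (`iSupIndep_cyc`). Two direct sums of such submodules with the same
weights are isomorphic, uniquely up to a scalar on each summand (`exists_equiv_of_highest`,
`eq_smul_on_cyc`). No complete reducibility theorem is needed.

In the algebra of the quantum hyperboloid the monomials `uᵃ vᵇ` and `vᵇ wᵃ` span, and the vectors
`uᵃ vᵇ` with `a` fixed are linearly independent, as one sees in a representation by shifts and
scalings (`exists_skewRep`). As `X` acts on `uᵃ vᵇ` as a `q`-derivative in `v`, the highest weight
vectors are exactly the multiples of the powers of `u` (`eq_smul_u_pow`), so that `V_k` is generated
by `u^k`.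

Both `A ⊗ V'` and `V' ⊗ A` are `A³` in coordinates, with very similar actions of `X`; the structure
`TangentData` records what they share. Solving `X m = 0` for the coefficients of `W`, `V` and `U` in
turn shows that the highest weight vectors of weight `2n` are spanned by `uⁿ κ`, by one vector of
the component of spin `n` of `V_n ⊗ V'` and by `u^(n-1) U` (by `κ` alone for `n = 0`). The
first lies in the submodule which is divided out, and the other two generate members of the basis,
hence these members span. They are independent in the quotient since their generators have no
coefficient at `W` and, `u` being regular, no nonzero element of the submodule generated by `κ` has
this property. Finally, a highest weight vector of spin `n` in `V_{n+1} ⊗ V'` is the sum of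
multiples of `uⁿ κ` and of `u^(n-1) U ∈ V_{n-1} ⊗ V'`, which is the claim on the remaining component
(`bottom_le`).
-/

open scoped TensorProduct

namespace QHyp

noncomputable section

/-! ### Weights and commutation relations in a `U_q(sl(2))`-module -/

section Weights

variable {𝕜 : Type*} [Field 𝕜] {q : 𝕜ˣ}

theorem zpow_injective_of_generic (hq : ∀ n : ℕ, 0 < n → q ^ n ≠ 1) :
    Function.Injective fun n : ℤ => (q : 𝕜) ^ n := by
  have h : Function.Injective fun n : ℤ => q ^ n := by
    rw [injective_zpow_iff_not_isOfFinOrder, isOfFinOrder_iff_pow_eq_one]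
    rintro ⟨n, hn, h⟩
    exact hq n hn h
  intro m n hmn
  apply h
  ext
  simpa using hmn

/-- The quantum integer `[n] = (qⁿ - q⁻ⁿ) / (q - q⁻¹)`. -/
def qInt (q : 𝕜ˣ) (n : ℤ) : 𝕜 := ((q : 𝕜) ^ n - (q : 𝕜) ^ (-n)) / ((q : 𝕜) - (q : 𝕜)⁻¹)

theorem sub_inv_ne_zero (hq : ∀ n : ℕ, 0 < n → q ^ n ≠ 1) : (q : 𝕜) - (q : 𝕜)⁻¹ ≠ 0 := by
  intro h
  have := @zpow_injective_of_generic _ _ _ hq 1 (-1) (by simpa [sub_eq_zero] using h)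
  omega

theorem qInt_ne_zero (hq : ∀ n : ℕ, 0 < n → q ^ n ≠ 1) {n : ℤ} (hn : n ≠ 0) :
    qInt q n ≠ 0 := by
  refine div_ne_zero ?_ (sub_inv_ne_zero hq)
  intro h
  have := zpow_injective_of_generic hq (sub_eq_zero.mp h)
  omega

@[simp] theorem qInt_zero : qInt q 0 = 0 := by simp [qInt]

theorem qInt_one (hq : ∀ n : ℕ, 0 < n → q ^ n ≠ 1) : qInt q 1 = 1 := by
  simpa [qInt] using div_self (sub_inv_ne_zero hq)

theorem qInt_neg (n : ℤ) : qInt q (-n) = -qInt q n := by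
  simp [qInt, ← neg_div]

/-- `[i+1][h-i] = [i][h-i+1] + [h-2i]`, the induction step for the commutator of `X` with a power
of `Y` on a vector of weight `h`. -/
theorem qInt_succ_mul (hq : ∀ n : ℕ, 0 < n → q ^ n ≠ 1) (i h : ℤ) :
    qInt q (i + 1) * qInt q (h - i) =
      qInt q i * qInt q (h - i + 1) + qInt q (h - 2 * i) := by
  have hq0 : (q : 𝕜) ≠ 0 := q.ne_zero
  have hD := sub_inv_ne_zero hq
  have hi : (q : 𝕜) ^ i ≠ 0 := zpow_ne_zero _ hq0
  have hh : (q : 𝕜) ^ h ≠ 0 := zpow_ne_zero _ hq0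
  have e : h - 2 * i = h - i - i := by ring
  simp only [qInt, e, zpow_neg, zpow_sub₀ hq0, zpow_add₀ hq0, zpow_one]
  generalize (q : 𝕜) ^ i = a at *
  generalize (q : 𝕜) ^ h = b at *
  rw [div_mul_div_comm, div_mul_div_comm, div_add_div _ _ (mul_ne_zero hD hD) hD,
    div_eq_div_iff (mul_ne_zero hD hD) (mul_ne_zero (mul_ne_zero hD hD) hD)]
  generalize hd : (q : 𝕜) - (q : 𝕜)⁻¹ = D at *
  have key : (a * q - (a * q)⁻¹) * (b / a - (b / a)⁻¹) =
      (a - a⁻¹) * (b / a * q - (b / a * q)⁻¹) + (b / a / a - (b / a / a)⁻¹) * D := by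
    rw [← hd]
    field_simp
    ring
  linear_combination (D * D * D) * key

/-- The form of `qInt_succ_mul` for the commutator of a power of `X` with `Y`. -/
theorem qInt_succ_mul' (hq : ∀ n : ℕ, 0 < n → q ^ n ≠ 1) (i h : ℤ) :
    qInt q (i + 1) * qInt q (h + i) =
      qInt q i * qInt q (h + i - 1) + qInt q (h + 2 * i) := by
  have := qInt_succ_mul hq i (-h)
  rw [show -h - i = -(h + i) by ring, show -(h + i) + 1 = -(h + i - 1) by ring,
    show -h - 2 * i = -(h + 2 * i) by ring, qInt_neg, qInt_neg, qInt_neg] at this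
  linear_combination -this

variable {M : Type*} [AddCommGroup M] [Module 𝕜 M] (ρ : UqRep q M)

/-- The operator by which `X` acts. -/
abbrev opX : Module.End 𝕜 M := ρ (uqGen q .X)

/-- The operator by which `Y` acts. -/
abbrev opY : Module.End 𝕜 M := ρ (uqGen q .Y)

/-- The weight space on which `H` acts by `2n`, i.e. `q^H` acts by `q^{2n}`. -/
def wtSpace (n : ℤ) : Submodule 𝕜 M :=
  Module.End.eigenspace (ρ (uqGen q .K)) ((q : 𝕜) ^ (2 * n))

variable {ρ} {n : ℤ} {m : M}

theorem mem_wtSpace : m ∈ wtSpace ρ n ↔ ρ (uqGen q .K) m = (q : 𝕜) ^ (2 * n) • m :=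
  Module.End.mem_eigenspace_iff

theorem iSupIndep_wtSpace (hq : ∀ n : ℕ, 0 < n → q ^ n ≠ 1) : iSupIndep (wtSpace ρ) := by
  refine (Module.End.eigenspaces_iSupIndep (ρ (uqGen q .K))).comp
    (f := fun n : ℤ => (q : 𝕜) ^ (2 * n)) fun a b h => ?_
  have := zpow_injective_of_generic hq h
  omega

theorem opX_mem_wtSpace (hm : m ∈ wtSpace ρ n) : opX ρ m ∈ wtSpace ρ (n + 1) := by
  rw [mem_wtSpace] at *
  have h := congrArg (fun z => ρ z m) (uq_K_X q)
  simp only [map_mul, map_smul, Module.End.mul_apply, LinearMap.smul_apply, hm] at h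
  rw [h, smul_smul, mul_add, zpow_add₀ q.ne_zero, mul_comm]
  norm_cast

theorem opY_mem_wtSpace (hm : m ∈ wtSpace ρ n) : opY ρ m ∈ wtSpace ρ (n - 1) := by
  rw [mem_wtSpace] at *
  have h := congrArg (fun z => ρ z m) (uq_Y_K q)
  simp only [map_mul, map_smul, Module.End.mul_apply, LinearMap.smul_apply, hm] at h
  have h2 : (q : 𝕜) ^ 2 ≠ 0 := pow_ne_zero _ q.ne_zero
  rw [mul_sub, zpow_sub₀ q.ne_zero, div_eq_inv_mul, mul_smul, h]
  change _ = _ • (q : 𝕜) ^ 2 • _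
  rw [smul_smul, show (2 : ℤ) * 1 = (2 : ℕ) by norm_num, zpow_natCast, inv_mul_cancel₀ h2,
    one_smul]

theorem opX_pow_mem_wtSpace (hm : m ∈ wtSpace ρ n) (i : ℕ) :
    (opX ρ ^ i) m ∈ wtSpace ρ (n + i) := by
  induction i with
  | zero => simpa using hm
  | succ i ih =>
    rw [pow_succ', Module.End.mul_apply]
    simpa [add_assoc] using opX_mem_wtSpace ih

theorem opY_pow_mem_wtSpace (hm : m ∈ wtSpace ρ n) (i : ℕ) :
    (opY ρ ^ i) m ∈ wtSpace ρ (n - i) := by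
  induction i with
  | zero => simpa using hm
  | succ i ih =>
    rw [pow_succ', Module.End.mul_apply]
    simpa [sub_sub] using opY_mem_wtSpace ih

theorem Kinv_apply_of_mem_wtSpace (hm : m ∈ wtSpace ρ n) :
    ρ (uqGen q .Kinv) m = (q : 𝕜) ^ (-(2 * n)) • m := by
  rw [mem_wtSpace] at hm
  have h := congrArg (fun z => ρ z m) (uq_Kinv_mul_K q)
  simp only [map_mul, map_one, Module.End.mul_apply, Module.End.one_apply, hm, map_smul] at h
  conv_rhs => rw [← h]
  rw [smul_smul, ← zpow_add₀ q.ne_zero, neg_add_cancel, zpow_zero, one_smul]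

theorem opX_opY (hq : ∀ n : ℕ, 0 < n → q ^ n ≠ 1) (hm : m ∈ wtSpace ρ n) :
    opX ρ (opY ρ m) = opY ρ (opX ρ m) + qInt q (2 * n) • m := by
  have h := congrArg (fun z => ρ z m) (uq_X_Y q)
  simp only [map_mul, map_smul, map_sub, Module.End.mul_apply, LinearMap.smul_apply,
    LinearMap.sub_apply, mem_wtSpace.mp hm, Kinv_apply_of_mem_wtSpace hm, ← sub_smul] at h
  rw [← sub_eq_iff_eq_add', qInt, div_eq_inv_mul, mul_smul, ← h,
    inv_smul_smul₀ (sub_inv_ne_zero hq)]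

theorem opX_opY_pow (hq : ∀ n : ℕ, 0 < n → q ^ n ≠ 1) (hm : m ∈ wtSpace ρ n) (i : ℕ) :
    opX ρ ((opY ρ ^ (i + 1)) m) = (opY ρ ^ (i + 1)) (opX ρ m) +
      (qInt q (i + 1) * qInt q (2 * n - i)) • (opY ρ ^ i) m := by
  induction i with
  | zero => simpa [qInt_one hq] using opX_opY hq hm
  | succ i ih =>
    rw [pow_succ', Module.End.mul_apply, opX_opY hq (opY_pow_mem_wtSpace hm (i + 1)), ih,
      map_add, map_smul, ← Module.End.mul_apply, ← Module.End.mul_apply (opY ρ), ← pow_succ',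
      ← pow_succ', add_assoc, ← add_smul]
    congr 2
    have := qInt_succ_mul hq (i + 1) (2 * n)
    push_cast
    rw [this]
    congr 3 <;> ring

theorem opX_pow_opY (hq : ∀ n : ℕ, 0 < n → q ^ n ≠ 1) (hm : m ∈ wtSpace ρ n) (i : ℕ) :
    (opX ρ ^ (i + 1)) (opY ρ m) = opY ρ ((opX ρ ^ (i + 1)) m) +
      (qInt q (i + 1) * qInt q (2 * n + i)) • (opX ρ ^ i) m := by
  induction i with
  | zero => simpa [qInt_one hq] using opX_opY hq hm
  | succ i ih =>
    rw [pow_succ', Module.End.mul_apply, ih, map_add, map_smul,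
      opX_opY hq (opX_pow_mem_wtSpace hm (i + 1)), ← Module.End.mul_apply (opX ρ),
      ← Module.End.mul_apply (opX ρ), ← pow_succ', ← pow_succ', add_assoc, ← add_smul]
    congr 2
    have := qInt_succ_mul' hq (i + 1) (2 * n)
    push_cast
    rw [this, add_comm]
    congr 3 <;> ring

end Weights

/-! ### Highest weight vectors in locally nilpotent modules -/

section HighestWeight

variable {𝕜 : Type*} [Field 𝕜] {q : 𝕜ˣ} {M : Type*} [AddCommGroup M] [Module 𝕜 M]
  (ρ : UqRep q M)

/-- `X` and `Y` act locally nilpotently. -/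
structure LocNilp : Prop where
  X : ∀ m, ∃ k, (opX ρ ^ k) m = 0
  Y : ∀ m, ∃ k, (opY ρ ^ k) m = 0

/-- `m` is a (nonzero) highest weight vector on which `H` acts by `2n`. -/
structure IsHW (n : ℕ) (m : M) : Prop where
  ne_zero : m ≠ 0
  X_eq_zero : opX ρ m = 0
  mem_wt : m ∈ wtSpace ρ n

/-- The span of the vectors `Yⁱ m`. For a highest weight vector `m` it is the submodule generated
by `m`. -/
def cyc (m : M) : Submodule 𝕜 M := Submodule.span 𝕜 (Set.range fun i : ℕ => (opY ρ ^ i) m)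

variable {ρ}

theorem self_mem_cyc (m : M) : m ∈ cyc ρ m := Submodule.subset_span ⟨0, by simp⟩

theorem opY_pow_mem_cyc (m : M) (i : ℕ) : (opY ρ ^ i) m ∈ cyc ρ m := Submodule.subset_span ⟨i, rfl⟩

theorem cyc_le {N : Submodule 𝕜 M} (hN : ∀ x ∈ N, opY ρ x ∈ N) {m : M} (hm : m ∈ N) :
    cyc ρ m ≤ N := by
  rw [cyc, Submodule.span_le]
  rintro _ ⟨i, rfl⟩
  induction i with
  | zero => simpa using hm
  | succ i ih =>
    simp only [pow_succ', Module.End.mul_apply]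
    exact hN _ ih

theorem map_cyc {M' : Type*} [AddCommGroup M'] [Module 𝕜 M'] {ρ' : UqRep q M'}
    (f : M →ₗ[𝕜] M') (hf : ∀ x, f (opY ρ x) = opY ρ' (f x)) (m : M) :
    (cyc ρ m).map f = cyc ρ' (f m) := by
  rw [cyc, Submodule.map_span, ← Set.range_comp, cyc]
  congr 2
  funext i
  simp only [Function.comp]
  induction i with
  | zero => simp
  | succ i ih => simp only [pow_succ', Module.End.mul_apply, hf, ih]

theorem cyc_smul {s : 𝕜} (hs : s ≠ 0) (m : M) : cyc ρ (s • m) = cyc ρ m := by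
  have := map_cyc (ρ := ρ) (ρ' := ρ) (s • LinearMap.id) (by simp) m
  simp only [LinearMap.smul_apply, LinearMap.id_apply] at this
  rw [← this, Submodule.map_smul _ _ _ hs, Submodule.map_id]

/-- Stability under the generators of a subspace spanned by weight vectors. -/
theorem span_stable_of_wt {S : Set M} (hS : ∀ x ∈ S, ∃ n, x ∈ wtSpace ρ n)
    (hX : ∀ x ∈ S, opX ρ x ∈ Submodule.span 𝕜 S) (hY : ∀ x ∈ S, opY ρ x ∈ Submodule.span 𝕜 S)
    (z : Uq q) : ∀ x ∈ Submodule.span 𝕜 S, ρ z x ∈ Submodule.span 𝕜 S := by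
  refine stable_of_gen ρ _ (fun g x hx => ?_) z
  suffices Submodule.span 𝕜 S ≤ (Submodule.span 𝕜 S).comap (ρ (uqGen q g)) from this hx
  rw [Submodule.span_le]
  intro y hy
  obtain ⟨n, hn⟩ := hS y hy
  cases g with
  | X => exact hX y hy
  | Y => exact hY y hy
  | K =>
    change ρ _ y ∈ Submodule.span 𝕜 S
    rw [mem_wtSpace.mp hn]
    exact Submodule.smul_mem _ _ (Submodule.subset_span hy)
  | Kinv =>
    change ρ _ y ∈ Submodule.span 𝕜 S
    rw [Kinv_apply_of_mem_wtSpace hn]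
    exact Submodule.smul_mem _ _ (Submodule.subset_span hy)

variable (hq : ∀ n : ℕ, 0 < n → q ^ n ≠ 1)
include hq

theorem cyc_stable {n : ℤ} {m : M} (hm : m ∈ wtSpace ρ n) (hX : opX ρ m = 0) (z : Uq q) :
    ∀ x ∈ cyc ρ m, ρ z x ∈ cyc ρ m := by
  refine span_stable_of_wt ?_ ?_ ?_ z
  · rintro _ ⟨i, rfl⟩
    exact ⟨_, opY_pow_mem_wtSpace hm i⟩
  · rintro _ ⟨i, rfl⟩
    cases i with
    | zero => simp [hX]
    | succ i =>
      simp only [opX_opY_pow hq hm, hX, map_zero, zero_add]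
      exact Submodule.smul_mem _ _ (opY_pow_mem_cyc m i)
  · rintro _ ⟨i, rfl⟩
    have := opY_pow_mem_cyc (ρ := ρ) m (i + 1)
    rwa [pow_succ', Module.End.mul_apply] at this

omit hq in
theorem exists_min_pow_eq_zero (hρ : LocNilp ρ) {m : M} (h0 : m ≠ 0) :
    ∃ k, (opY ρ ^ (k + 1)) m = 0 ∧ ∀ i ≤ k, (opY ρ ^ i) m ≠ 0 := by
  classical
  have h := hρ.Y m
  refine ⟨Nat.find h - 1, ?_, ?_⟩
  · have : Nat.find h ≠ 0 := by simpa [Nat.find_eq_zero] using h0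
    rw [Nat.sub_add_cancel (by omega)]
    exact Nat.find_spec h
  · intro i hi
    have : Nat.find h ≠ 0 := by simpa [Nat.find_eq_zero] using h0
    exact Nat.find_min h (by omega)

/-- If `Y^k m` is the last nonzero vector of the string of a vector `m` killed by `X`, then `k` is
the weight of `m`, since `X Y^(k+1) m` is `[k+1][2n-k] Y^k m`. -/
theorem two_mul_eq_of_pow {n : ℤ} {m : M} (hm : m ∈ wtSpace ρ n) (hX : opX ρ m = 0) {k : ℕ}
    (hk : (opY ρ ^ (k + 1)) m = 0) (hk' : (opY ρ ^ k) m ≠ 0) : 2 * n = k := by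
  have h := opX_opY_pow hq hm k
  rw [hk, hX, map_zero, map_zero, zero_add, eq_comm, smul_eq_zero, or_iff_left hk',
    mul_eq_zero] at h
  by_contra hne
  rcases h with h | h
  · exact qInt_ne_zero hq (by omega) h
  · exact qInt_ne_zero hq (by omega) h

namespace IsHW

variable {n : ℕ} {m : M}

theorem pow_ne_zero (hρ : LocNilp ρ) (h : IsHW ρ n m) {i : ℕ} (hi : i ≤ 2 * n) :
    (opY ρ ^ i) m ≠ 0 := by
  obtain ⟨k, hk, hk'⟩ := exists_min_pow_eq_zero hρ h.ne_zero
  have := two_mul_eq_of_pow hq h.mem_wt h.X_eq_zero hk (hk' k le_rfl)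
  exact hk' i (by omega)

theorem pow_eq_zero (hρ : LocNilp ρ) (h : IsHW ρ n m) {i : ℕ} (hi : 2 * n < i) :
    (opY ρ ^ i) m = 0 := by
  obtain ⟨k, hk, hk'⟩ := exists_min_pow_eq_zero hρ h.ne_zero
  have := two_mul_eq_of_pow hq h.mem_wt h.X_eq_zero hk (hk' k le_rfl)
  obtain ⟨j, rfl⟩ := Nat.exists_eq_add_of_le (show k + 1 ≤ i by omega)
  rw [add_comm, pow_add, Module.End.mul_apply, hk, map_zero]

theorem linearIndependent (hρ : LocNilp ρ) (h : IsHW ρ n m) :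
    LinearIndependent 𝕜 fun i : Fin (2 * n + 1) => (opY ρ ^ (i : ℕ)) m := by
  refine ((iSupIndep_wtSpace (ρ := ρ) hq).comp
    (f := fun i : Fin (2 * n + 1) => (n : ℤ) - (i : ℕ)) ?_).linearIndependent _
    (fun i => opY_pow_mem_wtSpace h.mem_wt i) fun i => h.pow_ne_zero hq hρ (by omega)
  intro i j hij
  ext
  simpa using hij

theorem span_eq (hρ : LocNilp ρ) (h : IsHW ρ n m) :
    Submodule.span 𝕜 (Set.range fun i : Fin (2 * n + 1) => (opY ρ ^ (i : ℕ)) m) = cyc ρ m := by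
  apply le_antisymm
  · rw [Submodule.span_le]
    rintro _ ⟨i, rfl⟩
    exact opY_pow_mem_cyc m i
  · rw [cyc, Submodule.span_le]
    rintro _ ⟨i, rfl⟩
    by_cases hi : i < 2 * n + 1
    · exact Submodule.subset_span ⟨⟨i, hi⟩, rfl⟩
    · simp [h.pow_eq_zero hq hρ (i := i) (by omega)]

/-- The basis `Yⁱ m`, `0 ≤ i ≤ 2n`, of the submodule generated by a highest weight vector. -/
def basis (hρ : LocNilp ρ) (h : IsHW ρ n m) : Module.Basis (Fin (2 * n + 1)) 𝕜 (cyc ρ m) :=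
  (Module.Basis.span (h.linearIndependent hq hρ)).map (LinearEquiv.ofEq _ _ (h.span_eq hq hρ))

@[simp] theorem basis_apply (hρ : LocNilp ρ) (h : IsHW ρ n m) (i : Fin (2 * n + 1)) :
    (h.basis hq hρ i : M) = (opY ρ ^ (i : ℕ)) m := by
  simp [basis, Module.Basis.span_apply]

/-- The highest weight line is the whole kernel of `X`. -/
theorem mem_span_of_X_eq_zero (hρ : LocNilp ρ) (h : IsHW ρ n m) {x : M} (hx : x ∈ cyc ρ m)
    (hX : opX ρ x = 0) : ∃ s : 𝕜, x = s • m := by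
  rw [← h.span_eq hq hρ, Submodule.mem_span_range_iff_exists_fun] at hx
  obtain ⟨a, rfl⟩ := hx
  rw [Fin.sum_univ_succ] at hX ⊢
  have hli := (h.linearIndependent hq hρ).comp (Fin.castSucc : Fin (2 * n) → _)
    (Fin.castSucc_injective _)
  rw [Fintype.linearIndependent_iff] at hli
  have := hli (fun i => a i.succ * (qInt q (i + 1) * qInt q (2 * n - i))) (by
    simpa [opX_opY_pow hq h.mem_wt, h.X_eq_zero, smul_smul] using hX)
  refine ⟨a 0, ?_⟩
  rw [Finset.sum_eq_zero, add_zero]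
  · simp
  intro i _
  have hi := this i
  have h1 : qInt q ((i : ℕ) + 1) ≠ 0 := qInt_ne_zero hq (by omega)
  have h2 : qInt q (2 * n - (i : ℕ)) ≠ 0 := qInt_ne_zero hq (by omega)
  simp only [mul_eq_zero, h1, h2, or_false] at hi
  simp [hi]

omit hq in
theorem exists_X_eq_zero (hρ : LocNilp ρ) {N : Submodule 𝕜 M} (hN : ∀ x ∈ N, opX ρ x ∈ N)
    (h : N ≠ ⊥) : ∃ x ∈ N, x ≠ 0 ∧ opX ρ x = 0 := by
  obtain ⟨x, hx, hx0⟩ := N.exists_mem_ne_zero_of_ne_bot h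
  obtain ⟨k, hk⟩ := hρ.X x
  induction k generalizing x with
  | zero => exact absurd (by simpa using hk) hx0
  | succ k ih =>
    by_cases hXx : opX ρ x = 0
    · exact ⟨x, hx, hx0, hXx⟩
    · exact ih _ (hN x hx) hXx (by rwa [pow_succ] at hk)

/-- Irreducibility of the submodule generated by a highest weight vector. -/
theorem le_of_stable (hρ : LocNilp ρ) (h : IsHW ρ n m) {N : Submodule 𝕜 M} (hle : N ≤ cyc ρ m)
    (hN : ∀ z, ∀ x ∈ N, ρ z x ∈ N) (h0 : N ≠ ⊥) : N = cyc ρ m := by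
  obtain ⟨x, hx, hx0, hXx⟩ := exists_X_eq_zero hρ (fun x hx => hN _ x hx) h0
  obtain ⟨s, rfl⟩ := h.mem_span_of_X_eq_zero hq hρ (hle hx) hXx
  have hs : s ≠ 0 := fun e => hx0 (by simp [e])
  refine le_antisymm hle (cyc_le (fun x hx => hN _ x hx) ?_)
  simpa [smul_smul, hs] using N.smul_mem s⁻¹ hx

theorem isSpinModule (hρ : LocNilp ρ) (h : IsHW ρ n m) : IsSpinModule ρ n (cyc ρ m) where
  stable := cyc_stable hq h.mem_wt h.X_eq_zero
  simple W' hW' hs := by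
    by_cases h0 : W' = ⊥
    · exact Or.inl h0
    · exact Or.inr (h.le_of_stable hq hρ hW' hs h0)
  finrank_eq := by simpa using Module.finrank_eq_card_basis (h.basis hq hρ)
  highest := ⟨m, self_mem_cyc m, h.ne_zero, h.X_eq_zero, by
    rw [mem_wtSpace.mp h.mem_wt]
    norm_cast⟩

end IsHW

theorem exists_isHW_of_isSpinModule {j : ℕ} {W : Submodule 𝕜 M} (h : IsSpinModule ρ j W) :
    ∃ m ∈ W, IsHW ρ j m ∧ W = cyc ρ m := by
  obtain ⟨m, hm, h0, hX, hK⟩ := h.highest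
  have hw : IsHW ρ j m := ⟨h0, hX, mem_wtSpace.mpr (by rw [hK]; norm_cast)⟩
  refine ⟨m, hm, hw, ?_⟩
  rcases h.simple (cyc ρ m) (cyc_le (fun x hx => h.stable _ x hx) hm)
    (cyc_stable hq hw.mem_wt hX) with e | e
  · exact absurd ((Submodule.mem_bot 𝕜).mp (e ▸ self_mem_cyc m)) h0
  · exact e.symm

/-- If the highest weight vectors of spin `j` in `P` form a line, they generate the component of
spin `j`. -/
theorem spinComponent_eq_cyc (hρ : LocNilp ρ) {P : Submodule 𝕜 M}
    (hP : ∀ x ∈ P, opY ρ x ∈ P) {j : ℕ} {m : M} (hm : m ∈ P) (h : IsHW ρ j m)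
    (huniq : ∀ y ∈ P, IsHW ρ j y → ∃ s : 𝕜, y = s • m) : spinComponent ρ P j = cyc ρ m := by
  apply le_antisymm
  · refine sSup_le ?_
    rintro W ⟨hWP, hW⟩
    obtain ⟨y, hy, hyw, rfl⟩ := exists_isHW_of_isSpinModule hq hW
    obtain ⟨s, rfl⟩ := huniq y (hWP hy) hyw
    rw [cyc_smul (fun e => hyw.ne_zero (by simp [e]))]
  · exact le_sSup ⟨cyc_le hP hm, h.isSpinModule hq hρ⟩

/-! ### Generation and independence through highest weight vectors -/

/-- Modulo a submodule, `X` is injective on negative weights; the hypothesis only concerns the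
`Y^(i+1) X m`, so it also holds when `X m` is an invariant. -/
theorem mem_of_neg_weight (hρ : LocNilp ρ) {N : Submodule 𝕜 M} (hN : ∀ x ∈ N, opX ρ x ∈ N)
    {n : ℤ} (hn : n < 0) {m : M} (hm : m ∈ wtSpace ρ n)
    (hX : ∀ i, (opY ρ ^ (i + 1)) (opX ρ m) ∈ N) : m ∈ N := by
  obtain ⟨k, hk⟩ := hρ.Y m
  suffices ∀ i, (opY ρ ^ i) m ∈ N → m ∈ N from this k (by simp [hk])
  intro i
  induction i with
  | zero => simp
  | succ i ih =>
    intro h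
    apply ih
    have h1 := N.sub_mem (hN _ h) (hX i)
    rw [opX_opY_pow hq hm, add_sub_cancel_left] at h1
    have h2 : qInt q (i + 1) * qInt q (2 * n - i) ≠ 0 :=
      mul_ne_zero (qInt_ne_zero hq (by omega)) (qInt_ne_zero hq (by omega))
    exact (N.smul_mem_iff h2).mp h1

/-- `X` maps the weight space `2n ≥ 0` onto the weight space `2n + 2`. -/
theorem exists_opX_eq {N : Submodule 𝕜 M} (hX : ∀ x ∈ N, opX ρ x ∈ N)
    (hY : ∀ x ∈ N, opY ρ x ∈ N) {n : ℤ} (hn : 0 ≤ n) (k : ℕ) {m : M} (hm : m ∈ wtSpace ρ (n + 1))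
    (hmN : m ∈ N) (hk : (opX ρ ^ k) m = 0) : ∃ p ∈ N, p ∈ wtSpace ρ n ∧ opX ρ p = m := by
  induction k generalizing m with
  | zero => exact ⟨0, N.zero_mem, Submodule.zero_mem _, by simpa [eq_comm] using hk⟩
  | succ k ih =>
    -- `X Y` acts by the nonzero scalar `a` on the quotient `ker X^(k+1) / ker X^k`.
    set a := qInt q (k + 1) * qInt q (2 * (n + 1) + k) with ha
    have ha0 : a ≠ 0 := mul_ne_zero (qInt_ne_zero hq (by omega)) (qInt_ne_zero hq (by omega))
    have hYw : opY ρ m ∈ wtSpace ρ n := by simpa using opY_mem_wtSpace hm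
    obtain ⟨p, hpN, hpw, hp⟩ := ih (m := opX ρ (opY ρ m) - a • m)
      (Submodule.sub_mem _ (opX_mem_wtSpace hYw) (Submodule.smul_mem _ _ hm))
      (N.sub_mem (hX _ (hY _ hmN)) (N.smul_mem _ hmN)) (by
        rw [map_sub, ← Module.End.mul_apply, ← pow_succ, opX_pow_opY hq hm, hk, map_zero, zero_add,
          map_smul, sub_self])
    refine ⟨a⁻¹ • (opY ρ m - p), N.smul_mem _ (N.sub_mem (hY _ hmN) hpN),
      Submodule.smul_mem _ _ (Submodule.sub_mem _ hYw hpw), ?_⟩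
    rw [map_smul, map_sub, hp, sub_sub_cancel, smul_smul, inv_mul_cancel₀ ha0, one_smul]

/-- A submodule containing all highest weight vectors is everything. -/
theorem eq_top_of_highest (hρ : LocNilp ρ) (hspan : ⨆ n, wtSpace ρ n = ⊤) {N : Submodule 𝕜 M}
    (hN : ∀ z, ∀ x ∈ N, ρ z x ∈ N) (hw : ∀ n m, IsHW ρ n m → m ∈ N) : N = ⊤ := by
  rw [eq_top_iff, ← hspan]
  refine iSup_le fun n m hm => ?_
  obtain ⟨k, hk⟩ := hρ.X m
  induction k generalizing m n with
  | zero => simp [show m = 0 by simpa using hk]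
  | succ k ih =>
    have hXm : opX ρ m ∈ N :=
      ih _ _ (opX_mem_wtSpace hm) (by rwa [pow_succ, Module.End.mul_apply] at hk)
    rcases lt_or_ge n 0 with hn | hn
    · refine mem_of_neg_weight hq hρ (fun x hx => hN _ x hx) hn hm fun i => ?_
      rw [← map_pow]
      exact hN _ _ hXm
    · obtain ⟨l, hl⟩ := hρ.X (opX ρ m)
      obtain ⟨p, hpN, hpw, hp⟩ := exists_opX_eq hq (fun x hx => hN _ x hx) (fun x hx => hN _ x hx)
        hn l (opX_mem_wtSpace hm) hXm hl
      have : m - p ∈ N := by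
        by_cases h0 : m - p = 0
        · simp [h0]
        · lift n to ℕ using hn
          exact hw n _ ⟨h0, by rw [map_sub, hp, sub_self], Submodule.sub_mem _ hm hpw⟩
      simpa using N.add_mem this hpN

/-- Linearly independent highest weight vectors generate independent submodules. -/
theorem iSupIndep_cyc (hρ : LocNilp ρ) {ι : Type*} {n : ι → ℕ} {m : ι → M}
    (h : ∀ i, IsHW ρ (n i) (m i)) (hli : LinearIndependent 𝕜 m) :
    iSupIndep fun i => cyc ρ (m i) := by
  classical
  apply iSupIndep_of_dfinsupp_lsum_injective
  rw [injective_iff_map_eq_zero]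
  have hst : ∀ i, ∀ x ∈ cyc ρ (m i), opX ρ x ∈ cyc ρ (m i) :=
    fun i x hx => cyc_stable hq (h i).mem_wt (h i).X_eq_zero _ x hx
  -- induction on the order of nilpotency of `X` on the summands
  suffices key : ∀ (k : ℕ) (f : Π₀ i, cyc ρ (m i)), (∀ i, (opX ρ ^ k) (f i : M) = 0) →
      DFinsupp.lsum ℕ (fun i => (cyc ρ (m i)).subtype) f = 0 → f = 0 by
    intro f hf
    choose k hk using fun i => hρ.X (f i : M)
    refine key (f.support.sup k) f (fun i => ?_) hf
    by_cases hi : i ∈ f.support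
    · obtain ⟨j, hj⟩ := Nat.exists_eq_add_of_le (Finset.le_sup (f := k) hi)
      rw [hj, add_comm, pow_add, Module.End.mul_apply, hk, map_zero]
    · rw [DFinsupp.notMem_support_iff.mp hi]
      simp
  intro k
  induction k with
  | zero =>
    intro f hf _
    ext i
    simpa using hf i
  | succ k ih =>
    intro f hf hsum
    have hsum' := hsum
    rw [DFinsupp.lsum_apply_apply, DFinsupp.sumAddHom_apply] at hsum'
    set g : Π₀ i, cyc ρ (m i) := f.mapRange (fun i => (opX ρ).restrict (hst i)) (by simp) with hg
    have hg0 : g = 0 := by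
      refine ih g (fun i => ?_) ?_
      · simpa [hg, pow_succ] using hf i
      · have : DFinsupp.lsum ℕ (fun i => (cyc ρ (m i)).subtype) g =
            opX ρ (DFinsupp.lsum ℕ (fun i => (cyc ρ (m i)).subtype) f) := by
          rw [DFinsupp.lsum_apply_apply, DFinsupp.sumAddHom_apply, DFinsupp.lsum_apply_apply,
            DFinsupp.sumAddHom_apply, hg, DFinsupp.sum_mapRange_index (by simp)]
          simp [DFinsupp.sum]
        rw [this, hsum, map_zero]
    have hX : ∀ i, opX ρ (f i : M) = 0 := by
      intro i
      have := congrArg (fun g' : Π₀ i, cyc ρ (m i) => (g' i : M)) hg0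
      simpa [hg] using this
    choose s hs using fun i => (h i).mem_span_of_X_eq_zero hq hρ (f i).2 (hX i)
    have h0 : ∀ i ∈ f.support, s i = 0 := by
      refine linearIndependent_iff'.mp hli f.support s ?_
      rw [← hsum', DFinsupp.sum]
      exact Finset.sum_congr rfl fun i _ => (hs i).symm
    ext i
    by_cases hi : i ∈ f.support
    · simp [hs i, h0 i hi]
    · rw [DFinsupp.notMem_support_iff.mp hi, DFinsupp.zero_apply]

end HighestWeight

/-! ### Isomorphisms between direct sums of modules generated by highest weight vectors -/

section Iso

variable {𝕜 : Type*} [Field 𝕜] {q : 𝕜ˣ} {M M' : Type*} [AddCommGroup M] [Module 𝕜 M]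
  [AddCommGroup M'] [Module 𝕜 M'] {ρ : UqRep q M} {ρ' : UqRep q M'}

theorem intertwines_of_gen {f : M →ₗ[𝕜] M'}
    (h : ∀ g x, f (ρ (uqGen q g) x) = ρ' (uqGen q g) (f x)) (z : Uq q) (x : M) :
    f (ρ z x) = ρ' z (f x) := by
  obtain ⟨z, rfl⟩ := uqMk_surjective q z
  induction z using FreeAlgebra.induction generalizing x with
  | grade0 r => simp
  | grade1 g => exact h g x
  | mul a b ha hb => simp [ha, hb]
  | add a b ha hb => simp [ha, hb]

variable (hq : ∀ n : ℕ, 0 < n → q ^ n ≠ 1)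
include hq

/-- Two modules which are direct sums of submodules generated by highest weight vectors of the
same weights are isomorphic, the isomorphism matching the given highest weight vectors. -/
theorem exists_equiv_of_highest {ι : Type*} (hρ : LocNilp ρ) (hρ' : LocNilp ρ') {n : ι → ℕ}
    {m : ι → M} {m' : ι → M'} (h : ∀ i, IsHW ρ (n i) (m i)) (h' : ∀ i, IsHW ρ' (n i) (m' i))
    (hind : iSupIndep fun i => cyc ρ (m i)) (hind' : iSupIndep fun i => cyc ρ' (m' i))
    (htop : ⨆ i, cyc ρ (m i) = ⊤) (htop' : ⨆ i, cyc ρ' (m' i) = ⊤) :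
    ∃ α : M ≃ₗ[𝕜] M', (∀ z x, α (ρ z x) = ρ' z (α x)) ∧ ∀ i, α (m i) = m' i := by
  classical
  let B := (DirectSum.isInternal_submodule_of_iSupIndep_of_iSup_eq_top hind htop).collectedBasis
    fun i => (h i).basis hq hρ
  let B' := (DirectSum.isInternal_submodule_of_iSupIndep_of_iSup_eq_top hind' htop').collectedBasis
    fun i => (h' i).basis hq hρ'
  have hB : ∀ a, B a = (opY ρ ^ (a.2 : ℕ)) (m a.1) := fun a => by
    simp [B, DirectSum.IsInternal.collectedBasis_coe]
  have hB' : ∀ a, B' a = (opY ρ' ^ (a.2 : ℕ)) (m' a.1) := fun a => by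
    simp [B', DirectSum.IsInternal.collectedBasis_coe]
  let α : M ≃ₗ[𝕜] M' := B.equiv B' (Equiv.refl _)
  have hα : ∀ i k, α ((opY ρ ^ k) (m i)) = (opY ρ' ^ k) (m' i) := by
    intro i k
    by_cases hk : k < 2 * n i + 1
    · have := B.equiv_apply ⟨i, ⟨k, hk⟩⟩ B' (Equiv.refl _)
      rwa [Equiv.refl_apply, hB, hB'] at this
    · rw [(h i).pow_eq_zero hq hρ (i := k) (by omega),
        (h' i).pow_eq_zero hq hρ' (i := k) (by omega), map_zero]
  refine ⟨α, intertwines_of_gen (f := α.toLinearMap) fun g x => ?_, fun i => by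
    simpa using hα i 0⟩
  suffices α.toLinearMap ∘ₗ ρ (uqGen q g) = ρ' (uqGen q g) ∘ₗ α.toLinearMap from
    LinearMap.congr_fun this x
  refine B.ext fun ⟨i, a⟩ => ?_
  have hw := opY_pow_mem_wtSpace (h i).mem_wt (a : ℕ)
  have hw' := opY_pow_mem_wtSpace (h' i).mem_wt (a : ℕ)
  simp only [LinearMap.comp_apply, hB, LinearEquiv.coe_coe]
  cases g with
  | X =>
    generalize (a : ℕ) = k
    cases k with
    | zero =>
      have h1 := (h i).X_eq_zero
      have h2 := (h' i).X_eq_zero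
      have h3 := hα i 0
      simp only [pow_zero, Module.End.one_apply] at h3 ⊢
      rw [h1, h3, h2, map_zero]
    | succ k =>
      rw [hα, opX_opY_pow hq (h i).mem_wt, opX_opY_pow hq (h' i).mem_wt, (h i).X_eq_zero,
        (h' i).X_eq_zero]
      simp [hα]
  | Y =>
    rw [hα]
    simpa only [pow_succ', Module.End.mul_apply] using hα i (a + 1)
  | K => rw [mem_wtSpace.mp hw, map_smul, hα, mem_wtSpace.mp hw']
  | Kinv =>
    rw [Kinv_apply_of_mem_wtSpace hw, map_smul, hα, Kinv_apply_of_mem_wtSpace hw']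

/-- Schur's lemma for submodules generated by highest weight vectors. -/
theorem eq_smul_on_cyc (hρ' : LocNilp ρ') {n : ℕ} {m : M} {m' : M'} (h : IsHW ρ n m)
    (h' : IsHW ρ' n m') {α β : M →ₗ[𝕜] M'} (hα : ∀ x, α (opY ρ x) = opY ρ' (α x))
    (hβ : ∀ z x, β (ρ z x) = ρ' z (β x)) (hαm : α m = m') (hβm : β m ∈ cyc ρ' m') :
    ∃ s : 𝕜, ∀ x ∈ cyc ρ m, β x = s • α x := by
  obtain ⟨s, hs⟩ := h'.mem_span_of_X_eq_zero hq hρ' hβm (by rw [← hβ, h.X_eq_zero, map_zero])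
  refine ⟨s, fun x hx => ?_⟩
  suffices cyc ρ m ≤ LinearMap.ker (β - s • α) by
    simpa [sub_eq_zero] using this hx
  refine cyc_le (fun x hx => ?_) ?_
  · rw [LinearMap.mem_ker, LinearMap.sub_apply, LinearMap.smul_apply, sub_eq_zero] at hx ⊢
    rw [hβ, hα, hx, map_smul]
  · simp [hs, hαm]

end Iso

/-! ### Local nilpotency of products and tensor products -/

section Nilpotent

variable {𝕜 : Type*} [Field 𝕜]

theorem pow_apply_eq_zero_of_le {M : Type*} [AddCommGroup M] [Module 𝕜 M] {D : Module.End 𝕜 M}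
    {k l : ℕ} (hkl : k ≤ l) {m : M} (h : (D ^ k) m = 0) : (D ^ l) m = 0 := by
  obtain ⟨j, rfl⟩ := Nat.exists_eq_add_of_le hkl
  rw [add_comm, pow_add, Module.End.mul_apply, h, map_zero]

theorem exists_pow_add_eq_zero {M : Type*} [AddCommGroup M] [Module 𝕜 M] {D : Module.End 𝕜 M}
    {a b : M} (ha : ∃ k, (D ^ k) a = 0) (hb : ∃ k, (D ^ k) b = 0) : ∃ k, (D ^ k) (a + b) = 0 := by
  obtain ⟨k, hk⟩ := ha
  obtain ⟨l, hl⟩ := hb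
  exact ⟨max k l, by rw [map_add, pow_apply_eq_zero_of_le (le_max_left k l) hk,
    pow_apply_eq_zero_of_le (le_max_right k l) hl, add_zero]⟩

theorem pow_apply_eq_zero_of_comm {M : Type*} [AddCommGroup M] [Module 𝕜 M] {D S : Module.End 𝕜 M}
    {r : 𝕜} (h : D * S = r • (S * D)) {k : ℕ} {m : M} (hm : (D ^ k) m = 0) :
    (D ^ k) (S m) = 0 := by
  have : ∀ k, D ^ k * S = r ^ k • (S * D ^ k) := by
    intro k
    induction k with
    | zero => simp
    | succ k ih =>
      rw [pow_succ' D, mul_assoc, ih, mul_smul_comm, ← mul_assoc, h, smul_mul_assoc, smul_smul,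
        mul_assoc, ← pow_succ]
  rw [← Module.End.mul_apply, this, LinearMap.smul_apply, Module.End.mul_apply, hm, map_zero,
    smul_zero]

/-- A twisted derivation of a bilinear product is locally nilpotent on products. -/
theorem pow_bilin_eq_zero {A B P : Type*} [AddCommGroup A] [Module 𝕜 A] [AddCommGroup B]
    [Module 𝕜 B] [AddCommGroup P] [Module 𝕜 P] (f : A →ₗ[𝕜] B →ₗ[𝕜] P) {DA SA : Module.End 𝕜 A}
    {DB SB : Module.End 𝕜 B} {DP : Module.End 𝕜 P}
    (h : ∀ a b, DP (f a b) = f (DA a) (SB b) + f (SA a) (DB b))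
    (hA : ∀ k a, (DA ^ k) a = 0 → (DA ^ k) (SA a) = 0)
    (hB : ∀ k b, (DB ^ k) b = 0 → (DB ^ k) (SB b) = 0) (n : ℕ) :
    ∀ k l a b, k + l = n → (DA ^ k) a = 0 → (DB ^ l) b = 0 → (DP ^ n) (f a b) = 0 := by
  induction n with
  | zero =>
    intro k l a b hkl ha hb
    obtain rfl : k = 0 := by omega
    simp [show a = 0 by simpa using ha]
  | succ n ih =>
    intro k l a b hkl ha hb
    cases k with
    | zero => simp [show a = 0 by simpa using ha]
    | succ k =>
      cases l with
      | zero => simp [show b = 0 by simpa using hb]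
      | succ l =>
        rw [pow_succ, Module.End.mul_apply, h, map_add,
          ih k (l + 1) _ _ (by omega) (by rwa [pow_succ] at ha) (hB _ _ hb),
          ih (k + 1) l _ _ (by omega) (hA _ _ ha) (by rwa [pow_succ] at hb), add_zero]

variable {q : 𝕜ˣ} {M N : Type*} [AddCommGroup M] [Module 𝕜 M] [AddCommGroup N] [Module 𝕜 N]
  {ρ : UqRep q M} {σ : UqRep q N}

theorem opX_pow_Kinv {k : ℕ} {m : M} (h : (opX ρ ^ k) m = 0) :
    (opX ρ ^ k) (ρ (uqGen q .Kinv) m) = 0 :=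
  pow_apply_eq_zero_of_comm (by simpa using congrArg ρ (uq_X_Kinv q)) h

theorem opY_pow_K {k : ℕ} {m : M} (h : (opY ρ ^ k) m = 0) :
    (opY ρ ^ k) (ρ (uqGen q .K) m) = 0 :=
  pow_apply_eq_zero_of_comm (by simpa using congrArg ρ (uq_Y_K q)) h

theorem LocNilp.tensor (hρ : LocNilp ρ) (hσ : LocNilp σ) : LocNilp (tensorRep ρ σ) where
  X x := by
    induction x using TensorProduct.induction_on with
    | zero => exact ⟨0, by simp⟩
    | add a b ha hb => exact exists_pow_add_eq_zero ha hb
    | tmul m n =>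
      obtain ⟨k, hk⟩ := hρ.X m
      obtain ⟨l, hl⟩ := hσ.X n
      exact ⟨k + l, pow_bilin_eq_zero (TensorProduct.mk 𝕜 M N) (SB := LinearMap.id)
        (fun a b => tensorRep_X ρ σ a b) (fun _ _ => opX_pow_Kinv) (fun _ _ h => h) _ k l m n rfl
        hk hl⟩
  Y x := by
    induction x using TensorProduct.induction_on with
    | zero => exact ⟨0, by simp⟩
    | add a b ha hb => exact exists_pow_add_eq_zero ha hb
    | tmul m n =>
      obtain ⟨k, hk⟩ := hρ.Y m
      obtain ⟨l, hl⟩ := hσ.Y n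
      exact ⟨k + l, pow_bilin_eq_zero (TensorProduct.mk 𝕜 M N) (SA := LinearMap.id)
        (fun a b => (tensorRep_Y ρ σ a b).trans (add_comm _ _)) (fun _ _ h => h)
        (fun _ _ => opY_pow_K) _ k l m n rfl hk hl⟩

theorem LocNilp.quot (hρ : LocNilp ρ) (P : Submodule 𝕜 M) (hP : ∀ z, ∀ m ∈ P, ρ z m ∈ P) :
    LocNilp (quotRep ρ P hP) := by
  have key : ∀ (g : UqGen) (k : ℕ) (m : M), (ρ (uqGen q g) ^ k) m = 0 →
      (quotRep ρ P hP (uqGen q g) ^ k) (P.mkQ m) = 0 := by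
    intro g k m h
    rw [← map_pow] at h ⊢
    change P.mapQ P (ρ _) (hP _) (P.mkQ m) = 0
    rw [Submodule.mkQ_apply, Submodule.mapQ_apply, h, Submodule.Quotient.mk_zero]
  constructor
  · intro x
    obtain ⟨m, rfl⟩ := P.mkQ_surjective x
    obtain ⟨k, hk⟩ := hρ.X m
    exact ⟨k, key _ k m hk⟩
  · intro x
    obtain ⟨m, rfl⟩ := P.mkQ_surjective x
    obtain ⟨k, hk⟩ := hρ.Y m
    exact ⟨k, key _ k m hk⟩

theorem basisV_expand (m : V 𝕜) : m = m 0 • basisV 𝕜 0 + m 1 • basisV 𝕜 1 + m 2 • basisV 𝕜 2 := by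
  ext i
  fin_cases i <;> simp [basisV]

theorem locNilp_vRep : LocNilp (vRep q) where
  X m := ⟨3, by
    rw [basisV_expand m]
    simp [pow_succ', vRep_X_u, vRep_X_v, vRep_X_w]⟩
  Y m := ⟨3, by
    rw [basisV_expand m]
    simp [pow_succ', vRep_Y_u, vRep_Y_v, vRep_Y_w]⟩

theorem locNilp_qhRep (c : 𝕜) : LocNilp (qhRep q c) where
  X a := by
    induction a using qh_induction with
    | h0 r => exact ⟨1, by simp [qhRep_X]⟩
    | h1 i => exact ⟨3, by fin_cases i <;> simp [pow_succ', qhRep_X]⟩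
    | ha a b ha hb => exact exists_pow_add_eq_zero ha hb
    | hm a b ha hb =>
      obtain ⟨k, hk⟩ := ha
      obtain ⟨l, hl⟩ := hb
      exact ⟨k + l, pow_bilin_eq_zero (LinearMap.mul 𝕜 (QH q c)) (SB := LinearMap.id)
        (SA := qhRep q c (uqGen q .Kinv))
        (fun a b => by simp [qhRep_X, qhRep_Kinv, qhX_mul]) (fun _ _ => opX_pow_Kinv)
        (fun _ _ h => h) _ k l a b rfl hk hl⟩
  Y a := by
    induction a using qh_induction with
    | h0 r => exact ⟨1, by simp [qhRep_Y]⟩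
    | h1 i => exact ⟨3, by fin_cases i <;> simp [pow_succ', qhRep_Y]⟩
    | ha a b ha hb => exact exists_pow_add_eq_zero ha hb
    | hm a b ha hb =>
      obtain ⟨k, hk⟩ := ha
      obtain ⟨l, hl⟩ := hb
      exact ⟨k + l, pow_bilin_eq_zero (LinearMap.mul 𝕜 (QH q c)) (SA := LinearMap.id)
        (SB := qhRep q c (uqGen q .K))
        (fun a b => by simp [qhRep_Y, qhRep_K, qhY_mul, add_comm]) (fun _ _ h => h)
        (fun _ _ => opY_pow_K) _ k l a b rfl hk hl⟩

end Nilpotent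

/-! ### Weight decompositions -/

section Decomposition

/-- If independent `E i` contain `B i` which span everything, then `B i = E i`, by the modular law. -/
theorem eq_of_le_of_iSup_eq_top {ι α : Type*} [CompleteLattice α] [IsModularLattice α]
    {B E : ι → α} (hE : iSupIndep E) (hle : ∀ i, B i ≤ E i) (hB : ⨆ i, B i = ⊤) (i : ι) :
    B i = E i := by
  refine le_antisymm (hle i) ?_
  have h1 : E i = (B i ⊔ ⨆ (j) (_ : j ≠ i), B j) ⊓ E i := by
    rw [← iSup_split_single, hB, top_inf_eq]
  have h2 : (⨆ (j) (_ : j ≠ i), B j) ⊓ E i = ⊥ := by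
    rw [inf_comm, ← disjoint_iff]
    exact (hE i).mono_right (iSup₂_mono fun j _ => hle j)
  rw [h1, sup_inf_assoc_of_le _ (hle i), h2, sup_bot_eq]

variable {𝕜 : Type*} [Field 𝕜] {q : 𝕜ˣ} {M : Type*} [AddCommGroup M] [Module 𝕜 M]
  {ρ : UqRep q M}

/-- A `K`-stable subspace without weight vectors is zero. -/
theorem eq_bot_of_inf_wtSpace (hq : ∀ n : ℕ, 0 < n → q ^ n ≠ 1) (hspan : ⨆ n, wtSpace ρ n = ⊤)
    {p : Submodule 𝕜 M} (hp : ∀ x ∈ p, ρ (uqGen q .K) x ∈ p)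
    (h : ∀ n, ∀ x ∈ p, x ∈ wtSpace ρ n → x = 0) : p = ⊥ := by
  rw [Submodule.eq_bot_iff]
  intro x hx
  obtain ⟨f, hf, rfl⟩ := (Submodule.mem_iSup_iff_exists_finsupp _ _).mp
    (show x ∈ ⨆ n, wtSpace ρ n by simp [hspan])
  -- the components of an element of `p` become eigenvectors of sum zero in the quotient by `p`
  have hE := (Module.End.eigenspaces_iSupIndep (p.mapQ p (ρ (uqGen q .K)) hp)).comp
    (f := fun n : ℤ => (q : 𝕜) ^ (2 * n)) fun a b h => by
      have := zpow_injective_of_generic hq h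
      omega
  refine Finset.sum_eq_zero fun n hn => h n _ ?_ (hf n)
  rw [← Submodule.Quotient.mk_eq_zero]
  refine (iSupIndep_iff_finsetSum_eq_zero_imp_eq_zero _).mp hE f.support
    (fun n => p.mkQ (f n)) (fun n _ => ?_) ?_ n hn
  · rw [Function.comp, Module.End.mem_eigenspace_iff, Submodule.mkQ_apply, Submodule.mapQ_apply,
      mem_wtSpace.mp (hf n), Submodule.Quotient.mk_smul]
  · rw [← map_sum]
    exact (Submodule.Quotient.mk_eq_zero p).mpr hx

end Decomposition

/-! ### Monomials in the algebra of the quantum hyperboloid -/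

section Monomials

variable {𝕜 : Type*} [Field 𝕜] {q : 𝕜ˣ} (hq : ∀ n : ℕ, 0 < n → q ^ n ≠ 1) (c : 𝕜)

include hq in
/-- Otherwise `q² = -1` and `q⁴ = 1`. -/
theorem add_inv_ne_zero : (q : 𝕜) + (q : 𝕜)⁻¹ ≠ 0 := by
  intro h
  refine hq 4 (by norm_num) (Units.ext ?_)
  have h2 : (q : 𝕜) ^ 2 = -1 := by
    field_simp at h
    linear_combination h
  push_cast
  linear_combination ((q : 𝕜) ^ 2 - 1) * h2

local notation "u" => qhGen q c 0
local notation "v" => qhGen q c 1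
local notation "w" => qhGen q c 2

theorem v_pow_mul_u (b : ℕ) : v ^ b * u = (q : 𝕜) ^ (2 * b) • (u * v ^ b) := by
  induction b with
  | zero => simp
  | succ b ih =>
    rw [pow_succ', mul_assoc, ih, mul_smul_comm, ← mul_assoc, qh_vu, smul_mul_assoc, smul_smul,
      mul_assoc]
    congr 1
    ring

theorem w_mul_v_pow (b : ℕ) : w * v ^ b = (q : 𝕜) ^ (2 * b) • (v ^ b * w) := by
  induction b with
  | zero => simp
  | succ b ih =>
    rw [pow_succ, ← mul_assoc, ih, smul_mul_assoc, mul_assoc, qh_wv, mul_smul_comm, smul_smul,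
      mul_assoc]
    congr 1
    ring

theorem v_pow_mul_w (b : ℕ) : v ^ b * w = ((q : 𝕜) ^ (2 * b))⁻¹ • (w * v ^ b) := by
  rw [w_mul_v_pow, inv_smul_smul₀ (pow_ne_zero _ q.ne_zero)]

theorem v_mul_u_pow (a : ℕ) : v * u ^ a = (q : 𝕜) ^ (2 * a) • (u ^ a * v) := by
  induction a with
  | zero => simp
  | succ b ih =>
    rw [pow_succ, ← mul_assoc, ih, smul_mul_assoc, mul_assoc, qh_vu, mul_smul_comm, smul_smul,
      mul_assoc]
    congr 1
    ring

theorem w_pow_mul_v_pow (a b : ℕ) : w ^ a * v ^ b = (q : 𝕜) ^ (2 * b * a) • (v ^ b * w ^ a) := by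
  induction a with
  | zero => simp
  | succ a ih =>
    rw [pow_succ', mul_assoc, ih, mul_smul_comm, ← mul_assoc, w_mul_v_pow, smul_mul_assoc,
      smul_smul, mul_assoc, ← pow_succ']
    congr 1
    · ring
    · rw [mul_assoc, ← pow_succ']

include hq in
theorem w_mul_u : w * u = ((q : 𝕜) * ((q : 𝕜) + (q : 𝕜)⁻¹) ^ 2)⁻¹ •
    (algebraMap 𝕜 _ c - (q : 𝕜) ^ 2 • (v * v)) := by
  have h := add_inv_ne_zero hq
  have hq0 : (q : 𝕜) ≠ 0 := q.ne_zero
  rw [eq_inv_smul_iff₀ (mul_ne_zero hq0 (pow_ne_zero _ h)), eq_sub_iff_add_eq, ← qh_casimir,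
    ← sub_eq_zero, ← neg_eq_zero, ← qh_uw q c]
  match_scalars <;> field_simp <;> ring

include hq in
theorem u_mul_w : u * w = ((q : 𝕜) * ((q : 𝕜) + (q : 𝕜)⁻¹) ^ 2)⁻¹ •
    (algebraMap 𝕜 _ c - ((q : 𝕜) ^ 2)⁻¹ • (v * v)) := by
  have h := add_inv_ne_zero hq
  have hq0 : (q : 𝕜) ≠ 0 := q.ne_zero
  rw [eq_inv_smul_iff₀ (mul_ne_zero hq0 (pow_ne_zero _ h)), eq_sub_iff_add_eq, ← qh_casimir,
    ← sub_eq_zero]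
  have h0 := congrArg (fun z => ((q : 𝕜) ^ 2)⁻¹ • z) (qh_uw q c)
  simp only [smul_zero] at h0
  rw [← h0]
  match_scalars <;> field_simp <;> ring

/-- The monomials `uⁿ vᵇ` (`n ≥ 0`) and `vᵇ w⁻ⁿ` (`n ≤ 0`), of weight `2n`. -/
def mono (n : ℤ) (b : ℕ) : QH q c := u ^ n.toNat * v ^ b * w ^ (-n).toNat

theorem mono_natCast (a b : ℕ) : mono c a b = u ^ a * v ^ b := by simp [mono]

theorem mono_neg (a b : ℕ) : mono c (-a) b = v ^ b * w ^ a := by simp [mono]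

theorem u_pow_mem_wtSpace (a : ℕ) : u ^ a ∈ wtSpace (qhRep q c) a := by
  rw [mem_wtSpace, qhRep_K, map_pow, qhK_u, smul_pow, ← pow_mul]
  norm_cast

theorem mul_mem_wtSpace {m n : ℤ} {a b : QH q c} (ha : a ∈ wtSpace (qhRep q c) m)
    (hb : b ∈ wtSpace (qhRep q c) n) : a * b ∈ wtSpace (qhRep q c) (m + n) := by
  rw [mem_wtSpace, qhRep_K] at *
  rw [map_mul, ha, hb, smul_mul_smul_comm, ← zpow_add₀ q.ne_zero, mul_add]

theorem v_mem_wtSpace : v ∈ wtSpace (qhRep q c) 0 := by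
  rw [mem_wtSpace, qhRep_K, qhK_v, mul_zero, zpow_zero, one_smul]

theorem w_mem_wtSpace : w ∈ wtSpace (qhRep q c) (-1) := by
  rw [mem_wtSpace, qhRep_K, qhK_w, inv_pow]
  norm_cast

theorem one_mem_wtSpace : (1 : QH q c) ∈ wtSpace (qhRep q c) 0 := by
  rw [mem_wtSpace, qhRep_K, map_one, mul_zero, zpow_zero, one_smul]

theorem mono_mem_wtSpace (n : ℤ) (b : ℕ) : mono c n b ∈ wtSpace (qhRep q c) n := by
  have hv : ∀ b : ℕ, v ^ b ∈ wtSpace (qhRep q c) 0 := fun b => by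
    induction b with
    | zero => simpa using one_mem_wtSpace c
    | succ b ih => simpa [pow_succ] using mul_mem_wtSpace c ih (v_mem_wtSpace c)
  have hw : ∀ a : ℕ, w ^ a ∈ wtSpace (qhRep q c) (-a) := fun a => by
    induction a with
    | zero => simpa using one_mem_wtSpace c
    | succ b ih => simpa [pow_succ, add_comm] using mul_mem_wtSpace c ih (w_mem_wtSpace c)
  have := mul_mem_wtSpace c (mul_mem_wtSpace c (u_pow_mem_wtSpace c n.toNat) (hv b)) (hw (-n).toNat)
  rwa [show (n.toNat : ℤ) + 0 + -((-n).toNat : ℤ) = n by omega] at this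

include hq in
/-- The monomials span the algebra: their span contains `1` and is closed under right
multiplication by the generators. -/
theorem iSup_span_mono : ⨆ n, Submodule.span 𝕜 (Set.range (mono (q := q) c n)) = ⊤ := by
  set T := ⨆ n, Submodule.span 𝕜 (Set.range (mono (q := q) c n)) with hT
  have hmem : ∀ n b, mono c n b ∈ T := fun n b =>
    le_iSup (fun n => Submodule.span 𝕜 (Set.range (mono (q := q) c n))) n
      (Submodule.subset_span ⟨b, rfl⟩)
  have huv : ∀ a b : ℕ, u ^ a * v ^ b ∈ T := fun a b => mono_natCast (q := q) c a b ▸ hmem a b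
  have hvw : ∀ a b : ℕ, v ^ b * w ^ a ∈ T := fun a b => mono_neg (q := q) c a b ▸ hmem (-a) b
  have hext : ∀ d : QH q c, (∀ a b : ℕ, u ^ a * v ^ b * d ∈ T) →
      (∀ a b : ℕ, v ^ b * w ^ (a + 1) * d ∈ T) → ∀ x ∈ T, x * d ∈ T := by
    intro d h1 h2
    suffices T ≤ T.comap (LinearMap.mulRight 𝕜 d) from fun x hx => this hx
    conv_lhs => rw [hT]
    refine iSup_le fun n => ?_
    rw [Submodule.span_le]
    rintro _ ⟨b, rfl⟩
    change mono c n b * d ∈ T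
    obtain ⟨a, rfl | rfl⟩ := n.eq_nat_or_neg
    · rw [mono_natCast]
      exact h1 a b
    · rw [mono_neg]
      cases a with
      | zero => simpa using h1 0 b
      | succ a => exact h2 a b
  have hgen : ∀ (i : Fin 3), ∀ x ∈ T, x * qhGen q c i ∈ T := by
    intro i
    fin_cases i
    · refine hext u (fun a b => ?_) (fun a b => ?_)
      · rw [mul_assoc, v_pow_mul_u, mul_smul_comm, ← mul_assoc, ← pow_succ]
        exact T.smul_mem _ (huv _ _)
      · rw [pow_succ, mul_assoc, mul_assoc, w_mul_u hq, mul_smul_comm, mul_smul_comm, mul_sub,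
          mul_sub, mul_smul_comm, mul_smul_comm, ← Algebra.commutes, ← Algebra.smul_def,
          mul_smul_comm, ← pow_two, w_pow_mul_v_pow, mul_smul_comm, ← mul_assoc, ← pow_add]
        exact T.smul_mem _ (T.sub_mem (T.smul_mem _ (hvw _ _))
          (T.smul_mem _ (T.smul_mem _ (hvw _ _))))
    · refine hext v (fun a b => ?_) (fun a b => ?_)
      · rw [mul_assoc, ← pow_succ]
        exact huv _ _
      · have := w_pow_mul_v_pow (q := q) c (a + 1) 1
        rw [pow_one] at this
        rw [mul_assoc, this, mul_smul_comm, ← mul_assoc, ← pow_succ]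
        exact T.smul_mem _ (hvw _ _)
    · refine hext w (fun a b => ?_) (fun a b => ?_)
      · cases a with
        | zero => simpa using hvw 1 b
        | succ a =>
          rw [mul_assoc, v_pow_mul_w, mul_smul_comm, ← mul_assoc, pow_succ, mul_assoc (u ^ a),
            u_mul_w hq, mul_smul_comm, smul_mul_assoc, mul_sub, mul_smul_comm, sub_mul,
            smul_mul_assoc, ← Algebra.commutes, mul_assoc, ← Algebra.smul_def, ← pow_two,
            mul_assoc, ← pow_add]
          exact T.smul_mem _ (T.smul_mem _ (T.sub_mem (T.smul_mem _ (huv _ _))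
            (T.smul_mem _ (huv _ _))))
      · rw [mul_assoc, ← pow_succ]
        exact hvw _ _
  have hall : ∀ d : QH q c, ∀ x ∈ T, x * d ∈ T := by
    intro d
    induction d using qh_induction with
    | h0 r =>
      intro x hx
      rw [← Algebra.commutes, ← Algebra.smul_def]
      exact T.smul_mem _ hx
    | h1 i => exact hgen i
    | hm a b ha hb =>
      intro x hx
      rw [← mul_assoc]
      exact hb _ (ha _ hx)
    | ha a b ha hb =>
      intro x hx
      rw [mul_add]
      exact T.add_mem (ha _ hx) (hb _ hx)
  rw [eq_top_iff]
  intro d _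
  simpa using hall d 1 (by simpa using huv 0 0)

include hq in
/-- The weight space `2n` is spanned by the monomials of that weight. -/
theorem span_mono_eq_wtSpace (n : ℤ) :
    Submodule.span 𝕜 (Set.range (mono (q := q) c n)) = wtSpace (qhRep q c) n :=
  eq_of_le_of_iSup_eq_top (B := fun n => Submodule.span 𝕜 (Set.range (mono (q := q) c n)))
    (E := wtSpace (qhRep q c)) (iSupIndep_wtSpace hq)
    (fun n => Submodule.span_le.mpr (by rintro _ ⟨b, rfl⟩; exact mono_mem_wtSpace c n b))
    (iSup_span_mono hq c) n

include hq in
theorem iSup_wtSpace_qhRep : ⨆ n, wtSpace (qhRep q c) n = ⊤ := by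
  simp only [← span_mono_eq_wtSpace hq]
  exact iSup_span_mono hq c

/-- The operator of `u` in the representation `skewRep`. -/
def skewU (𝕜 : Type*) [Field 𝕜] : Module.End 𝕜 (ℤ → 𝕜 → 𝕜) where
  toFun f n t := f (n - 1) t
  map_add' _ _ := rfl
  map_smul' _ _ := rfl

/-- The operator of `v` in the representation `skewRep`. -/
def skewV (q : 𝕜ˣ) : Module.End 𝕜 (ℤ → 𝕜 → 𝕜) where
  toFun f n t := (q : 𝕜) ^ (2 * n) * t * f n t
  map_add' _ _ := by ext; simp [mul_add]
  map_smul' _ _ := by ext; simp [mul_left_comm]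

/-- The operator of `w` in the representation `skewRep`. -/
def skewW (q : 𝕜ˣ) (c : 𝕜) : Module.End 𝕜 (ℤ → 𝕜 → 𝕜) where
  toFun f n t := ((q : 𝕜) * ((q : 𝕜) + (q : 𝕜)⁻¹) ^ 2)⁻¹ *
    (c - (q : 𝕜) ^ 2 * ((q : 𝕜) ^ (2 * n) * t) ^ 2) * f (n + 1) t
  map_add' _ _ := by ext; simp [mul_add]
  map_smul' _ _ := by ext; simp [mul_left_comm]

theorem skewU_apply (f : ℤ → 𝕜 → 𝕜) (n : ℤ) (t : 𝕜) : skewU 𝕜 f n t = f (n - 1) t := rfl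

theorem skewV_apply (f : ℤ → 𝕜 → 𝕜) (n : ℤ) (t : 𝕜) :
    skewV q f n t = (q : 𝕜) ^ (2 * n) * t * f n t := rfl

theorem skewW_apply (f : ℤ → 𝕜 → 𝕜) (n : ℤ) (t : 𝕜) :
    skewW q c f n t = ((q : 𝕜) * ((q : 𝕜) + (q : 𝕜)⁻¹) ^ 2)⁻¹ *
      (c - (q : 𝕜) ^ 2 * ((q : 𝕜) ^ (2 * n) * t) ^ 2) * f (n + 1) t := rfl

include hq in
/-- The embedding of the algebra into a skew Laurent polynomial ring (`u` acts as a shift, `v` as a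
scaling, and `w = (wu) u⁻¹`), written as an action on functions of `n : ℤ` and of the value
`t` of `v` at `n = 0`. -/
theorem exists_skewRep : ∃ φ : QH q c →ₐ[𝕜] Module.End 𝕜 (ℤ → 𝕜 → 𝕜),
    φ u = skewU 𝕜 ∧ φ v = skewV q := by
  have h := add_inv_ne_zero hq
  have hq0 : (q : 𝕜) ≠ 0 := q.ne_zero
  have h2 : 1 + (q : 𝕜) ^ 2 ≠ 0 := by
    convert mul_ne_zero hq0 h using 1
    field_simp
    ring
  have h3 : (q : 𝕜) ^ 2 + 1 ≠ 0 := by rwa [add_comm]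
  have e1 : ∀ n : ℤ, (q : 𝕜) ^ (2 * (n - 1)) = (q : 𝕜) ^ (2 * n) / (q : 𝕜) ^ 2 := fun n => by
    rw [mul_sub, zpow_sub₀ hq0]
    norm_cast
  have e2 : ∀ n : ℤ, (q : 𝕜) ^ (2 * (n + 1)) = (q : 𝕜) ^ (2 * n) * (q : 𝕜) ^ 2 := fun n => by
    rw [mul_add, zpow_add₀ hq0]
    norm_cast
  refine ⟨qhLift q c (skewU 𝕜) (skewV q) (skewW q c) ?_ ?_ ?_ ?_,
    qhLift_u q c _ _ _ _ _ _ _, qhLift_v q c _ _ _ _ _ _ _⟩ <;>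
  · ext f n t
    simp only [LinearMap.sub_apply, LinearMap.smul_apply, LinearMap.add_apply, LinearMap.neg_apply,
      LinearMap.zero_apply, Module.End.mul_apply, Module.algebraMap_end_apply, Pi.sub_apply,
      Pi.smul_apply, Pi.add_apply, Pi.neg_apply, Pi.zero_apply, smul_eq_mul, skewU_apply,
      skewV_apply, skewW_apply, e1, e2, sub_add_cancel, add_sub_cancel_right]
    have hx : (q : 𝕜) ^ (2 * n) ≠ 0 := zpow_ne_zero _ hq0
    generalize (q : 𝕜) ^ (2 * n) = x at *
    field_simp
    ring

include hq in
theorem linearIndependent_u_pow_mul_v_pow (a : ℕ) :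
    LinearIndependent 𝕜 fun b : ℕ => u ^ a * v ^ b := by
  have : Infinite 𝕜 := Infinite.of_injective _ (zpow_injective_of_generic hq)
  obtain ⟨φ, hu, hv⟩ := exists_skewRep hq c
  -- apply `uᵃ vᵇ` to the constant function `1` and evaluate at `n = a`
  let L : QH q c →ₗ[𝕜] (𝕜 → 𝕜) := LinearMap.proj (a : ℤ) ∘ₗ
    LinearMap.applyₗ (1 : ℤ → 𝕜 → 𝕜) ∘ₗ φ.toLinearMap
  have hU : ∀ (a : ℕ) (f : ℤ → 𝕜 → 𝕜) n, (skewU 𝕜 ^ a) f n = f (n - a) := by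
    intro a
    induction a with
    | zero => simp
    | succ a ih =>
      intro f n
      ext t
      rw [pow_succ, Module.End.mul_apply, ih, skewU_apply]
      simp [sub_sub]
  have hV : ∀ b t, (skewV q ^ b) (1 : ℤ → 𝕜 → 𝕜) 0 t = t ^ b := by
    intro b t
    induction b with
    | zero => simp
    | succ b ih =>
      rw [pow_succ', Module.End.mul_apply, skewV_apply, ih]
      simp [pow_succ']
  have hL : ∀ b, L (u ^ a * v ^ b) = fun t => t ^ b := by
    intro b
    ext t
    simp [L, hu, hv, hU, hV]
  apply LinearIndependent.of_comp L
  let ev : Polynomial 𝕜 →ₗ[𝕜] (𝕜 → 𝕜) := LinearMap.pi fun t => Polynomial.leval t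
  have h := (Polynomial.basisMonomials 𝕜).linearIndependent.map' ev (by
    rw [LinearMap.ker_eq_bot']
    intro p hp
    exact Polynomial.funext fun t => by simpa [ev] using congrFun hp t)
  have e : L ∘ (fun b : ℕ => u ^ a * v ^ b) = ev ∘ Polynomial.basisMonomials 𝕜 := by
    ext b t
    simp [hL, ev, Polynomial.leval]
  rw [e]
  exact h

end Monomials

/-! ### Highest weight vectors in the algebra of the quantum hyperboloid -/

section HighestAlgebra

variable {𝕜 : Type*} [Field 𝕜] {q : 𝕜ˣ} (hq : ∀ n : ℕ, 0 < n → q ^ n ≠ 1) (c : 𝕜)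

local notation "u" => qhGen q c 0
local notation "v" => qhGen q c 1

theorem qhX_v_pow (b : ℕ) : qhX q c (v ^ b) =
    -(((q : 𝕜) + (q : 𝕜)⁻¹) * ∑ i ∈ Finset.range b, ((q : 𝕜) ^ 2) ^ i) • (u * v ^ (b - 1)) := by
  induction b with
  | zero => simpa using qhX_algebraMap q c 1
  | succ b ih =>
    have e : u * v ^ (b - 1) * v = u * v ^ b ∨ b = 0 := by
      cases b with
      | zero => exact Or.inr rfl
      | succ b => exact Or.inl (by rw [mul_assoc, ← pow_succ, Nat.add_sub_cancel])
    rw [pow_succ, qhX_mul, ih, map_pow, qhKinv_v, qhX_v, mul_smul_comm, v_pow_mul_u, smul_mul_assoc,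
      smul_smul, Finset.sum_range_succ, Nat.add_sub_cancel, pow_mul]
    rcases e with e | rfl
    · rw [e, ← add_smul]
      congr 1
      ring
    · simp

theorem qhX_u_pow (a : ℕ) : qhX q c (u ^ a) = 0 := by
  induction a with
  | zero => simpa using qhX_algebraMap q c 1
  | succ a ih => rw [pow_succ, qhX_mul, ih, qhX_u, zero_mul, mul_zero, add_zero]

theorem qhKinv_u_pow (a : ℕ) : qhKinv q c (u ^ a) = ((q : 𝕜) ^ (2 * a))⁻¹ • u ^ a := by
  rw [map_pow, qhKinv_u, smul_pow, inv_pow, inv_pow, pow_mul]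

theorem qhX_u_pow_mul_v_pow (a b : ℕ) : qhX q c (u ^ a * v ^ (b + 1)) =
    -(((q : 𝕜) ^ (2 * a))⁻¹ * (((q : 𝕜) + (q : 𝕜)⁻¹) *
      ∑ i ∈ Finset.range (b + 1), ((q : 𝕜) ^ 2) ^ i)) • (u ^ (a + 1) * v ^ b) := by
  rw [qhX_mul, qhX_u_pow, zero_mul, zero_add, qhKinv_u_pow, qhX_v_pow, mul_smul_comm,
    smul_mul_assoc, smul_smul, Nat.add_sub_cancel, ← mul_assoc, ← pow_succ]
  congr 1
  ring

include hq

theorem geom_sum_sq_ne_zero (b : ℕ) : ∑ i ∈ Finset.range (b + 1), ((q : 𝕜) ^ 2) ^ i ≠ 0 := by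
  intro h
  have h1 := geom_sum_mul ((q : 𝕜) ^ 2) (b + 1)
  rw [h, zero_mul, eq_comm, sub_eq_zero, ← pow_mul] at h1
  exact hq (2 * (b + 1)) (by omega) (Units.ext (by simpa using h1))

theorem u_pow_ne_zero (a : ℕ) : u ^ a ≠ 0 := by
  simpa using (linearIndependent_u_pow_mul_v_pow hq c a).ne_zero 0

theorem linearIndependent_u_pow : LinearIndependent 𝕜 fun a : ℕ => u ^ a :=
  ((iSupIndep_wtSpace (ρ := qhRep q c) hq).comp (f := fun a : ℕ => (a : ℤ))
    Nat.cast_injective).linearIndependent _ (fun a => u_pow_mem_wtSpace c a)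
    fun a => u_pow_ne_zero hq c a

theorem isHW_u_pow (a : ℕ) : IsHW (qhRep q c) a (u ^ a) :=
  ⟨u_pow_ne_zero hq c a, by rw [qhRep_X, qhX_u_pow], u_pow_mem_wtSpace c a⟩

/-- The powers of `u` are the highest weight vectors: on `uᵃ K[v]` the operator `X` is a
`q`-derivative followed by an injection into `u^(a+1) K[v]`. -/
theorem eq_smul_u_pow {a : ℕ} {f : QH q c} (hf : f ∈ wtSpace (qhRep q c) a)
    (hX : qhX q c f = 0) : ∃ s : 𝕜, f = s • u ^ a := by
  rw [← span_mono_eq_wtSpace hq, Finsupp.mem_span_range_iff_exists_finsupp] at hf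
  obtain ⟨x, rfl⟩ := hf
  obtain ⟨N, hN⟩ := x.support.exists_nat_subset_range
  simp only [mono_natCast] at hX ⊢
  rw [Finsupp.sum_of_support_subset x (hN.trans (Finset.range_subset_range.mpr N.le_succ)) _
    (by simp), Finset.sum_range_succ'] at hX ⊢
  rw [map_add, map_sum] at hX
  simp only [map_smul, qhX_u_pow_mul_v_pow, pow_zero, mul_one, qhX_u_pow, smul_zero, add_zero,
    smul_smul] at hX
  have h0 := linearIndependent_iff'.mp (linearIndependent_u_pow_mul_v_pow hq c (a + 1)) _ _ hX
  refine ⟨x 0, ?_⟩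
  rw [pow_zero, mul_one, add_eq_right]
  refine Finset.sum_eq_zero fun b hb => ?_
  have := h0 b hb
  have h1 := geom_sum_sq_ne_zero hq b
  have h2 := add_inv_ne_zero hq
  have h3 : ((q : 𝕜) ^ (2 * a))⁻¹ ≠ 0 := inv_ne_zero (pow_ne_zero _ q.ne_zero)
  simp only [mul_eq_zero, neg_eq_zero, h1, h2, h3, or_false] at this
  rw [this, zero_smul]

/-- A vector of negative weight whose image under `X` is a scalar vanishes. -/
theorem eq_zero_of_neg_weight {n : ℤ} (hn : n < 0) {f : QH q c} (hf : f ∈ wtSpace (qhRep q c) n)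
    {s : 𝕜} (hX : qhX q c f = s • 1) : f = 0 := by
  have := mem_of_neg_weight hq (locNilp_qhRep (q := q) c) (N := ⊥) (by simp) hn hf (fun i => by
    rw [qhRep_X, hX, pow_succ, Module.End.mul_apply, qhRep_Y, ← Algebra.algebraMap_eq_smul_one,
      qhY_algebraMap, map_zero]
    simp)
  simpa using this

theorem Vk_eq (k : ℕ) : Vk q c k = cyc (qhRep q c) (u ^ k) := by
  refine spinComponent_eq_cyc hq (locNilp_qhRep c) (by simp) (by simp) (isHW_u_pow hq c k) ?_
  intro y _ hy
  exact eq_smul_u_pow hq c hy.mem_wt (by rw [← qhRep_X]; exact hy.X_eq_zero)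

theorem u_pow_mem_Vk (k : ℕ) : u ^ k ∈ Vk q c k := by
  rw [Vk_eq hq]
  exact self_mem_cyc _

theorem Vk_stable (k : ℕ) (z : Uq q) : ∀ x ∈ Vk q c k, qhRep q c z x ∈ Vk q c k := by
  rw [Vk_eq hq]
  exact cyc_stable hq (isHW_u_pow hq c k).mem_wt (isHW_u_pow hq c k).X_eq_zero z

/-- `V_k` contains no power of `u` but `u^k`. -/
theorem eq_zero_of_smul_u_pow_mem_Vk {k a : ℕ} (hka : a ≠ k) {s : 𝕜}
    (h : s • u ^ a ∈ Vk q c k) : s = 0 := by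
  rw [Vk_eq hq] at h
  obtain ⟨t, ht⟩ := (isHW_u_pow hq c k).mem_span_of_X_eq_zero hq (locNilp_qhRep c) h
    (by rw [qhRep_X, map_smul, qhX_u_pow, smul_zero])
  have := (linearIndependent_u_pow (q := q) hq c)
    (a₁ := Finsupp.single a s) (a₂ := Finsupp.single k t) (by
      simpa only [Finsupp.linearCombination_single] using ht)
  rcases Finsupp.single_eq_single_iff _ _ _ _ |>.mp this with h | h
  · exact absurd h.1 hka
  · exact h.1

/-- `Y u^(a+1)` is a nonzero multiple of `uᵃ v`. -/
theorem u_pow_mul_v_mem_Vk (a : ℕ) : u ^ a * v ∈ Vk q c (a + 1) := by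
  have h : ∀ a, ∃ s : 𝕜, qhY q c (u ^ (a + 1)) = s • (u ^ a * v) := by
    intro a
    induction a with
    | zero => exact ⟨-1, by simp⟩
    | succ a ih =>
      obtain ⟨s, hs⟩ := ih
      refine ⟨-1 + s * (q : 𝕜) ^ 2 * (q : 𝕜) ^ 2, ?_⟩
      rw [pow_succ _ (a + 1), qhY_mul, hs, qhY_u, qhK_u, mul_smul_comm, smul_mul_assoc, mul_assoc,
        qh_vu, mul_smul_comm, ← mul_assoc, ← pow_succ, smul_smul, smul_smul, add_smul, neg_smul,
        one_smul, mul_neg]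
      congr 2
      ring
  obtain ⟨s, hs⟩ := h a
  have hY := Vk_stable hq c (a + 1) (uqGen q .Y) _ (u_pow_mem_Vk hq c (a + 1))
  have h0 := (isHW_u_pow hq c (a + 1)).pow_ne_zero hq (locNilp_qhRep c) (i := 1) (by omega)
  rw [pow_one, qhRep_Y, hs] at h0
  rw [qhRep_Y, hs] at hY
  exact (Submodule.smul_mem_iff _ (fun e => h0 (by rw [e, zero_smul]))).mp hY

/-- An injectivity criterion for maps of the algebra which commute with `X` and `K` up to scalars:
it suffices to test the powers of `u`. -/
theorem ker_eq_bot_of_u_pow {f : QH q c →ₗ[𝕜] QH q c}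
    (hX : ∀ x, f x = 0 → f (qhX q c x) = 0) (hK : ∀ x, f x = 0 → f (qhK q c x) = 0)
    (hu : ∀ a, f (u ^ a) ≠ 0) : LinearMap.ker f = ⊥ := by
  refine eq_bot_of_inf_wtSpace hq (iSup_wtSpace_qhRep hq c) (fun x hx => ?_) fun n x hx hxn => ?_
  · rw [qhRep_K]
    exact hK x hx
  · obtain ⟨k, hk⟩ := (locNilp_qhRep c).X x
    induction k generalizing x n with
    | zero => simpa using hk
    | succ k ih =>
      have h0 : qhX q c x = 0 := by
        rw [← qhRep_X]
        refine ih (n + 1) _ ?_ (opX_mem_wtSpace hxn) (by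
          rwa [pow_succ, Module.End.mul_apply] at hk)
        rw [qhRep_X]
        exact hX x hx
      rcases lt_or_ge n 0 with hn | hn
      · exact eq_zero_of_neg_weight hq c hn hxn (s := 0) (by simpa using h0)
      · lift n to ℕ using hn
        obtain ⟨s, rfl⟩ := eq_smul_u_pow hq c hxn h0
        rw [LinearMap.mem_ker, map_smul, smul_eq_zero, or_iff_left (hu n)] at hx
        rw [hx, zero_smul]

theorem eq_zero_of_mul_u {f : QH q c} (hf : f * u = 0) : f = 0 := by
  have h := ker_eq_bot_of_u_pow hq c (f := LinearMap.mulRight 𝕜 u) (fun x hx => ?_)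
    (fun x hx => ?_) fun a => ?_
  · exact (Submodule.mem_bot 𝕜).mp (h ▸ (show f ∈ LinearMap.ker (LinearMap.mulRight 𝕜 u) from hf))
  · have := congrArg (qhX q c) hx
    simpa [qhX_mul] using this
  · have := congrArg (qhK q c) hx
    simpa using this
  · simpa [← pow_succ] using u_pow_ne_zero hq c (a + 1)

theorem eq_zero_of_u_mul {f : QH q c} (hf : u * f = 0) : f = 0 := by
  have h := ker_eq_bot_of_u_pow hq c (f := LinearMap.mulLeft 𝕜 u) (fun x hx => ?_)
    (fun x hx => ?_) fun a => ?_
  · exact (Submodule.mem_bot 𝕜).mp (h ▸ (show f ∈ LinearMap.ker (LinearMap.mulLeft 𝕜 u) from hf))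
  · have := congrArg (qhX q c) hx
    simpa [qhX_mul] using this
  · have := congrArg (qhK q c) hx
    simpa using this
  · simpa [← pow_succ'] using u_pow_ne_zero hq c (a + 1)

end HighestAlgebra

/-! ### Tangent modules in coordinates -/

section Tangent

variable {𝕜 : Type*} [Field 𝕜] {q : 𝕜ˣ} {c : 𝕜} {M : Type*} [AddCommGroup M] [Module 𝕜 M]

local notation "u" => qhGen q c 0

/-- What the left and the right modules have in common. `M` is a free module with basis `U, V, W`
over the algebra, `N` is the submodule generated by the invariant element `κ`, `tens k` is the
tensor product of `V_k` and `V'`, and `gen` is the copy of `V'` in `M`. The action of `X` on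
coordinates involves scalars `r₀, r₂` and a linear map `τ` which come from the coproduct and differ
on the two sides. -/
structure TangentData (ρ : UqRep q M) (N : Submodule 𝕜 M) (tens : ℕ → Submodule 𝕜 M)
    (gen : Submodule 𝕜 M) where
  /-- The coefficients of `U`, `V` and `W`. -/
  coord : M ≃ₗ[𝕜] (Fin 3 → QH q c)
  /-- The scalar by which the action of `X` on the coefficient of `U` is twisted. -/
  r₀ : 𝕜
  /-- The scalar by which the action of `X` on the coefficient of `W` is twisted. -/
  r₂ : 𝕜
  /-- The map by which a coefficient is twisted when `X` acts on `V` or `W`. -/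
  τ : QH q c →ₗ[𝕜] QH q c
  /-- The eigenvalues of `τ` on the powers of `u`. -/
  t : ℕ → 𝕜
  r₀_ne_zero : r₀ ≠ 0
  r₂_ne_zero : r₂ ≠ 0
  t_ne_zero : ∀ n, t n ≠ 0
  τ_u_pow : ∀ n, τ (u ^ n) = t n • u ^ n
  coord_X_zero : ∀ m, coord (opX ρ m) 0 =
    r₀ • qhX q c (coord m 0) - ((q : 𝕜) + (q : 𝕜)⁻¹) • τ (coord m 1)
  coord_X_one : ∀ m, coord (opX ρ m) 1 = qhX q c (coord m 1) + τ (coord m 2)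
  coord_X_two : ∀ m, coord (opX ρ m) 2 = r₂ • qhX q c (coord m 2)
  mem_wt_iff : ∀ (n : ℤ) (m : M), m ∈ wtSpace ρ n ↔ coord m 0 ∈ wtSpace (qhRep q c) (n - 1) ∧
    coord m 1 ∈ wtSpace (qhRep q c) n ∧ coord m 2 ∈ wtSpace (qhRep q c) (n + 1)
  locNilp : LocNilp ρ
  stable : ∀ z, ∀ m ∈ N, ρ z m ∈ N
  eq_zero_of_mem : ∀ m ∈ N, coord m 2 = 0 → m = 0
  exists_kappa : ∀ n : ℕ, ∃ m ∈ N, m ∈ wtSpace ρ n ∧ opX ρ m = 0 ∧ coord m 2 = u ^ (n + 1) ∧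
    coord m 1 ∈ Vk q c (n + 1)
  mem_tens_iff : ∀ k m, m ∈ tens k ↔ ∀ i, coord m i ∈ Vk q c k
  tens_stable : ∀ k z, ∀ m ∈ tens k, ρ z m ∈ tens k
  gen_eq : gen = cyc ρ (coord.symm ![1, 0, 0])

namespace TangentData

variable {ρ : UqRep q M} {N : Submodule 𝕜 M} {tens : ℕ → Submodule 𝕜 M} {gen : Submodule 𝕜 M}
  (S : TangentData (c := c) ρ N tens gen)

/-- The vector `u^k U`. -/
def topVec (k : ℕ) : M := S.coord.symm ![u ^ k, 0, 0]

/-- The highest weight vector of spin `k + 1` with the coefficient `u^(k+1)` of `V` and no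
component along `W`. -/
def midVec (k : ℕ) : M :=
  S.coord.symm ![(((q : 𝕜) + (q : 𝕜)⁻¹) * S.t (k + 1) * S.r₀⁻¹ * (qInt q (2 * (k + 1)))⁻¹) •
    qhY q c (u ^ (k + 1)), u ^ (k + 1), 0]

/-- The highest weight vectors generating the members of the basis. -/
def vec : BasisIdx → M
  | .gen => S.topVec 0
  | .mid k => S.midVec k
  | .top k => S.topVec (k + 1)

/-- The members of the basis. -/
def block (ρ : UqRep q M) (tens : ℕ → Submodule 𝕜 M) (gen : Submodule 𝕜 M) :
    BasisIdx → Submodule 𝕜 M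
  | .gen => gen
  | .mid k => spinComponent ρ (tens (k + 1)) (k + 1)
  | .top k => spinComponent ρ (tens (k + 1)) (k + 2)

@[simp] theorem coord_topVec (k : ℕ) : S.coord (S.topVec k) = ![u ^ k, 0, 0] := by
  simp [topVec]

theorem coord_midVec_one (k : ℕ) : S.coord (S.midVec k) 1 = u ^ (k + 1) := by
  simp [midVec]

theorem coord_midVec_two (k : ℕ) : S.coord (S.midVec k) 2 = 0 := by
  simp [midVec]

theorem ext_coord {m m' : M} (h0 : S.coord m 0 = S.coord m' 0) (h1 : S.coord m 1 = S.coord m' 1)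
    (h2 : S.coord m 2 = S.coord m' 2) : m = m' := by
  apply S.coord.injective
  ext i
  fin_cases i
  exacts [h0, h1, h2]

variable (hq : ∀ n : ℕ, 0 < n → q ^ n ≠ 1)
include S hq

theorem coord_midVec_zero_mem (k : ℕ) : S.coord (S.midVec k) 0 ∈ Vk q c (k + 1) := by
  have h := Vk_stable hq c (k + 1) (uqGen q .Y) _ (u_pow_mem_Vk hq c (k + 1))
  rw [qhRep_Y] at h
  simpa [midVec] using Submodule.smul_mem _ _ h

theorem isHW_topVec (k : ℕ) : IsHW ρ (k + 1) (S.topVec k) where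
  ne_zero h := by
    have := congrFun (congrArg S.coord h) 0
    simp [u_pow_ne_zero hq] at this
  X_eq_zero := S.ext_coord (by simp [S.coord_X_zero, qhX_u_pow]) (by simp [S.coord_X_one])
    (by simp [S.coord_X_two])
  mem_wt := by
    rw [S.mem_wt_iff]
    simpa using u_pow_mem_wtSpace c k

theorem isHW_midVec (k : ℕ) : IsHW ρ (k + 1) (S.midVec k) where
  ne_zero h := by
    have := congrFun (congrArg S.coord h) 1
    simp [u_pow_ne_zero hq, coord_midVec_one] at this
  X_eq_zero := by
    refine S.ext_coord ?_ ?_ ?_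
    · have h := opX_opY hq (u_pow_mem_wtSpace (q := q) c (k + 1))
      rw [qhRep_X, qhRep_X, qhRep_Y, qhX_u_pow, map_zero, zero_add] at h
      have hne : qInt q (2 * ((k : ℤ) + 1)) ≠ 0 := qInt_ne_zero hq (by omega)
      have hr := S.r₀_ne_zero
      rw [S.coord_X_zero, coord_midVec_one, S.τ_u_pow]
      simp only [midVec, LinearEquiv.apply_symm_apply, Matrix.cons_val_zero, map_smul, h, smul_smul,
        ← sub_smul]
      simp only [map_zero, Pi.zero_apply, smul_eq_zero]
      left
      push_cast
      field_simp
      ring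
    · simp [S.coord_X_one, coord_midVec_one, coord_midVec_two, qhX_u_pow]
    · simp [S.coord_X_two, coord_midVec_two]
  mem_wt := by
    rw [S.mem_wt_iff, coord_midVec_one, coord_midVec_two]
    refine ⟨?_, u_pow_mem_wtSpace c (k + 1), Submodule.zero_mem _⟩
    have h := opY_mem_wtSpace (u_pow_mem_wtSpace (q := q) c (k + 1))
    rw [qhRep_Y] at h
    simpa [midVec] using Submodule.smul_mem _ _ h

theorem isHW_vec (i : BasisIdx) : IsHW ρ i.spin (S.vec i) := by
  cases i with
  | gen => exact S.isHW_topVec hq 0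
  | mid k => exact S.isHW_midVec hq k
  | top k => exact S.isHW_topVec hq (k + 1)

/-- The coefficient of `W` in a highest weight vector is itself a highest weight vector. -/
theorem coord_two_of_highest {n : ℕ} {m : M} (hm : m ∈ wtSpace ρ n) (hX : opX ρ m = 0) :
    ∃ s : 𝕜, S.coord m 2 = s • u ^ (n + 1) := by
  refine eq_smul_u_pow hq c (by simpa using ((S.mem_wt_iff _ _).mp hm).2.2) ?_
  have := S.coord_X_two m
  rw [hX, map_zero, Pi.zero_apply, eq_comm, smul_eq_zero] at this
  exact this.resolve_left S.r₂_ne_zero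

/-- If the coefficient of `W` vanishes, that of `V` is a highest weight vector. -/
theorem coord_one_of_highest {n : ℕ} {m : M} (hm : m ∈ wtSpace ρ n) (hX : opX ρ m = 0)
    (h2 : S.coord m 2 = 0) : ∃ s : 𝕜, S.coord m 1 = s • u ^ n := by
  refine eq_smul_u_pow hq c ((S.mem_wt_iff _ _).mp hm).2.1 ?_
  have := S.coord_X_one m
  rwa [hX, h2, map_zero, Pi.zero_apply, map_zero, add_zero, eq_comm] at this

/-- There is no invariant without `W`: its coefficient of `V` would be a scalar in the image under
`X` of a weight vector of weight `-2`. -/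
theorem eq_zero_of_highest {m : M} (hm : m ∈ wtSpace ρ (0 : ℕ)) (hX : opX ρ m = 0)
    (h2 : S.coord m 2 = 0) : m = 0 := by
  obtain ⟨s, hs⟩ := S.coord_one_of_highest hq hm hX h2
  have h := S.coord_X_zero m
  rw [hX, map_zero, Pi.zero_apply, eq_comm, sub_eq_zero, hs, map_smul, S.τ_u_pow, pow_zero] at h
  have h0 : S.coord m 0 = 0 := by
    refine eq_zero_of_neg_weight hq c (n := -1) (by norm_num)
      (by simpa using ((S.mem_wt_iff _ _).mp hm).1)
      (s := S.r₀⁻¹ * (((q : 𝕜) + (q : 𝕜)⁻¹) * (s * S.t 0))) ?_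
    rw [mul_smul, mul_smul, mul_smul, ← h, inv_smul_smul₀ S.r₀_ne_zero]
  rw [h0, map_zero, smul_zero, eq_comm, smul_eq_zero, smul_eq_zero, smul_eq_zero] at h
  have h1 : (1 : QH q c) ≠ 0 := by simpa using u_pow_ne_zero hq c 0
  have hs0 : s = 0 := by
    simpa [add_inv_ne_zero hq, S.t_ne_zero, h1] using h
  exact S.ext_coord (by simpa using h0) (by simp [hs, hs0]) (by simpa using h2)

/-- The highest weight vectors of spin `k + 1` without `W` form a plane. -/
theorem eq_add_of_highest {k : ℕ} {m : M} (hm : m ∈ wtSpace ρ (k + 1 : ℕ)) (hX : opX ρ m = 0)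
    (h2 : S.coord m 2 = 0) : ∃ s s' : 𝕜, m = s • S.midVec k + s' • S.topVec k := by
  obtain ⟨s, hs⟩ := S.coord_one_of_highest hq hm hX h2
  have hmid := S.isHW_midVec hq k
  have hX' : opX ρ (m - s • S.midVec k) = 0 := by
    rw [map_sub, map_smul, hX, hmid.X_eq_zero, smul_zero, sub_zero]
  have hw' := Submodule.sub_mem _ hm (Submodule.smul_mem _ s hmid.mem_wt)
  have h1 : S.coord (m - s • S.midVec k) 1 = 0 := by
    simp [hs, coord_midVec_one]
  have h0 := S.coord_X_zero (m - s • S.midVec k)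
  rw [hX', h1, map_zero, map_zero, Pi.zero_apply, smul_zero, sub_zero, eq_comm, smul_eq_zero,
    or_iff_right S.r₀_ne_zero] at h0
  obtain ⟨s', hs'⟩ := eq_smul_u_pow hq c (a := k) (by
    simpa using ((S.mem_wt_iff _ _).mp hw').1) h0
  refine ⟨s, s', ?_⟩
  rw [← sub_eq_iff_eq_add']
  exact S.ext_coord (by simpa using hs') (by simpa using h1) (by simp [h2, coord_midVec_two])

theorem iSup_wtSpace : ⨆ n, wtSpace ρ n = ⊤ := by
  have key : ∀ (i : Fin 3) (a : QH q c), S.coord.symm (Pi.single i a) ∈ ⨆ n, wtSpace ρ n := by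
    intro i a
    suffices ⊤ ≤ (⨆ n, wtSpace ρ n).comap
      (S.coord.symm.toLinearMap ∘ₗ LinearMap.single 𝕜 (fun _ => QH q c) i) from this trivial
    rw [← iSup_wtSpace_qhRep hq c]
    refine iSup_le fun n a ha => ?_
    refine Submodule.mem_iSup_of_mem (n + (1 - (i : ℕ))) ?_
    simp only [LinearMap.comp_apply, LinearEquiv.coe_coe, LinearMap.single_apply, S.mem_wt_iff,
      LinearEquiv.apply_symm_apply]
    fin_cases i <;> simp [ha]
  rw [eq_top_iff]
  intro m _
  rw [← S.coord.symm_apply_apply m, ← Finset.univ_sum_single (S.coord m), map_sum]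
  exact Submodule.sum_mem _ fun i _ => key i _

theorem topVec_mem_tens (k : ℕ) : S.topVec k ∈ tens k := by
  rw [S.mem_tens_iff]
  intro i
  fin_cases i <;> simp [u_pow_mem_Vk hq c k]

theorem midVec_mem_tens (k : ℕ) : S.midVec k ∈ tens (k + 1) := by
  rw [S.mem_tens_iff]
  intro i
  fin_cases i
  · exact S.coord_midVec_zero_mem hq k
  · simpa [coord_midVec_one] using u_pow_mem_Vk hq c (k + 1)
  · simp [coord_midVec_two]

theorem coord_two_of_mem_tens {n k : ℕ} (hnk : n + 1 ≠ k) {m : M} (hm : m ∈ tens k)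
    (h : IsHW ρ n m) : S.coord m 2 = 0 := by
  obtain ⟨s, hs⟩ := S.coord_two_of_highest hq h.mem_wt h.X_eq_zero
  have := (S.mem_tens_iff _ _).mp hm 2
  rw [hs] at this
  rw [hs, eq_zero_of_smul_u_pow_mem_Vk hq c hnk this, zero_smul]

/-- The members of the basis are generated by the vectors `vec i`: in `V_{k+1} ⊗ V'` the powers of
`u` other than `u^(k+1)` cannot occur as coefficients, which leaves a line of highest weight
vectors of each spin. -/
theorem block_eq (i : BasisIdx) : block ρ tens gen i = cyc ρ (S.vec i) := by
  cases i with
  | gen => simpa [block, vec, topVec] using S.gen_eq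
  | mid k =>
    refine spinComponent_eq_cyc hq S.locNilp (fun x hx => S.tens_stable _ _ x hx)
      (S.midVec_mem_tens hq k) (S.isHW_midVec hq k) fun y hy hyw => ?_
    obtain ⟨s, s', rfl⟩ := S.eq_add_of_highest hq hyw.mem_wt hyw.X_eq_zero
      (S.coord_two_of_mem_tens hq (by omega) hy hyw)
    have h := (S.mem_tens_iff _ _).mp hy 0
    simp only [map_add, map_smul, Pi.add_apply, Pi.smul_apply, coord_topVec,
      Matrix.cons_val_zero] at h
    rw [Submodule.add_mem_iff_right _ (Submodule.smul_mem _ _ (S.coord_midVec_zero_mem hq k))] at h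
    rw [eq_zero_of_smul_u_pow_mem_Vk hq c (by omega) h]
    exact ⟨s, by simp [vec]⟩
  | top k =>
    refine spinComponent_eq_cyc hq S.locNilp (fun x hx => S.tens_stable _ _ x hx)
      (S.topVec_mem_tens hq (k + 1)) (S.isHW_topVec hq (k + 1)) fun y hy hyw => ?_
    obtain ⟨s, s', rfl⟩ := S.eq_add_of_highest hq hyw.mem_wt hyw.X_eq_zero
      (S.coord_two_of_mem_tens hq (by omega) hy hyw)
    have h := (S.mem_tens_iff _ _).mp hy 1
    simp only [map_add, map_smul, Pi.add_apply, Pi.smul_apply, coord_topVec, coord_midVec_one,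
      Matrix.cons_val_one, Matrix.cons_val_zero, smul_zero, add_zero] at h
    rw [eq_zero_of_smul_u_pow_mem_Vk hq c (by omega) h]
    exact ⟨s', by simp [vec]⟩

/-- A highest weight vector becomes free of `W` after subtracting a multiple of some `uⁿ κ`. -/
theorem exists_sub_mem {n : ℕ} {m : M} (hm : m ∈ wtSpace ρ n) (hX : opX ρ m = 0) :
    ∃ y ∈ N, m - y ∈ wtSpace ρ n ∧ opX ρ (m - y) = 0 ∧ S.coord (m - y) 2 = 0 ∧
      S.coord y 1 ∈ Vk q c (n + 1) := by
  obtain ⟨s, hs⟩ := S.coord_two_of_highest hq hm hX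
  obtain ⟨y, hyN, hyw, hyX, hy2, hy1⟩ := S.exists_kappa n
  refine ⟨s • y, N.smul_mem _ hyN, Submodule.sub_mem _ hm (Submodule.smul_mem _ _ hyw), ?_, ?_, ?_⟩
  · rw [map_sub, map_smul, hX, hyX, smul_zero, sub_zero]
  · simp [hs, hy2]
  · simpa using Submodule.smul_mem _ s hy1

/-- The component of `tens (n + 1)` of spin `n` is redundant modulo `N`. -/
theorem bottom_le (n : ℕ) : spinComponent ρ (tens (n + 1)) n ≤ N ⊔ ⨆ j < n, tens j := by
  refine sSup_le ?_
  rintro W ⟨hWP, hW⟩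
  obtain ⟨m, hm, hmw, rfl⟩ := exists_isHW_of_isSpinModule hq hW
  have hm' := hWP hm
  obtain ⟨y, hyN, hw, hX, h2, h1⟩ := S.exists_sub_mem hq hmw.mem_wt hmw.X_eq_zero
  cases n with
  | zero =>
    refine le_trans (cyc_le (fun x hx => S.stable (uqGen q .Y) x hx) ?_) le_sup_left
    have hmy : m - y = 0 := S.eq_zero_of_highest hq hw hX h2
    rw [sub_eq_zero.mp hmy]
    exact hyN
  | succ k =>
    have hle : tens k ≤ ⨆ j < k + 1, tens j :=
      le_iSup₂_of_le (f := fun j (_ : j < k + 1) => tens j) k k.lt_succ_self le_rfl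
    refine le_trans (b := N ⊔ tens k) (cyc_le (fun x hx => ?_) ?_) (sup_le_sup_left hle N)
    · obtain ⟨a, ha, b, hb, rfl⟩ := Submodule.mem_sup.mp hx
      rw [map_add]
      exact Submodule.add_mem_sup (S.stable (uqGen q .Y) a ha)
        (S.tens_stable k (uqGen q .Y) b hb)
    · obtain ⟨s, s', hs⟩ := S.eq_add_of_highest hq hw hX h2
      have h := Submodule.sub_mem _ ((S.mem_tens_iff _ _).mp hm' 1) h1
      rw [← Pi.sub_apply, ← map_sub, hs] at h
      simp only [map_add, map_smul, Pi.add_apply, Pi.smul_apply, coord_topVec, coord_midVec_one,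
        Matrix.cons_val_one, Matrix.cons_val_zero, smul_zero, add_zero] at h
      rw [eq_zero_of_smul_u_pow_mem_Vk hq c (by omega) h, zero_smul, zero_add,
        sub_eq_iff_eq_add'] at hs
      rw [hs]
      exact Submodule.add_mem_sup hyN (Submodule.smul_mem _ _ (S.topVec_mem_tens hq k))

/-- The members of the basis and `N` contain all highest weight vectors, hence span. -/
theorem sup_iSup_eq_top : N ⊔ ⨆ i, cyc ρ (S.vec i) = ⊤ := by
  have hst : ∀ i z, ∀ x ∈ cyc ρ (S.vec i), ρ z x ∈ cyc ρ (S.vec i) := fun i =>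
    cyc_stable hq (S.isHW_vec hq i).mem_wt (S.isHW_vec hq i).X_eq_zero
  have hmem : ∀ i, S.vec i ∈ N ⊔ ⨆ i, cyc ρ (S.vec i) := fun i =>
    Submodule.mem_sup_right (Submodule.mem_iSup_of_mem i (self_mem_cyc _))
  refine eq_top_of_highest hq S.locNilp (S.iSup_wtSpace hq) (fun z => ?_) fun n m hm => ?_
  · suffices N ⊔ ⨆ i, cyc ρ (S.vec i) ≤ (N ⊔ ⨆ i, cyc ρ (S.vec i)).comap (ρ z) from
      fun x hx => this hx
    refine sup_le (fun x hx => Submodule.mem_sup_left (S.stable z x hx)) (iSup_le fun i x hx => ?_)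
    exact Submodule.mem_sup_right (Submodule.mem_iSup_of_mem i (hst i z x hx))
  · obtain ⟨y, hyN, hw, hX, h2, -⟩ := S.exists_sub_mem hq hm.mem_wt hm.X_eq_zero
    rw [← sub_add_cancel m y]
    refine Submodule.add_mem _ ?_ (Submodule.mem_sup_left hyN)
    cases n with
    | zero => rw [S.eq_zero_of_highest hq hw hX h2]; exact Submodule.zero_mem _
    | succ k =>
      obtain ⟨s, s', hs⟩ := S.eq_add_of_highest hq hw hX h2
      rw [hs]
      refine Submodule.add_mem _ (Submodule.smul_mem _ _ (hmem (.mid k)))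
        (Submodule.smul_mem _ _ ?_)
      cases k with
      | zero => exact hmem .gen
      | succ k => exact hmem (.top k)

theorem linearIndependent_vec : LinearIndependent 𝕜 S.vec := by
  have hu := linearIndependent_u_pow (q := q) hq c
  have htop : LinearIndependent 𝕜 S.topVec := by
    apply LinearIndependent.of_comp (LinearMap.proj 0 ∘ₗ S.coord.toLinearMap)
    convert hu using 1
    ext k
    simp
  have hmid : LinearIndependent 𝕜 (fun k => S.coord (S.midVec k) 1) := by
    simp only [coord_midVec_one]
    exact hu.comp _ (add_left_injective 1)
  have hdisj : Disjoint (Submodule.span 𝕜 (Set.range S.topVec))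
      (Submodule.span 𝕜 (Set.range S.midVec)) := by
    rw [Submodule.disjoint_def]
    intro x hx hx'
    have h1 : S.coord x 1 = 0 := by
      suffices Submodule.span 𝕜 (Set.range S.topVec) ≤
        LinearMap.ker (LinearMap.proj 1 ∘ₗ S.coord.toLinearMap) from this hx
      rw [Submodule.span_le]
      rintro _ ⟨k, rfl⟩
      simp
    obtain ⟨a, rfl⟩ := Finsupp.mem_span_range_iff_exists_finsupp.mp hx'
    have := linearIndependent_iff.mp hmid a (by
      rw [← h1, Finsupp.linearCombination_apply, Finsupp.sum, Finsupp.sum, map_sum,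
        Finset.sum_apply]
      simp)
    simp [this]
  have hsum := htop.sum_type (LinearIndependent.of_comp
    (LinearMap.proj 1 ∘ₗ S.coord.toLinearMap) hmid) hdisj
  let idx : BasisIdx → ℕ ⊕ ℕ := fun i => match i with
    | .gen => .inl 0
    | .mid k => .inr k
    | .top k => .inl (k + 1)
  have hidx : Function.Injective idx := by
    rintro (_ | _ | _) (_ | _ | _) h <;> simp_all [idx]
  have e : S.vec = Sum.elim S.topVec S.midVec ∘ idx := by
    ext i
    cases i <;> rfl
  rw [e]
  exact hsum.comp idx hidx

/-- The vectors `vec i` have no coefficient at `W`, so their span meets `N` trivially. -/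
theorem linearIndependent_mkQ_vec : LinearIndependent 𝕜 fun i => N.mkQ (S.vec i) := by
  refine (S.linearIndependent_vec hq).map (f := N.mkQ) ?_
  rw [Submodule.ker_mkQ, Submodule.disjoint_def]
  intro x hx hxN
  refine S.eq_zero_of_mem x hxN ?_
  suffices Submodule.span 𝕜 (Set.range S.vec) ≤
    LinearMap.ker (LinearMap.proj 2 ∘ₗ S.coord.toLinearMap) from this hx
  rw [Submodule.span_le]
  rintro _ ⟨i, rfl⟩
  cases i <;> simp [vec, coord_midVec_two]

/-- The module structure of the tangent module. -/
abbrev qRep : UqRep q (M ⧸ N) := quotRep ρ N S.stable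

omit hq in
theorem mkQ_rep (z : Uq q) (m : M) : N.mkQ (ρ z m) = S.qRep z (N.mkQ m) := rfl

theorem isHW_mkQ_vec (i : BasisIdx) : IsHW S.qRep i.spin (N.mkQ (S.vec i)) where
  ne_zero := (S.linearIndependent_mkQ_vec hq).ne_zero i
  X_eq_zero := by
    rw [← mkQ_rep, (S.isHW_vec hq i).X_eq_zero, map_zero]
  mem_wt := by
    rw [mem_wtSpace, ← mkQ_rep, mem_wtSpace.mp (S.isHW_vec hq i).mem_wt, map_smul]

omit hq in
theorem locNilp_qRep : LocNilp S.qRep := S.locNilp.quot N S.stable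

theorem map_block (i : BasisIdx) :
    (block ρ tens gen i).map N.mkQ = cyc S.qRep (N.mkQ (S.vec i)) := by
  rw [S.block_eq hq]
  exact map_cyc (ρ' := S.qRep) N.mkQ (fun x => rfl) _

theorem iSup_cyc_mkQ : ⨆ i, cyc S.qRep (N.mkQ (S.vec i)) = ⊤ := by
  have h := congrArg (Submodule.map N.mkQ) (S.sup_iSup_eq_top hq)
  rw [Submodule.map_sup, Submodule.map_iSup, Submodule.map_top, Submodule.range_mkQ,
    Submodule.mkQ_map_self, bot_sup_eq] at h
  simpa only [← S.map_block hq, S.block_eq hq] using h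

theorem iSupIndep_cyc_mkQ : iSupIndep fun i => cyc S.qRep (N.mkQ (S.vec i)) :=
  iSupIndep_cyc hq S.locNilp_qRep (S.isHW_mkQ_vec hq) (S.linearIndependent_mkQ_vec hq)

theorem injOn_block (i : BasisIdx) : Set.InjOn N.mkQ (block ρ tens gen i) := by
  rw [S.block_eq hq]
  have hi := S.isHW_vec hq i
  have hst := cyc_stable hq hi.mem_wt hi.X_eq_zero
  have hbot : cyc ρ (S.vec i) ⊓ N = ⊥ := by
    by_contra h0
    have e := hi.le_of_stable hq S.locNilp inf_le_left
      (fun z x hx => ⟨hst z x hx.1, S.stable z x hx.2⟩) h0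
    have hmem : S.vec i ∈ cyc ρ (S.vec i) ⊓ N := by
      rw [e]
      exact self_mem_cyc _
    exact (S.isHW_mkQ_vec hq i).ne_zero ((Submodule.Quotient.mk_eq_zero N).mpr hmem.2)
  intro x hx y hy hxy
  have hmem : x - y ∈ cyc ρ (S.vec i) ⊓ N :=
    ⟨Submodule.sub_mem _ hx hy, (Submodule.Quotient.eq N).mp hxy⟩
  rw [hbot, Submodule.mem_bot] at hmem
  exact sub_eq_zero.mp hmem

/-- The quotient by `N` is the direct sum of the images of the members of the basis, and the
components of `tens (n + 1)` of spin `n` contribute nothing new. -/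
theorem decomposition :
    (∀ i, Set.InjOn N.mkQ (block ρ tens gen i) ∧
      IsSpinModule S.qRep i.spin ((block ρ tens gen i).map N.mkQ)) ∧
    iSupIndep (fun i => (block ρ tens gen i).map N.mkQ) ∧
    (⨆ i, (block ρ tens gen i).map N.mkQ) = ⊤ ∧
    ∀ n, (spinComponent ρ (tens (n + 1)) n).map N.mkQ ≤ ⨆ j < n, (tens j).map N.mkQ := by
  simp only [S.map_block hq]
  refine ⟨fun i => ⟨S.injOn_block hq i, (S.isHW_mkQ_vec hq i).isSpinModule hq S.locNilp_qRep⟩,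
    S.iSupIndep_cyc_mkQ hq, S.iSup_cyc_mkQ hq, fun n => ?_⟩
  have h := Submodule.map_mono (f := N.mkQ) (S.bottom_le hq n)
  rw [Submodule.map_sup, Submodule.mkQ_map_self, bot_sup_eq] at h
  simpa only [Submodule.map_iSup] using h

/-- The generating vectors of the two sides have the same weights, which gives an isomorphism
matching the members of the bases, unique up to scalars by Schur's lemma. -/
theorem exists_identification {M' : Type*} [AddCommGroup M'] [Module 𝕜 M'] {ρ' : UqRep q M'}
    {N' : Submodule 𝕜 M'} {tens' : ℕ → Submodule 𝕜 M'} {gen' : Submodule 𝕜 M'}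
    (S' : TangentData (c := c) ρ' N' tens' gen') :
    ∃ α : (M ⧸ N) ≃ₗ[𝕜] (M' ⧸ N'),
      (∀ z t, α (S.qRep z t) = S'.qRep z (α t)) ∧
      (∀ i, ((block ρ tens gen i).map N.mkQ).map α.toLinearMap =
        (block ρ' tens' gen' i).map N'.mkQ) ∧
      ∀ β : (M ⧸ N) →ₗ[𝕜] (M' ⧸ N'), (∀ z t, β (S.qRep z t) = S'.qRep z (β t)) →
        (∀ i, ((block ρ tens gen i).map N.mkQ).map β ≤ (block ρ' tens' gen' i).map N'.mkQ) →
        ∀ i, ∃ s : 𝕜, ∀ t ∈ (block ρ tens gen i).map N.mkQ, β t = s • α t := by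
  simp only [S.map_block hq, S'.map_block hq]
  obtain ⟨α, hα, hαv⟩ := exists_equiv_of_highest hq S.locNilp_qRep S'.locNilp_qRep
    (S.isHW_mkQ_vec hq) (S'.isHW_mkQ_vec hq) (S.iSupIndep_cyc_mkQ hq) (S'.iSupIndep_cyc_mkQ hq)
    (S.iSup_cyc_mkQ hq) (S'.iSup_cyc_mkQ hq)
  refine ⟨α, hα, fun i => ?_, fun β hβ hβi i => ?_⟩
  · rw [map_cyc (ρ' := S'.qRep) α.toLinearMap (fun x => hα _ x), LinearEquiv.coe_coe, hαv]
  · exact eq_smul_on_cyc hq S'.locNilp_qRep (S.isHW_mkQ_vec hq i) (S'.isHW_mkQ_vec hq i)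
      (α := α.toLinearMap) (fun x => hα _ x) hβ (hαv i)
      (hβi i (Submodule.mem_map_of_mem (self_mem_cyc _)))

end TangentData

end Tangent

/-! ### The left and the right tangent module -/

section TensorStable

variable {𝕜 : Type*} [Field 𝕜] {q : 𝕜ˣ} {M N : Type*} [AddCommGroup M] [Module 𝕜 M]
  [AddCommGroup N] [Module 𝕜 N]

theorem range_rTensor_stable {ρ : UqRep q M} (σ : UqRep q N) {P : Submodule 𝕜 M}
    (hP : ∀ z, ∀ m ∈ P, ρ z m ∈ P) (z : Uq q) :
    ∀ x ∈ LinearMap.range (LinearMap.rTensor N P.subtype),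
      tensorRep ρ σ z x ∈ LinearMap.range (LinearMap.rTensor N P.subtype) := by
  have hmem : ∀ m ∈ P, ∀ n : N, m ⊗ₜ[𝕜] n ∈ LinearMap.range (LinearMap.rTensor N P.subtype) :=
    fun m hm n => ⟨(⟨m, hm⟩ : P) ⊗ₜ n, by simp⟩
  refine stable_of_gen _ _ (fun g x hx => ?_) z
  obtain ⟨y, rfl⟩ := hx
  induction y using TensorProduct.induction_on with
  | zero => simp
  | add a b ha hb =>
    rw [map_add, map_add]
    exact Submodule.add_mem _ ha hb
  | tmul m n =>
    rw [LinearMap.rTensor_tmul, Submodule.subtype_apply]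
    cases g with
    | X =>
      rw [tensorRep_X]
      exact Submodule.add_mem _ (hmem _ (hP _ _ m.2) _) (hmem _ (hP _ _ m.2) _)
    | Y =>
      rw [tensorRep_Y]
      exact Submodule.add_mem _ (hmem _ m.2 _) (hmem _ (hP _ _ m.2) _)
    | K => rw [tensorRep_K]; exact hmem _ (hP _ _ m.2) _
    | Kinv => rw [tensorRep_Kinv]; exact hmem _ (hP _ _ m.2) _

theorem range_lTensor_stable (ρ : UqRep q M) {σ : UqRep q N} {P : Submodule 𝕜 N}
    (hP : ∀ z, ∀ m ∈ P, σ z m ∈ P) (z : Uq q) :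
    ∀ x ∈ LinearMap.range (LinearMap.lTensor M P.subtype),
      tensorRep ρ σ z x ∈ LinearMap.range (LinearMap.lTensor M P.subtype) := by
  have hmem : ∀ (m : M), ∀ n ∈ P, m ⊗ₜ[𝕜] n ∈ LinearMap.range (LinearMap.lTensor M P.subtype) :=
    fun m n hn => ⟨m ⊗ₜ (⟨n, hn⟩ : P), by simp⟩
  refine stable_of_gen _ _ (fun g x hx => ?_) z
  obtain ⟨y, rfl⟩ := hx
  induction y using TensorProduct.induction_on with
  | zero => simp
  | add a b ha hb =>
    rw [map_add, map_add]
    exact Submodule.add_mem _ ha hb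
  | tmul m n =>
    rw [LinearMap.lTensor_tmul, Submodule.subtype_apply]
    cases g with
    | X =>
      rw [tensorRep_X]
      exact Submodule.add_mem _ (hmem _ _ n.2) (hmem _ _ (hP _ _ n.2))
    | Y =>
      rw [tensorRep_Y]
      exact Submodule.add_mem _ (hmem _ _ (hP _ _ n.2)) (hmem _ _ (hP _ _ n.2))
    | K => rw [tensorRep_K]; exact hmem _ _ (hP _ _ n.2)
    | Kinv => rw [tensorRep_Kinv]; exact hmem _ _ (hP _ _ n.2)

end TensorStable

section Sides

variable {𝕜 : Type*} [Field 𝕜] {q : 𝕜ˣ} (c : 𝕜)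

local notation "u" => qhGen q c 0
local notation "v" => qhGen q c 1
local notation "w" => qhGen q c 2

theorem cyc_vRep (hq : ∀ n : ℕ, 0 < n → q ^ n ≠ 1) : cyc (vRep q) (basisV 𝕜 0) = ⊤ := by
  have h0 := self_mem_cyc (ρ := vRep q) (basisV 𝕜 0)
  have h1 := opY_pow_mem_cyc (ρ := vRep q) (basisV 𝕜 0) 1
  have h2 := opY_pow_mem_cyc (ρ := vRep q) (basisV 𝕜 0) 2
  simp only [pow_succ', pow_zero, mul_one, Module.End.mul_apply, vRep_Y_u, map_neg, vRep_Y_v,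
    Submodule.neg_mem_iff, Submodule.smul_mem_iff _ (add_inv_ne_zero hq)] at h1 h2
  rw [eq_top_iff]
  intro m _
  rw [basisV_expand m]
  exact Submodule.add_mem _ (Submodule.add_mem _ (Submodule.smul_mem _ _ h0)
    (Submodule.smul_mem _ _ h1)) (Submodule.smul_mem _ _ h2)

/-- Weight vectors in coordinates, given the action of `K` in coordinates. -/
theorem mem_wtSpace_iff_coord {M : Type*} [AddCommGroup M] [Module 𝕜 M] {ρ : UqRep q M}
    {e : M ≃ₗ[𝕜] (Fin 3 → QH q c)} (h0 : ∀ m, e (ρ (uqGen q .K) m) 0 = (q : 𝕜) ^ 2 • qhK q c (e m 0))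
    (h1 : ∀ m, e (ρ (uqGen q .K) m) 1 = qhK q c (e m 1))
    (h2 : ∀ m, e (ρ (uqGen q .K) m) 2 = ((q : 𝕜)⁻¹) ^ 2 • qhK q c (e m 2)) (n : ℤ) (m : M) :
    m ∈ wtSpace ρ n ↔ e m 0 ∈ wtSpace (qhRep q c) (n - 1) ∧
      e m 1 ∈ wtSpace (qhRep q c) n ∧ e m 2 ∈ wtSpace (qhRep q c) (n + 1) := by
  have hq2 : (q : 𝕜) ^ 2 ≠ 0 := pow_ne_zero _ q.ne_zero
  have e1 : (q : 𝕜) ^ (2 * (n - 1)) = ((q : 𝕜) ^ 2)⁻¹ * (q : 𝕜) ^ (2 * n) := by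
    rw [mul_sub, zpow_sub₀ q.ne_zero, div_eq_inv_mul]
    norm_cast
  have e2 : (q : 𝕜) ^ (2 * (n + 1)) = (q : 𝕜) ^ 2 * (q : 𝕜) ^ (2 * n) := by
    rw [mul_add, zpow_add₀ q.ne_zero, mul_comm]
    norm_cast
  rw [mem_wtSpace, mem_wtSpace, mem_wtSpace, mem_wtSpace, qhRep_K, qhRep_K, qhRep_K, e1, e2,
    mul_smul, mul_smul, ← e.injective.eq_iff, funext_iff, Fin.forall_fin_succ, Fin.forall_fin_two]
  simp only [Fin.succ_zero_eq_one, Fin.succ_one_eq_two, h0, h1, h2, map_smul, Pi.smul_apply]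
  rw [eq_inv_smul_iff₀ hq2, inv_pow, inv_smul_eq_iff₀ hq2]

theorem cube_add_ne_zero (hq : ∀ n : ℕ, 0 < n → q ^ n ≠ 1) : (q : 𝕜) ^ 3 + (q : 𝕜) ≠ 0 := by
  convert mul_ne_zero (pow_ne_zero 2 q.ne_zero) (add_inv_ne_zero hq) using 1
  have := q.ne_zero
  field_simp

/-- Coordinates on the free left module. -/
def coordL : ML q c ≃ₗ[𝕜] (Fin 3 → QH q c) := TensorProduct.piScalarRight 𝕜 𝕜 (QH q c) (Fin 3)

/-- Coordinates on the free right module. -/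
def coordR : MR q c ≃ₗ[𝕜] (Fin 3 → QH q c) :=
  (TensorProduct.comm 𝕜 (V 𝕜) (QH q c)).trans (coordL c)

@[simp] theorem coordL_tmul (a : QH q c) (y : V 𝕜) (i : Fin 3) :
    coordL c (a ⊗ₜ y) i = y i • a := by
  simp [coordL]

@[simp] theorem coordR_tmul (a : QH q c) (y : V 𝕜) (i : Fin 3) :
    coordR c (y ⊗ₜ a) i = y i • a := by
  simp [coordR]

/-- Linear maps on the left module are determined by their values on the `aU`, `aV`, `aW`. -/
theorem ml_ext {Z : Type*} [AddCommGroup Z] [Module 𝕜 Z] {f g : ML q c →ₗ[𝕜] Z}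
    (h : ∀ a i, f (a ⊗ₜ basisV 𝕜 i) = g (a ⊗ₜ basisV 𝕜 i)) (m : ML q c) : f m = g m := by
  induction m using TensorProduct.induction_on with
  | zero => simp
  | add a b ha hb => simp [ha, hb]
  | tmul a y =>
    rw [basisV_expand y]
    simp only [TensorProduct.tmul_add, TensorProduct.tmul_smul, map_add, map_smul, h]

/-- Linear maps on the right module are determined by their values on the `Ua`, `Va`, `Wa`. -/
theorem mr_ext {Z : Type*} [AddCommGroup Z] [Module 𝕜 Z] {f g : MR q c →ₗ[𝕜] Z}
    (h : ∀ a i, f (basisV 𝕜 i ⊗ₜ a) = g (basisV 𝕜 i ⊗ₜ a)) (m : MR q c) : f m = g m := by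
  induction m using TensorProduct.induction_on with
  | zero => simp
  | add a b ha hb => simp [ha, hb]
  | tmul y a =>
    rw [basisV_expand y]
    simp only [TensorProduct.add_tmul, ← TensorProduct.smul_tmul', map_add, map_smul, h]

theorem coordL_X_zero (m : ML q c) : coordL c (opX (mlRep q c) m) 0 =
    (1 : 𝕜) • qhX q c (coordL c m 0) -
      ((q : 𝕜) + (q : 𝕜)⁻¹) • qhKinv q c (coordL c m 1) := by
  refine ml_ext c (f := LinearMap.proj 0 ∘ₗ (coordL c).toLinearMap ∘ₗ opX (mlRep q c))
    (g := (1 : 𝕜) • (qhX q c ∘ₗ LinearMap.proj 0 ∘ₗ (coordL c).toLinearMap) -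
      ((q : 𝕜) + (q : 𝕜)⁻¹) • ((qhKinv q c).toLinearMap ∘ₗ LinearMap.proj 1 ∘ₗ
        (coordL c).toLinearMap)) (fun a i => ?_) m
  fin_cases i <;>
    simp [mlRep, tensorRep_X, vRep_X_u, vRep_X_v, vRep_X_w, qhRep_X, qhRep_Kinv,
      -neg_add_rev] <;>
    simp [basisV, -neg_add_rev]

theorem coordL_X_one (m : ML q c) : coordL c (opX (mlRep q c) m) 1 =
    qhX q c (coordL c m 1) + qhKinv q c (coordL c m 2) := by
  refine ml_ext c (f := LinearMap.proj 1 ∘ₗ (coordL c).toLinearMap ∘ₗ opX (mlRep q c))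
    (g := qhX q c ∘ₗ LinearMap.proj 1 ∘ₗ (coordL c).toLinearMap +
      (qhKinv q c).toLinearMap ∘ₗ LinearMap.proj 2 ∘ₗ (coordL c).toLinearMap) (fun a i => ?_) m
  fin_cases i <;>
    simp [mlRep, tensorRep_X, vRep_X_u, vRep_X_v, vRep_X_w, qhRep_X, qhRep_Kinv] <;>
    simp [basisV]

theorem coordL_X_two (m : ML q c) : coordL c (opX (mlRep q c) m) 2 =
    (1 : 𝕜) • qhX q c (coordL c m 2) := by
  refine ml_ext c (f := LinearMap.proj 2 ∘ₗ (coordL c).toLinearMap ∘ₗ opX (mlRep q c))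
    (g := (1 : 𝕜) • (qhX q c ∘ₗ LinearMap.proj 2 ∘ₗ (coordL c).toLinearMap)) (fun a i => ?_) m
  fin_cases i <;>
    simp [mlRep, tensorRep_X, vRep_X_u, vRep_X_v, vRep_X_w, qhRep_X, qhRep_Kinv] <;>
    simp [basisV]

theorem coordL_K (m : ML q c) (i : Fin 3) : coordL c (mlRep q c (uqGen q .K) m) i =
    (![(q : 𝕜) ^ 2, 1, ((q : 𝕜)⁻¹) ^ 2] i) • qhK q c (coordL c m i) := by
  refine ml_ext c (f := LinearMap.proj i ∘ₗ (coordL c).toLinearMap ∘ₗ mlRep q c (uqGen q .K))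
    (g := (![(q : 𝕜) ^ 2, 1, ((q : 𝕜)⁻¹) ^ 2] i) •
      ((qhK q c).toLinearMap ∘ₗ LinearMap.proj i ∘ₗ (coordL c).toLinearMap)) (fun a j => ?_) m
  fin_cases j <;>
    simp [mlRep, tensorRep_K, vRep_K_u, vRep_K_v, vRep_K_w, qhRep_K] <;>
    fin_cases i <;> simp [basisV]

theorem coordR_X_zero (m : MR q c) : coordR c (opX (mrRep q c) m) 0 =
    ((q : 𝕜)⁻¹) ^ 2 • qhX q c (coordR c m 0) -
      ((q : 𝕜) + (q : 𝕜)⁻¹) • (LinearMap.id : QH q c →ₗ[𝕜] QH q c) (coordR c m 1) := by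
  refine mr_ext c (f := LinearMap.proj 0 ∘ₗ (coordR c).toLinearMap ∘ₗ opX (mrRep q c))
    (g := ((q : 𝕜)⁻¹) ^ 2 • (qhX q c ∘ₗ LinearMap.proj 0 ∘ₗ (coordR c).toLinearMap) -
      ((q : 𝕜) + (q : 𝕜)⁻¹) • (LinearMap.proj 1 ∘ₗ (coordR c).toLinearMap)) (fun a i => ?_) m
  fin_cases i <;>
    simp [mrRep, tensorRep_X, vRep_X_u, vRep_X_v, vRep_X_w, vRep_Kinv_u, vRep_Kinv_v,
      vRep_Kinv_w, qhRep_X, -neg_add_rev] <;>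
    simp [basisV, -neg_add_rev]

theorem coordR_X_one (m : MR q c) : coordR c (opX (mrRep q c) m) 1 =
    qhX q c (coordR c m 1) + (LinearMap.id : QH q c →ₗ[𝕜] QH q c) (coordR c m 2) := by
  refine mr_ext c (f := LinearMap.proj 1 ∘ₗ (coordR c).toLinearMap ∘ₗ opX (mrRep q c))
    (g := qhX q c ∘ₗ LinearMap.proj 1 ∘ₗ (coordR c).toLinearMap +
      LinearMap.proj 2 ∘ₗ (coordR c).toLinearMap) (fun a i => ?_) m
  fin_cases i <;>
    simp [mrRep, tensorRep_X, vRep_X_u, vRep_X_v, vRep_X_w, vRep_Kinv_u, vRep_Kinv_v,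
      vRep_Kinv_w, qhRep_X] <;>
    simp [basisV]

theorem coordR_X_two (m : MR q c) : coordR c (opX (mrRep q c) m) 2 =
    (q : 𝕜) ^ 2 • qhX q c (coordR c m 2) := by
  refine mr_ext c (f := LinearMap.proj 2 ∘ₗ (coordR c).toLinearMap ∘ₗ opX (mrRep q c))
    (g := (q : 𝕜) ^ 2 • (qhX q c ∘ₗ LinearMap.proj 2 ∘ₗ (coordR c).toLinearMap)) (fun a i => ?_) m
  fin_cases i <;>
    simp [mrRep, tensorRep_X, vRep_X_u, vRep_X_v, vRep_X_w, vRep_Kinv_u, vRep_Kinv_v,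
      vRep_Kinv_w, qhRep_X] <;>
    simp [basisV]

theorem coordR_K (m : MR q c) (i : Fin 3) : coordR c (mrRep q c (uqGen q .K) m) i =
    (![(q : 𝕜) ^ 2, 1, ((q : 𝕜)⁻¹) ^ 2] i) • qhK q c (coordR c m i) := by
  refine mr_ext c (f := LinearMap.proj i ∘ₗ (coordR c).toLinearMap ∘ₗ mrRep q c (uqGen q .K))
    (g := (![(q : 𝕜) ^ 2, 1, ((q : 𝕜)⁻¹) ^ 2] i) •
      ((qhK q c).toLinearMap ∘ₗ LinearMap.proj i ∘ₗ (coordR c).toLinearMap)) (fun a j => ?_) m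
  fin_cases j <;>
    simp [mrRep, tensorRep_K, vRep_K_u, vRep_K_v, vRep_K_w, qhRep_K] <;>
    fin_cases i <;> simp [basisV]

theorem mem_tensL_iff (k : ℕ) (m : ML q c) : m ∈ tensL q c k ↔ ∀ i, coordL c m i ∈ Vk q c k := by
  constructor
  · rintro ⟨x, rfl⟩ i
    induction x using TensorProduct.induction_on with
    | zero => simp
    | add a b ha hb =>
      rw [map_add, map_add]
      exact Submodule.add_mem _ ha hb
    | tmul a y => simpa using Submodule.smul_mem _ (y i) a.2
  · intro h
    have e : m = ∑ i, coordL c m i ⊗ₜ[𝕜] basisV 𝕜 i := by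
      refine ml_ext c (f := LinearMap.id) (g := ∑ i, (TensorProduct.mk 𝕜 _ _).flip (basisV 𝕜 i) ∘ₗ
        LinearMap.proj i ∘ₗ (coordL c).toLinearMap) (fun a i => ?_) m |>.trans (by simp)
      fin_cases i <;> simp [Fin.sum_univ_three] <;> simp [basisV]
    rw [e]
    exact Submodule.sum_mem _ fun i _ => ⟨(⟨_, h i⟩ : Vk q c k) ⊗ₜ basisV 𝕜 i, by simp⟩

theorem mem_tensR_iff (k : ℕ) (m : MR q c) : m ∈ tensR q c k ↔ ∀ i, coordR c m i ∈ Vk q c k := by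
  constructor
  · rintro ⟨x, rfl⟩ i
    induction x using TensorProduct.induction_on with
    | zero => simp
    | add a b ha hb =>
      rw [map_add, map_add]
      exact Submodule.add_mem _ ha hb
    | tmul y a => simpa using Submodule.smul_mem _ (y i) a.2
  · intro h
    have e : m = ∑ i, basisV 𝕜 i ⊗ₜ[𝕜] coordR c m i := by
      refine mr_ext c (f := LinearMap.id) (g := ∑ i, TensorProduct.mk 𝕜 _ _ (basisV 𝕜 i) ∘ₗ
        LinearMap.proj i ∘ₗ (coordR c).toLinearMap) (fun a i => ?_) m |>.trans (by simp)
      fin_cases i <;> simp [Fin.sum_univ_three] <;> simp [basisV]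
    rw [e]
    exact Submodule.sum_mem _ fun i _ => ⟨basisV 𝕜 i ⊗ₜ (⟨_, h i⟩ : Vk q c k), by simp⟩

theorem coordL_smul_KL (f : QH q c) : coordL c (f • KL q c) =
    ![((q : 𝕜) + (q : 𝕜)⁻¹) • (f * w), f * v, ((q : 𝕜) ^ 3 + (q : 𝕜)) • (f * u)] := by
  ext i
  rw [smul_KL]
  fin_cases i <;> simp <;> simp [basisV]

theorem coordR_rightMul_KR (f : QH q c) : coordR c (rightMul q c f (KR q c)) =
    ![((q : 𝕜) ^ 3 + (q : 𝕜)) • (w * f), v * f, ((q : 𝕜) + (q : 𝕜)⁻¹) • (u * f)] := by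
  ext i
  rw [rightMul_KR]
  fin_cases i <;> simp <;> simp [basisV]

/-- The right submodule generated by `κ` consists of the multiples `κ f`. -/
theorem exists_of_mem_NR {m : MR q c} (hm : m ∈ NR q c) :
    ∃ f, m = rightMul q c f (KR q c) := by
  induction hm using Submodule.span_induction with
  | mem x hx =>
    obtain ⟨f, rfl⟩ := hx
    exact ⟨f, rfl⟩
  | zero => exact ⟨0, by simp [rightMul_KR]⟩
  | add x y _ _ hx hy =>
    obtain ⟨f, rfl⟩ := hx
    obtain ⟨g, rfl⟩ := hy
    refine ⟨f + g, (coordR c).injective ?_⟩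
    rw [map_add]
    simp only [coordR_rightMul_KR, mul_add, smul_add]
    simp
  | smul r x _ hx =>
    obtain ⟨f, rfl⟩ := hx
    refine ⟨r • f, (coordR c).injective ?_⟩
    rw [map_smul]
    simp only [coordR_rightMul_KR, mul_smul_comm, smul_comm _ r]
    simp

variable (hq : ∀ n : ℕ, 0 < n → q ^ n ≠ 1)
include hq

theorem blockL_gen_eq : blockL q c .gen = cyc (mlRep q c) ((coordL c).symm ![1, 0, 0]) := by
  have e : (coordL c).symm ![1, 0, 0] = TensorProduct.mk 𝕜 (QH q c) (V 𝕜) 1 (basisV 𝕜 0) := by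
    rw [LinearEquiv.symm_apply_eq]
    ext i
    fin_cases i <;> simp <;> simp [basisV]
  rw [e, ← map_cyc (ρ := vRep q) (ρ' := mlRep q c), cyc_vRep hq, Submodule.map_top]
  · rfl
  · intro y
    have h1 : qhY q c 1 = 0 := by simpa using qhY_algebraMap q c 1
    simp [mlRep, tensorRep_Y, qhRep_Y, h1]

theorem blockR_gen_eq : blockR q c .gen = cyc (mrRep q c) ((coordR c).symm ![1, 0, 0]) := by
  have e : (coordR c).symm ![1, 0, 0] =
      (TensorProduct.mk 𝕜 (V 𝕜) (QH q c)).flip 1 (basisV 𝕜 0) := by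
    rw [LinearEquiv.symm_apply_eq]
    ext i
    fin_cases i <;> simp <;> simp [basisV]
  rw [e, ← map_cyc (ρ := vRep q) (ρ' := mrRep q c), cyc_vRep hq, Submodule.map_top]
  · rfl
  · intro y
    have h1 : qhY q c 1 = 0 := by simpa using qhY_algebraMap q c 1
    simp [mrRep, tensorRep_Y, qhRep_Y, qhRep_K, h1]

/-- A multiple of `uⁿ κ`, normalized to have coefficient `u^(n+1)` at `W`. -/
theorem exists_kappa_left (n : ℕ) : ∃ m ∈ (NL q c).restrictScalars 𝕜, m ∈ wtSpace (mlRep q c) n ∧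
    opX (mlRep q c) m = 0 ∧ coordL c m 2 = u ^ (n + 1) ∧ coordL c m 1 ∈ Vk q c (n + 1) := by
  have h3 := cube_add_ne_zero hq
  have hmem : u ^ n • KL q c ∈ (NL q c).restrictScalars 𝕜 :=
    Submodule.mem_span_singleton.mpr ⟨_, rfl⟩
  have hc := coordL_smul_KL c (u ^ n)
  generalize u ^ n • KL q c = y at hmem hc
  refine ⟨((q : 𝕜) ^ 3 + (q : 𝕜))⁻¹ • y, Submodule.smul_mem _ _ hmem,
    Submodule.smul_mem _ _ ?_, ?_, ?_, ?_⟩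
  · rw [mem_wtSpace_iff_coord c (fun m => coordL_K c m 0)
      (fun m => (coordL_K c m 1).trans (by simp)) (fun m => coordL_K c m 2), hc]
    have hu := u_pow_mem_wtSpace (q := q) c n
    refine ⟨Submodule.smul_mem _ _ ?_, ?_, Submodule.smul_mem _ _ ?_⟩
    · simpa only [sub_eq_add_neg] using mul_mem_wtSpace c hu (w_mem_wtSpace c)
    · simpa using mul_mem_wtSpace c hu (v_mem_wtSpace c)
    · simpa [← pow_succ] using u_pow_mem_wtSpace (q := q) c (n + 1)
  · rw [map_smul]
    refine smul_eq_zero_of_right _ ((coordL c).injective ?_)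
    have hq0 : (q : 𝕜) ≠ 0 := q.ne_zero
    ext i
    fin_cases i
    · refine (coordL_X_zero c _).trans ?_
      simp [hc, qhX_mul, qhX_u_pow]
    · refine (coordL_X_one c _).trans ?_
      simp [hc, qhX_mul, qhX_u_pow, -neg_add_rev]
      match_scalars
      field_simp
      ring
    · refine (coordL_X_two c _).trans ?_
      simp [hc, qhX_mul, qhX_u_pow]
  · simp [hc, smul_smul, h3, pow_succ u]
  · rw [map_smul, hc]
    exact Submodule.smul_mem _ _ (u_pow_mul_v_mem_Vk hq c n)

/-- The left tangent module in coordinates. -/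
def leftData : TangentData (c := c) (mlRep q c) ((NL q c).restrictScalars 𝕜) (tensL q c)
    (blockL q c .gen) where
  coord := coordL c
  r₀ := 1
  r₂ := 1
  τ := (qhKinv q c).toLinearMap
  t n := ((q : 𝕜) ^ (2 * n))⁻¹
  r₀_ne_zero := one_ne_zero
  r₂_ne_zero := one_ne_zero
  t_ne_zero n := inv_ne_zero (pow_ne_zero _ q.ne_zero)
  τ_u_pow n := qhKinv_u_pow c n
  coord_X_zero := coordL_X_zero c
  coord_X_one := coordL_X_one c
  coord_X_two := coordL_X_two c
  mem_wt_iff := mem_wtSpace_iff_coord c (fun m => coordL_K c m 0)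
    (fun m => (coordL_K c m 1).trans (by simp)) (fun m => coordL_K c m 2)
  locNilp := (locNilp_qhRep c).tensor locNilp_vRep
  stable := NL_stable q c
  eq_zero_of_mem m hm h := by
    obtain ⟨f, rfl⟩ := Submodule.mem_span_singleton.mp hm
    rw [coordL_smul_KL] at h
    have h' : ((q : 𝕜) ^ 3 + (q : 𝕜)) • (f * u) = 0 := h
    rw [smul_eq_zero, or_iff_right (cube_add_ne_zero hq)] at h'
    rw [eq_zero_of_mul_u hq c h', zero_smul]
  exists_kappa := exists_kappa_left c hq
  mem_tens_iff := mem_tensL_iff c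
  tens_stable k := range_rTensor_stable _ (Vk_stable hq c k)
  gen_eq := blockL_gen_eq c hq

/-- The right tangent module in coordinates. -/
def rightData : TangentData (c := c) (mrRep q c) (NR q c) (tensR q c) (blockR q c .gen) where
  coord := coordR c
  r₀ := ((q : 𝕜)⁻¹) ^ 2
  r₂ := (q : 𝕜) ^ 2
  τ := LinearMap.id
  t _ := 1
  r₀_ne_zero := pow_ne_zero _ (inv_ne_zero q.ne_zero)
  r₂_ne_zero := pow_ne_zero _ q.ne_zero
  t_ne_zero _ := one_ne_zero
  τ_u_pow n := by simp
  coord_X_zero := coordR_X_zero c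
  coord_X_one := coordR_X_one c
  coord_X_two := coordR_X_two c
  mem_wt_iff := mem_wtSpace_iff_coord c (fun m => coordR_K c m 0)
    (fun m => (coordR_K c m 1).trans (by simp)) (fun m => coordR_K c m 2)
  locNilp := locNilp_vRep.tensor (locNilp_qhRep c)
  stable := NR_stable q c
  eq_zero_of_mem m hm h := by
    obtain ⟨f, rfl⟩ := exists_of_mem_NR c hm
    rw [coordR_rightMul_KR] at h
    have h' : ((q : 𝕜) + (q : 𝕜)⁻¹) • (u * f) = 0 := h
    rw [smul_eq_zero, or_iff_right (add_inv_ne_zero hq)] at h'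
    simp [eq_zero_of_u_mul hq c h', rightMul_KR]
  exists_kappa n := by
    have h3 := add_inv_ne_zero hq
    refine ⟨((q : 𝕜) + (q : 𝕜)⁻¹)⁻¹ • rightMul q c (u ^ n) (KR q c), Submodule.smul_mem _ _
      (Submodule.subset_span ⟨_, rfl⟩), Submodule.smul_mem _ _ ?_, ?_, ?_, ?_⟩
    · rw [mem_wtSpace_iff_coord c (fun m => coordR_K c m 0)
        (fun m => (coordR_K c m 1).trans (by simp)) (fun m => coordR_K c m 2), coordR_rightMul_KR]
      have hu := u_pow_mem_wtSpace (q := q) c n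
      refine ⟨Submodule.smul_mem _ _ ?_, ?_, Submodule.smul_mem _ _ ?_⟩
      · have := mul_mem_wtSpace c (w_mem_wtSpace c) hu
        rwa [neg_add_eq_sub] at this
      · simpa using mul_mem_wtSpace c (v_mem_wtSpace c) hu
      · simpa [← pow_succ'] using u_pow_mem_wtSpace (q := q) c (n + 1)
    · rw [map_smul]
      refine smul_eq_zero_of_right _ ((coordR c).injective ?_)
      have hq0 : (q : 𝕜) ≠ 0 := q.ne_zero
      ext i
      fin_cases i
      · refine (coordR_X_zero c _).trans ?_
        simp [coordR_rightMul_KR, qhX_mul, qhX_u_pow]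
        match_scalars
        field_simp
        ring
      · refine (coordR_X_one c _).trans ?_
        simp [coordR_rightMul_KR, qhX_mul, qhX_u_pow, -neg_add_rev]
      · refine (coordR_X_two c _).trans ?_
        simp [coordR_rightMul_KR, qhX_mul, qhX_u_pow]
    · simp [coordR_rightMul_KR, smul_smul, h3, pow_succ']
    · rw [map_smul, coordR_rightMul_KR]
      refine Submodule.smul_mem _ _ ?_
      change v * u ^ n ∈ _
      rw [v_mul_u_pow]
      exact Submodule.smul_mem _ _ (u_pow_mul_v_mem_Vk hq c n)
  mem_tens_iff := mem_tensR_iff c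
  tens_stable k := range_lTensor_stable _ (Vk_stable hq c k)
  gen_eq := blockR_gen_eq c hq

omit hq in
theorem block_left (i : BasisIdx) :
    TangentData.block (mlRep q c) (tensL q c) (blockL q c .gen) i = blockL q c i := by
  cases i <;> rfl

omit hq in
theorem block_right (i : BasisIdx) :
    TangentData.block (mrRep q c) (tensR q c) (blockR q c .gen) i = blockR q c i := by
  cases i <;> rfl

end Sides

end
end QHyp

open QHyp in
theorem proposition7p1 {𝕜 : Type*} [RCLike 𝕜] (q : 𝕜ˣ) (c : 𝕜)
    (hq : ∀ n : ℕ, 0 < n → q ^ n ≠ 1) (hc : c ≠ 0) :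
    -- the basis of the left module
    ((∀ i, Set.InjOn (projL q c) (blockL q c i) ∧
        IsSpinModule (tlRep q c) i.spin (imageL q c i)) ∧
      iSupIndep (imageL q c) ∧ (⨆ i, imageL q c i) = ⊤ ∧
      -- the component of spin `k - 1`, for `k = n + 1`
      ∀ n, (compL q c (n + 1) n).map (projL q c) ≤ ⨆ j < n, (tensL q c j).map (projL q c)) ∧
    -- the basis of the right module
    ((∀ i, Set.InjOn (projR q c) (blockR q c i) ∧
        IsSpinModule (trRep q c) i.spin (imageR q c i)) ∧
      iSupIndep (imageR q c) ∧ (⨆ i, imageR q c i) = ⊤ ∧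
      ∀ n, (compR q c (n + 1) n).map (projR q c) ≤ ⨆ j < n, (tensR q c j).map (projR q c)) ∧
    -- the identification
    (∃ α : TL q c ≃ₗ[𝕜] TR q c,
      (∀ z t, α (tlRep q c z t) = trRep q c z (α t)) ∧
      (∀ i, (imageL q c i).map α.toLinearMap = imageR q c i) ∧
      ∀ β : TL q c →ₗ[𝕜] TR q c, (∀ z t, β (tlRep q c z t) = trRep q c z (β t)) →
        (∀ i, (imageL q c i).map β ≤ imageR q c i) →
        ∀ i, ∃ s : 𝕜, ∀ t ∈ imageL q c i, β t = s • α t) := by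
  have hL := (leftData c hq).decomposition hq
  have hR := (rightData c hq).decomposition hq
  have hα := (leftData c hq).exists_identification hq (rightData c hq)
  simp only [block_left, block_right] at hL hR hα
  exact ⟨hL, hR, hα⟩
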